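/- Let $I=(0,1)$, let $\lambda_n>0$, $\delta_n>0$ be sequences with $\lambda_n\to0$, $\delta_n\to0$, and put $N_n=\lfloor 1/\lambda_n\rfloor$. Consider chains of spins $u=(u^0,\dots,u^{N_n})$ with $u^i\in S^1\subset\mathbb R^2$ satisfying the boundary condition $(u^1,u^0)=(u^{N_n},u^{N_n-1})$, with energy (for ferromagnetic parameter $J_1=4(1-\delta_n)$) $$H_n^{hf}(u)=\frac12\sum_{i=0}^{N_n-2}\lambda_n\left|u^{i+2}-2(1-\delta_n)u^{i+1}+u^i\right|^2 .$$ For $i=0,\dots,N_n-1$ let $\theta_n^i=\chi[u^i,u^{i+1}]\arccos\big((u^i,u^{i+1})\big)\in[-\pi,\pi)$, where $\chi[v,w]=\operatorname{sign}(v_1w_2-v_2w_1)$ with $\operatorname{sign}(0)=-1$, and let $z_n^i=\sqrt{2/\delta_n}\,\sin(\theta_n^i/2)$. A function $z\in L^1(I)$ is said to be associated with $u$ if $z=z_n^i$ a.e. on $\lambda_n(i+[0,1))$ for $i=0,\dots,N_n-1$. Since $z$ determines $u$ up to a rotation, which does not change the energy, we may set $H_n^{hf}(z)=H_n^{hf}(u)$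 if $z$ is associated with some such chain $u$, and $H_n^{hf}(z)=+\infty$ for all other $z\in L^1(I)$. Assume that $l:=\lim_n \lambda_n/(2\delta_n)^{1/2}\in[0,+\infty]$ exists. Then the functionals $H_n^{hf}/(\sqrt2\,\lambda_n\delta_n^{3/2})$ on $L^1(I)$ $\Gamma$-converge, with respect to $L^1(I)$ convergence, to the following functional $H^{hf}$. (i) If $l=0$: $H^{hf}(z)=\frac83\,\#S(z)$ if $z\in BV(I,\{\pm1\})$, and $+\infty$ otherwise, where $S(z)\subset I$ is the jump set of $z$. (ii) If $l\in(0,+\infty)$: $H^{hf}(z)=\frac1l\int_I(z^2-1)^2\,dx+l\int_I(z')^2\,dx$ if $z\in W^{1,2}(I)$ and $|z(0)|=|z(1)|$, and $+\infty$ otherwise. (iii) If $l=+\infty$: $H^{hf}(z)=0$ if $z$ is (a.e. equal to) a constant, and $+\infty$ otherwise. -/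

import Mathlib

open MeasureTheory Filter Topology
open scoped ENNReal NNReal ContDiff

namespace SpinChain

/-! ### Gamma-convergence -/

/-- Sequential `Γ`-convergence: the liminf inequality along every converging sequence and the
existence of a recovery sequence. (On a metrizable space, such as `L¹`, this is `Γ`-convergence.) -/
def GammaConverges {X : Type*} [TopologicalSpace X] (F : ℕ → X → ℝ≥0∞) (F₀ : X → ℝ≥0∞) : Prop :=
  ∀ z : X,
    (∀ y : ℕ → X, Tendsto y atTop (𝓝 z) → F₀ z ≤ liminf (fun n => F n (y n)) atTop) ∧
    (∃ y : ℕ → X, Tendsto y atTop (𝓝 z) ∧ limsup (fun n => F n (y n)) atTop ≤ F₀ z)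

/-! ### The discrete energy -/

/-- The unit circle `S¹` in `ℝ²`. -/
abbrev Circle1 : Type := Metric.sphere (0 : EuclideanSpace ℝ (Fin 2)) 1

/-- Scalar product of two spins. -/
noncomputable def dot (v w : Circle1) : ℝ :=
  inner ℝ (v : EuclideanSpace ℝ (Fin 2)) (w : EuclideanSpace ℝ (Fin 2))

/-- `χ[v,w] = sign (v₁ w₂ - v₂ w₁)` with the convention `sign 0 = -1`. -/
noncomputable def chi (v w : Circle1) : ℝ :=
  if 0 < v.1 0 * w.1 1 - v.1 1 * w.1 0 then 1 else -1

/-- The oriented central angle in `[-π, π)` from `v` to `w`. -/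
noncomputable def angle (v w : Circle1) : ℝ := chi v w * Real.arccos (dot v w)

/-- `[1/lam]`: the sites of the chain in `[0,1]` are `lam * i`, `i = 0, …, numCells lam`. -/
noncomputable def numCells (lam : ℝ) : ℕ := ⌊1 / lam⌋₊

/-- The boundary condition `(u¹,u⁰) = (u^N, u^{N-1})`. Configurations are functions on `ℕ`, of which
only the values at `0, …, N` are ever used. -/
def IsPeriodic (N : ℕ) (u : ℕ → Circle1) : Prop :=
  dot (u 1) (u 0) = dot (u N) (u (N - 1))

/-- The renormalized energy of a configuration,
`½ ∑_{i=0}^{[1/lam]-2} lam |u^{i+2} - 2 (1 - del) u^{i+1} + u^i|²`. -/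
noncomputable def spinEnergy (lam del : ℝ) (u : ℕ → Circle1) : ℝ :=
  (1 / 2) * ∑ i ∈ Finset.range (numCells lam - 1),
    lam * ‖(u (i + 2) : EuclideanSpace ℝ (Fin 2))
      - (2 * (1 - del)) • (u (i + 1) : EuclideanSpace ℝ (Fin 2))
      + (u i : EuclideanSpace ℝ (Fin 2))‖ ^ 2

/-- The chirality order parameter `zⁱ = √(2/del) sin (θⁱ / 2)`. -/
noncomputable def chirality (del : ℝ) (u : ℕ → Circle1) (i : ℕ) : ℝ :=
  Real.sqrt (2 / del) * Real.sin (angle (u i) (u (i + 1)) / 2)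

/-- Lebesgue measure on `I = (0,1)`. -/
noncomputable abbrev muI : Measure ℝ := volume.restrict (Set.Ioo 0 1)

/-- The space `L¹(I)`. -/
abbrev L1I : Type := Lp ℝ 1 muI

/-- `z` is the piecewise constant function associated with the order parameter of `u`: it is equal
to `zⁱ` on `lam (i + [0,1))` for `i = 0, …, [1/lam] - 1`. -/
def IsChiralityOf (lam del : ℝ) (u : ℕ → Circle1) (z : ℝ → ℝ) : Prop :=
  ∀ i < numCells lam, ∀ᵐ x ∂muI,
    x ∈ Set.Ico (lam * i) (lam * (i + 1)) → z x = chirality del u i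

/-- The energy as a functional on `L¹(I)`: the energy of any configuration `u` (with the boundary
condition) whose order parameter is `z`, and `+∞` if there is none. All such `u` differ by a
rotation and have the same energy, so the infimum is over at most one value. -/
noncomputable def Hhf (lam del : ℝ) (z : L1I) : ℝ≥0∞ :=
  ⨅ (u : ℕ → Circle1) (_ : IsPeriodic (numCells lam) u) (_ : IsChiralityOf lam del u z),
    ENNReal.ofReal (spinEnergy lam del u)

/-- The scaled energy `H(z) / (√2 lam del^{3/2})`. -/
noncomputable def scaledHhf (lam del : ℝ) (z : L1I) : ℝ≥0∞ :=
  Hhf lam del z / ENNReal.ofReal (Real.sqrt 2 * lam * del ^ (3 / 2 : ℝ))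

/-! ### Function spaces on `I = (0,1)` -/

/-- `φ ∈ C_c^∞(I)`. -/
def IsTestFun (φ : ℝ → ℝ) : Prop :=
  ContDiff ℝ ∞ φ ∧ HasCompactSupport φ ∧ tsupport φ ⊆ Set.Ioo 0 1

/-- `z ∈ BV(I, {±1})`, for a `z` that is integrable on `I`: the values are `±1` a.e. and the
variation `sup {∫ z φ' : φ ∈ C_c^∞(I), |φ| ≤ 1}` is finite. -/
def IsBVpm (z : ℝ → ℝ) : Prop :=
  (∀ᵐ x ∂muI, z x = 1 ∨ z x = -1) ∧
  ∃ C : ℝ, ∀ φ : ℝ → ℝ, IsTestFun φ → (∀ x, |φ x| ≤ 1) → ∫ x, z x * deriv φ x ∂muI ≤ C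

/-- The jump set `S(z)`: the points of `I` at which `z` has no approximate limit. -/
def jumpSet (z : ℝ → ℝ) : Set ℝ :=
  {x | x ∈ Set.Ioo (0 : ℝ) 1 ∧
    ¬ ∃ a : ℝ, Tendsto (fun r => ⨍ y in Metric.ball x r, |z y - a| ∂muI) (𝓝[>] 0) (𝓝 0)}

/-- `g ∈ L¹_loc(I)` is the weak derivative of `z` on `I`. -/
def IsWeakDeriv (z g : ℝ → ℝ) : Prop :=
  LocallyIntegrableOn g (Set.Ioo 0 1) ∧
  ∀ φ : ℝ → ℝ, IsTestFun φ → ∫ x, z x * deriv φ x ∂muI = - ∫ x, g x * φ x ∂muI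

/-- `z ∈ W^{1,2}(I)`. -/
def IsW12 (z : ℝ → ℝ) : Prop :=
  MemLp z 2 muI ∧ ∃ g : ℝ → ℝ, MemLp g 2 muI ∧ IsWeakDeriv z g

/-- `z ∈ W^{1,2}(I)` and `|z(0)| = |z(1)|`, the end values being those of the representative of `z`
that is continuous on `[0,1]`. -/
def IsW12per (z : ℝ → ℝ) : Prop :=
  IsW12 z ∧ ∃ w : ℝ → ℝ, ContinuousOn w (Set.Icc 0 1) ∧ z =ᵐ[muI] w ∧ |w 0| = |w 1|

open Classical in
/-- The weak derivative `z'` on `I` (unique up to null sets; `0` if there is none). -/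
noncomputable def weakDeriv (z : ℝ → ℝ) : ℝ → ℝ :=
  if h : ∃ g, IsWeakDeriv z g then h.choose else 0

/-! ### The limit functionals -/

open Classical in
/-- `(8/3) #S(z)` on `BV(I, {±1})`, `+∞` otherwise. -/
noncomputable def limitZero (z : L1I) : ℝ≥0∞ :=
  if IsBVpm z then (8 / 3 : ℝ≥0∞) * ((jumpSet z).encard : ℝ≥0∞) else ⊤

open Classical in
/-- `(1/l) ∫ (z² - 1)² + l ∫ (z')²` on the functions in `W^{1,2}(I)` with `|z(0)| = |z(1)|`,
`+∞` otherwise. -/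
noncomputable def limitFinite (l : ℝ) (z : L1I) : ℝ≥0∞ :=
  if IsW12per z then
    ENNReal.ofReal (1 / l) * (∫⁻ x, ENNReal.ofReal ((z x ^ 2 - 1) ^ 2) ∂muI)
      + ENNReal.ofReal l * (∫⁻ x, ENNReal.ofReal (weakDeriv z x ^ 2) ∂muI)
  else ⊤

open Classical in
/-- `0` on the constants, `+∞` otherwise. -/
noncomputable def limitTop (z : L1I) : ℝ≥0∞ :=
  if ∃ c : ℝ, z =ᵐ[muI] fun _ => c then 0 else ⊤

end SpinChain

namespace SpinChain

/-!
In terms of the chiralities `zⁱ` the energy is, up to a factor tending to `1` in the gradient term,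
`∑ h/4 ((zⁱ)² + (zⁱ⁺¹)² - 2)² + (zⁱ⁺¹ - zⁱ)² / h` with `h = √(2 del)`: a discrete Modica–Mortola
energy on a grid of step `lam`. If `lam / h → 0` the transitions between `1` and `-1`, of width
`lam / h`, become sharp; each costs `2 ∫_{-1}^1 (1 - s²) ds = 8/3`, attained by the profile
`tanh`. If `lam / h → l` in `(0, ∞)` the two terms are Riemann sums of `(1/l) ∫ (z² - 1)²` and
`l ∫ (z')²`, and the increments converge weakly in `L²` along sequences of bounded energy.
If `lam / h → ∞` a bounded energy leaves no room for increments, and the limits are constant.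
-/

/-! ### From spins to chiralities -/

/-- The determinant `v₁ w₂ - v₂ w₁` of two spins. -/
noncomputable def cross (v w : Circle1) : ℝ := v.1 0 * w.1 1 - v.1 1 * w.1 0

theorem Circle1.sq_add_sq (v : Circle1) : v.1 0 ^ 2 + v.1 1 ^ 2 = 1 := by
  have h : ‖v.1‖ ^ 2 = 1 := by simp
  simpa only [EuclideanSpace.norm_sq_eq, Fin.sum_univ_two, Real.norm_eq_abs, sq_abs] using h

theorem dot_eq (v w : Circle1) : dot v w = v.1 0 * w.1 0 + v.1 1 * w.1 1 := by
  simp [dot, PiLp.inner_apply, Fin.sum_univ_two, mul_comm]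

theorem dot_comm (v w : Circle1) : dot v w = dot w v := real_inner_comm _ _

theorem dot_sq_add_cross_sq (v w : Circle1) : dot v w ^ 2 + cross v w ^ 2 = 1 := by
  rw [dot_eq, cross]
  linear_combination (w.1 0 ^ 2 + w.1 1 ^ 2) * v.sq_add_sq + w.sq_add_sq

theorem cos_angle (v w : Circle1) : Real.cos (angle v w) = dot v w := by
  have h : |dot v w| ≤ 1 :=
    sq_le_one_iff_abs_le_one _ |>.1 (by linarith [dot_sq_add_cross_sq v w, sq_nonneg (cross v w)])
  have hcos := Real.cos_arccos (abs_le.1 h).1 (abs_le.1 h).2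
  unfold angle chi
  split_ifs
  · rwa [one_mul]
  · rwa [neg_one_mul, Real.cos_neg]

theorem sin_angle (v w : Circle1) : Real.sin (angle v w) = cross v w := by
  have hsin : Real.sin (Real.arccos (dot v w)) = |cross v w| := by
    rw [Real.sin_arccos, ← Real.sqrt_sq_eq_abs]
    congr 1
    linarith [dot_sq_add_cross_sq v w]
  unfold angle chi
  split_ifs with hc
  · rw [one_mul, hsin, abs_of_pos (show 0 < cross v w from hc)]
  · rw [neg_one_mul, Real.sin_neg, hsin, abs_of_nonpos (show cross v w ≤ 0 from not_lt.1 hc),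
      neg_neg]

theorem abs_angle_le_pi (v w : Circle1) : |angle v w| ≤ Real.pi := by
  have hchi : |chi v w| = 1 := by unfold chi; split_ifs <;> simp
  rw [angle, abs_mul, hchi, one_mul, abs_of_nonneg (Real.arccos_nonneg _)]
  exact Real.arccos_le_pi _

/-- The spin at angle `θ`. -/
noncomputable def spinAt (θ : ℝ) : Circle1 :=
  ⟨!₂[Real.cos θ, Real.sin θ], by simp [EuclideanSpace.norm_eq, Fin.sum_univ_two]⟩

theorem dot_spinAt (α β : ℝ) : dot (spinAt α) (spinAt β) = Real.cos (β - α) := by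
  rw [dot_eq, Real.cos_sub]
  simp [spinAt, mul_comm]

theorem cross_spinAt (α β : ℝ) : cross (spinAt α) (spinAt β) = Real.sin (β - α) := by
  rw [cross, Real.sin_sub]
  simp [spinAt, mul_comm]

theorem angle_spinAt {α θ : ℝ} (hθ : |θ| < Real.pi) :
    angle (spinAt α) (spinAt (α + θ)) = θ := by
  obtain ⟨hlt, hgt⟩ := abs_lt.1 hθ
  have hchi : chi (spinAt α) (spinAt (α + θ)) = if 0 < Real.sin θ then 1 else -1 := by
    rw [show Real.sin θ = cross (spinAt α) (spinAt (α + θ)) by simp [cross_spinAt], chi, cross]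
  rw [angle, hchi, dot_spinAt, add_sub_cancel_left]
  split_ifs with hsin
  · have h0 : 0 ≤ θ := by
      by_contra! h0
      linarith [Real.sin_neg_of_neg_of_neg_pi_lt h0 hlt]
    rw [one_mul, Real.arccos_cos h0 hgt.le]
  · have h0 : θ ≤ 0 := by
      by_contra! h0
      exact hsin (Real.sin_pos_of_pos_of_lt_pi h0 hgt)
    rw [← Real.cos_neg, Real.arccos_cos (by linarith) (by linarith), neg_one_mul, neg_neg]

/-- `z √(1 - δ z² / 2)`: up to the factor `√(2 δ)`, the sine of the angle whose chirality is `z`. -/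
noncomputable def scaledSine (δ z : ℝ) : ℝ := z * √(1 - δ * z ^ 2 / 2)

theorem hasDerivAt_scaledSine {δ z : ℝ} (hz : δ * z ^ 2 < 2) :
    HasDerivAt (scaledSine δ) ((1 - δ * z ^ 2) / √(1 - δ * z ^ 2 / 2)) z := by
  have hpos : 0 < 1 - δ * z ^ 2 / 2 := by linarith
  have hinner : HasDerivAt (fun z => 1 - δ * z ^ 2 / 2) (-(δ * z)) z :=
    ((((hasDerivAt_pow 2 z).const_mul δ).div_const 2).const_sub 1).congr_deriv (by norm_num; ring)
  refine ((hasDerivAt_id' z).mul (hinner.sqrt hpos.ne')).congr_deriv ?_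
  have hsq := Real.sq_sqrt hpos.le
  have hne : √(1 - δ * z ^ 2 / 2) ≠ 0 := (Real.sqrt_pos.2 hpos).ne'
  generalize √(1 - δ * z ^ 2 / 2) = s at hsq hne ⊢
  field_simp
  linear_combination 2 * hsq

theorem deriv_scaledSine_mem_Icc {ε t : ℝ} (hε : ε ≤ 1) (h0 : 0 ≤ t) (ht : t ≤ ε) :
    (1 - t) / √(1 - t / 2) ∈ Set.Icc (1 - ε) 1 := by
  have hpos : 0 < √(1 - t / 2) := Real.sqrt_pos.2 (by linarith)
  have hle : √(1 - t / 2) ≤ 1 := Real.sqrt_le_one.2 (by linarith)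
  constructor
  · rw [le_div_iff₀ hpos]
    nlinarith
  · rw [div_le_one hpos]
    exact Real.le_sqrt_of_sq_le (by nlinarith)

theorem exists_scaledSine_sub_eq {δ ε a b : ℝ} (hδ : 0 ≤ δ) (hε : ε ≤ 1) (ha : δ * a ^ 2 ≤ ε)
    (hb : δ * b ^ 2 ≤ ε) :
    ∃ r ∈ Set.Icc (1 - ε) 1, scaledSine δ b - scaledSine δ a = r * (b - a) := by
  wlog hab : a < b generalizing a b
  · rcases (not_lt.1 hab).eq_or_lt with rfl | hlt
    · exact ⟨1, ⟨by linarith [(by positivity : 0 ≤ δ * b ^ 2)], le_rfl⟩, by ring⟩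
    · obtain ⟨r, hr, h⟩ := this hb ha hlt
      exact ⟨r, hr, by linear_combination -h⟩
  have hbound : ∀ x ∈ Set.Icc a b, δ * x ^ 2 ≤ ε := fun x hx => by
    rcases le_total 0 x with h0 | h0
    · exact (mul_le_mul_of_nonneg_left (pow_le_pow_left₀ h0 hx.2 2) hδ).trans hb
    · exact (mul_le_mul_of_nonneg_left (by nlinarith [hx.1]) hδ).trans ha
  have hderiv : ∀ x ∈ Set.Icc a b, HasDerivAt (scaledSine δ) _ x := fun x hx =>
    hasDerivAt_scaledSine (by linarith [hbound x hx])
  obtain ⟨ξ, hξ, h⟩ := exists_hasDerivAt_eq_slope (scaledSine δ)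
    (fun x => (1 - δ * x ^ 2) / √(1 - δ * x ^ 2 / 2)) hab
    (fun x hx => (hderiv x hx).continuousAt.continuousWithinAt)
    (fun x hx => hderiv x (Set.Ioo_subset_Icc_self hx))
  have hξε := hbound ξ (Set.Ioo_subset_Icc_self hξ)
  refine ⟨_, deriv_scaledSine_mem_Icc hε (by positivity) hξε, ?_⟩
  rw [h, div_mul_cancel₀ _ (sub_pos.2 hab).ne']

theorem scaledSine_sub_sq_le {δ a b : ℝ} (hδ : 0 ≤ δ) (ha : δ * a ^ 2 ≤ 1) (hb : δ * b ^ 2 ≤ 1) :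
    (scaledSine δ b - scaledSine δ a) ^ 2 ≤ (b - a) ^ 2 := by
  obtain ⟨r, ⟨h0, h1⟩, h⟩ := exists_scaledSine_sub_eq hδ le_rfl ha hb
  rw [h, mul_pow]
  exact mul_le_of_le_one_left (sq_nonneg _) (pow_le_one₀ (by linarith) h1)

theorem le_scaledSine_sub_sq {δ ε a b : ℝ} (hδ : 0 ≤ δ) (hε : ε ≤ 1) (ha : δ * a ^ 2 ≤ ε)
    (hb : δ * b ^ 2 ≤ ε) :
    (1 - ε) ^ 2 * (b - a) ^ 2 ≤ (scaledSine δ b - scaledSine δ a) ^ 2 := by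
  obtain ⟨r, ⟨h0, -⟩, h⟩ := exists_scaledSine_sub_eq hδ hε ha hb
  rw [h, mul_pow]
  exact mul_le_mul_of_nonneg_right (pow_le_pow_left₀ (by linarith) h0 2) (sq_nonneg _)

section Chirality

variable {δ : ℝ} (u : ℕ → Circle1) (i : ℕ)

theorem del_mul_chirality_sq (hδ : 0 < δ) :
    δ * chirality δ u i ^ 2 = 2 * Real.sin (angle (u i) (u (i + 1)) / 2) ^ 2 := by
  rw [chirality, mul_pow, Real.sq_sqrt (by positivity)]
  field_simp

theorem dot_succ_eq (hδ : 0 < δ) : dot (u i) (u (i + 1)) = 1 - δ * chirality δ u i ^ 2 := by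
  rw [del_mul_chirality_sq u i hδ, ← cos_angle, Real.sin_sq_eq_half_sub,
    mul_div_cancel₀ _ two_ne_zero]
  ring

theorem cross_succ_eq (hδ : 0 < δ) :
    cross (u i) (u (i + 1)) = √(2 * δ) * scaledSine δ (chirality δ u i) := by
  set θ := angle (u i) (u (i + 1)) with hθ
  have hcos : √(1 - δ * chirality δ u i ^ 2 / 2) = Real.cos (θ / 2) := by
    obtain ⟨h₁, h₂⟩ := abs_le.1 (abs_angle_le_pi (u i) (u (i + 1)))
    rw [del_mul_chirality_sq u i hδ, mul_div_cancel_left₀ _ two_ne_zero,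
      ← Real.cos_eq_sqrt_one_sub_sin_sq (by linarith) (by linarith)]
  have hsqrt : √(2 * δ) * √(2 / δ) = 2 := by
    rw [← Real.sqrt_mul (by positivity), show 2 * δ * (2 / δ) = 2 ^ 2 by field_simp]
    simp
  calc cross (u i) (u (i + 1)) = Real.sin (2 * (θ / 2)) := by
        rw [← sin_angle, mul_div_cancel₀ _ two_ne_zero]
    _ = √(2 * δ) * √(2 / δ) * (Real.sin (θ / 2) * Real.cos (θ / 2)) := by
        rw [Real.sin_two_mul, hsqrt, mul_assoc]
    _ = √(2 * δ) * scaledSine δ (chirality δ u i) := by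
        rw [scaledSine, hcos, chirality, ← hθ]
        ring

theorem isPeriodic_iff (hδ : 0 < δ) {N : ℕ} (hN : 1 ≤ N) :
    IsPeriodic N u ↔ |chirality δ u 0| = |chirality δ u (N - 1)| := by
  have h0 := dot_succ_eq u 0 hδ
  have hlast := dot_succ_eq u (N - 1) hδ
  rw [Nat.sub_add_cancel hN] at hlast
  rw [IsPeriodic, dot_comm, h0, dot_comm, hlast, sub_right_inj, mul_right_inj' hδ.ne',
    sq_eq_sq_iff_abs_eq_abs]

end Chirality

theorem exists_chirality_eq {δ : ℝ} (hδ : 0 < δ) {a : ℕ → ℝ} (ha : ∀ i, δ * a i ^ 2 < 2) :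
    ∃ u : ℕ → Circle1, chirality δ u = a := by
  have hs (i : ℕ) : |√(δ / 2) * a i| < 1 := by
    rw [← sq_lt_one_iff_abs_lt_one, mul_pow, Real.sq_sqrt (by positivity)]
    linarith [ha i]
  refine ⟨fun i => spinAt (∑ j ∈ Finset.range i, 2 * Real.arcsin (√(δ / 2) * a j)), ?_⟩
  funext i
  obtain ⟨hlt, hgt⟩ := abs_lt.1 (hs i)
  have hangle : |2 * Real.arcsin (√(δ / 2) * a i)| < Real.pi :=
    abs_lt.2 ⟨by linarith [Real.neg_pi_div_two_lt_arcsin.2 hlt],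
      by linarith [Real.arcsin_lt_pi_div_two.2 hgt]⟩
  rw [chirality, Finset.sum_range_succ, angle_spinAt hangle, mul_div_cancel_left₀ _ two_ne_zero,
    Real.sin_arcsin hlt.le hgt.le, ← mul_assoc, ← Real.sqrt_mul (by positivity),
    show 2 / δ * (δ / 2) = 1 by field_simp, Real.sqrt_one, one_mul]

/-- The scaled energy as a function of the chiralities of the `N` bonds. -/
noncomputable def chainEnergy (δ : ℝ) (N : ℕ) (a : ℕ → ℝ) : ℝ :=
  ∑ i ∈ Finset.range (N - 1),
    (√(2 * δ) / 4 * (a i ^ 2 + a (i + 1) ^ 2 - 2) ^ 2 +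
      1 / √(2 * δ) * (scaledSine δ (a (i + 1)) - scaledSine δ (a i)) ^ 2)

theorem norm_sub_smul_add_sq (v w x : Circle1) (c : ℝ) :
    ‖(x : EuclideanSpace ℝ (Fin 2)) - c • (w : EuclideanSpace ℝ (Fin 2))
      + (v : EuclideanSpace ℝ (Fin 2))‖ ^ 2 =
      (dot v w + dot w x - c) ^ 2 + (cross w x - cross v w) ^ 2 := by
  rw [EuclideanSpace.norm_sq_eq, Fin.sum_univ_two, dot_eq, dot_eq, cross, cross]
  simp only [PiLp.add_apply, PiLp.sub_apply, PiLp.smul_apply, smul_eq_mul, Real.norm_eq_abs, sq_abs]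
  linear_combination (c ^ 2 - (x.1 0 + v.1 0) ^ 2 - (x.1 1 + v.1 1) ^ 2) * w.sq_add_sq

theorem spinEnergy_eq {lam δ : ℝ} (hδ : 0 < δ) (u : ℕ → Circle1) :
    spinEnergy lam δ u =
      √2 * lam * δ ^ (3 / 2 : ℝ) * chainEnergy δ (numCells lam) (chirality δ u) := by
  have hpow : δ ^ (3 / 2 : ℝ) = δ * √δ := by
    rw [show (3 / 2 : ℝ) = 1 + 1 / 2 by norm_num, Real.rpow_add hδ, Real.rpow_one,
      Real.sqrt_eq_rpow]
  rw [spinEnergy, chainEnergy, Finset.mul_sum, Finset.mul_sum]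
  refine Finset.sum_congr rfl fun i _ => ?_
  rw [norm_sub_smul_add_sq, dot_succ_eq u i hδ, dot_succ_eq u (i + 1) hδ,
    cross_succ_eq u (i + 1) hδ, cross_succ_eq u i hδ, hpow, Real.sqrt_mul zero_le_two δ]
  have h2 : √2 ^ 2 = 2 := Real.sq_sqrt zero_le_two
  have hsq : √δ ^ 2 = δ := Real.sq_sqrt hδ.le
  have h2' : √2 ≠ 0 := by positivity
  have hsq' : √δ ≠ 0 := by positivity
  field_simp
  rw [h2]
  ring_nf
  rw [hsq]
  ring_nf

/-- `z` is the piecewise constant function with value `a i` on the cell `lam * (i + [0, 1))`. -/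
def IsStepFun (lam : ℝ) (a : ℕ → ℝ) (z : ℝ → ℝ) : Prop :=
  ∀ᵐ x ∂muI, ⌊x / lam⌋₊ < numCells lam → z x = a ⌊x / lam⌋₊

theorem mem_cell_iff {lam x : ℝ} (hlam : 0 < lam) (hx : 0 ≤ x) (i : ℕ) :
    x ∈ Set.Ico (lam * i) (lam * (i + 1)) ↔ ⌊x / lam⌋₊ = i := by
  rw [Nat.floor_eq_iff (by positivity), Set.mem_Ico, le_div_iff₀ hlam, div_lt_iff₀ hlam,
    mul_comm lam, mul_comm lam]

theorem ae_mem_Ioo : ∀ᵐ x ∂muI, x ∈ Set.Ioo (0 : ℝ) 1 := ae_restrict_mem measurableSet_Ioo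

theorem isChiralityOf_iff {lam δ : ℝ} (hlam : 0 < lam) {u : ℕ → Circle1} {z : ℝ → ℝ} :
    IsChiralityOf lam δ u z ↔ IsStepFun lam (chirality δ u) z := by
  constructor
  · intro h
    have hall := ae_all_iff.2 fun i => eventually_imp_distrib_left.2 (h i)
    filter_upwards [hall, ae_mem_Ioo] with x hx hxI hi
    exact hx _ hi ((mem_cell_iff hlam hxI.1.le _).2 rfl)
  · intro h i hi
    filter_upwards [h, ae_mem_Ioo] with x hx hxI hxi
    rw [mem_cell_iff hlam hxI.1.le] at hxi
    rw [hx (hxi ▸ hi), hxi]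

theorem scaledHhf_le {lam δ : ℝ} (hlam : 0 < lam) (hδ : 0 < δ) (hN : 1 ≤ numCells lam)
    {a : ℕ → ℝ} (ha : ∀ i, δ * a i ^ 2 < 2) (hper : |a 0| = |a (numCells lam - 1)|) {z : L1I}
    (hz : IsStepFun lam a z) :
    scaledHhf lam δ z ≤ ENNReal.ofReal (chainEnergy δ (numCells lam) a) := by
  obtain ⟨u, rfl⟩ := exists_chirality_eq hδ ha
  have hscale : 0 ≤ √2 * lam * δ ^ (3 / 2 : ℝ) := by positivity
  refine ENNReal.div_le_of_le_mul' ?_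
  rw [← ENNReal.ofReal_mul hscale, ← spinEnergy_eq hδ]
  exact iInf_le_of_le u
    (iInf₂_le_of_le ((isPeriodic_iff u hδ hN).2 hper) ((isChiralityOf_iff hlam).2 hz) le_rfl)

theorem exists_of_scaledHhf_lt {lam δ : ℝ} (hlam : 0 < lam) (hδ : 0 < δ) (hN : 1 ≤ numCells lam)
    {z : L1I} {c : ℝ≥0∞} (h : scaledHhf lam δ z < c) :
    ∃ a : ℕ → ℝ, |a 0| = |a (numCells lam - 1)| ∧ IsStepFun lam a z ∧
      ENNReal.ofReal (chainEnergy δ (numCells lam) a) < c := by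
  have hscale : 0 < √2 * lam * δ ^ (3 / 2 : ℝ) := by positivity
  rw [scaledHhf, ENNReal.div_lt_iff (.inl (ENNReal.ofReal_pos.2 hscale).ne')
    (.inl ENNReal.ofReal_ne_top), Hhf] at h
  simp only [iInf_lt_iff] at h
  obtain ⟨u, hu, hz, h⟩ := h
  rw [spinEnergy_eq hδ, mul_comm, ENNReal.ofReal_mul' hscale.le] at h
  exact ⟨chirality δ u, (isPeriodic_iff u hδ hN).1 hu, (isChiralityOf_iff hlam).1 hz,
    lt_of_mul_lt_mul_right' h⟩

/-- The scaled energy of a bond pair with chiralities `x`, `y`, without the nonlinearity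
`scaledSine` and with a prefactor `κ` in front of the gradient term; here `h = √(2 δ)`. -/
noncomputable def bondEnergy (h κ x y : ℝ) : ℝ :=
  h / 4 * (x ^ 2 + y ^ 2 - 2) ^ 2 + κ / h * (y - x) ^ 2

theorem bondEnergy_nonneg {h κ : ℝ} (hh : 0 ≤ h) (hκ : 0 ≤ κ) (x y : ℝ) :
    0 ≤ bondEnergy h κ x y := by
  unfold bondEnergy
  positivity

/-- The chain energy with `bondEnergy` as the energy of neighbouring bonds. -/
noncomputable def quadEnergy (h κ : ℝ) (N : ℕ) (a : ℕ → ℝ) : ℝ :=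
  ∑ i ∈ Finset.range (N - 1), bondEnergy h κ (a i) (a (i + 1))

theorem chainEnergy_le_quadEnergy {δ : ℝ} (hδ : 0 ≤ δ) {a : ℕ → ℝ} (ha : ∀ i, δ * a i ^ 2 ≤ 1)
    (N : ℕ) : chainEnergy δ N a ≤ quadEnergy (√(2 * δ)) 1 N a := by
  refine Finset.sum_le_sum fun i _ => add_le_add le_rfl ?_
  exact mul_le_mul_of_nonneg_left (scaledSine_sub_sq_le hδ (ha i) (ha (i + 1))) (by positivity)

/-- A bound on `δ z²` for the chiralities `z` of a chain of scaled energy at most `c`, coming from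
the potential term. -/
noncomputable def angleBound (δ c : ℝ) : ℝ := 2 * δ + √(c * √(2 * δ) ^ 3)

theorem del_mul_sq_add_sq_le {δ c : ℝ} (hδ : 0 ≤ δ) {N i : ℕ} {a : ℕ → ℝ}
    (hc : chainEnergy δ N a ≤ c) (hi : i ∈ Finset.range (N - 1)) :
    δ * (a i ^ 2 + a (i + 1) ^ 2) ≤ angleBound δ c := by
  have hpot : √(2 * δ) / 4 * (a i ^ 2 + a (i + 1) ^ 2 - 2) ^ 2 ≤ c :=
    calc _ ≤ _ := le_add_of_nonneg_right (by positivity)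
      _ ≤ chainEnergy δ N a := Finset.single_le_sum (f := fun i =>
          √(2 * δ) / 4 * (a i ^ 2 + a (i + 1) ^ 2 - 2) ^ 2 +
            1 / √(2 * δ) * (scaledSine δ (a (i + 1)) - scaledSine δ (a i)) ^ 2)
          (fun j _ => by positivity) hi
      _ ≤ c := hc
  have hsq : √(2 * δ) ^ 2 = 2 * δ := Real.sq_sqrt (by positivity)
  have hdev : δ * (a i ^ 2 + a (i + 1) ^ 2 - 2) ≤ √(c * √(2 * δ) ^ 3) := by
    refine Real.le_sqrt_of_sq_le ?_
    calc (δ * (a i ^ 2 + a (i + 1) ^ 2 - 2)) ^ 2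
        = √(2 * δ) / 4 * (a i ^ 2 + a (i + 1) ^ 2 - 2) ^ 2 * √(2 * δ) ^ 3 := by
          linear_combination (-(δ / 2 + √(2 * δ) ^ 2 / 4) * (a i ^ 2 + a (i + 1) ^ 2 - 2) ^ 2) * hsq
      _ ≤ c * √(2 * δ) ^ 3 := by gcongr
  unfold angleBound
  linarith

theorem quadEnergy_le_of_chainEnergy_le {δ c : ℝ} (hδ : 0 ≤ δ) {N : ℕ} {a : ℕ → ℝ}
    (hc : chainEnergy δ N a ≤ c) (hbound : angleBound δ c ≤ 1) :
    quadEnergy (√(2 * δ)) ((1 - angleBound δ c) ^ 2) N a ≤ c := by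
  refine le_trans (Finset.sum_le_sum fun i hi => ?_) hc
  have hsum := del_mul_sq_add_sq_le hδ hc hi
  have hi0 : 0 ≤ δ * a i ^ 2 := by positivity
  have hi1 : 0 ≤ δ * a (i + 1) ^ 2 := by positivity
  have hgrad := le_scaledSine_sub_sq (a := a i) (b := a (i + 1)) hδ hbound (by linarith)
    (by linarith)
  refine add_le_add le_rfl ?_
  rw [div_eq_mul_one_div, mul_comm _ (1 / _), mul_assoc]
  exact mul_le_mul_of_nonneg_left hgrad (by positivity)

/-! ### Step functions on the grid -/

theorem muI_eq_Ico : muI = volume.restrict (Set.Ico (0 : ℝ) 1) :=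
  Measure.restrict_congr_set Ioo_ae_eq_Ico

theorem muI_eq_Ioc : muI = volume.restrict (Set.Ioc (0 : ℝ) 1) :=
  Measure.restrict_congr_set Ioo_ae_eq_Ioc

instance : IsProbabilityMeasure muI := ⟨by simp [muI]⟩

theorem mul_numCells_le {lam : ℝ} (hlam : 0 < lam) : lam * numCells lam ≤ 1 := by
  rw [mul_comm, ← le_div_iff₀ hlam]
  exact Nat.floor_le (by positivity)

theorem mul_numCells_sub_one_le {lam : ℝ} (hlam : 0 < lam) :
    lam * (numCells lam - 1 : ℕ) ≤ 1 :=
  (mul_le_mul_of_nonneg_left (by exact_mod_cast Nat.sub_le _ _) hlam.le).trans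
    (mul_numCells_le hlam)

theorem lt_mul_numCells {lam : ℝ} (hlam : 0 < lam) : 1 - lam < lam * numCells lam := by
  have h := Nat.lt_floor_add_one (1 / lam)
  rw [div_lt_iff₀ hlam] at h
  unfold numCells
  linarith

theorem mul_floor_le {lam x : ℝ} (hlam : 0 < lam) (hx : 0 ≤ x) : lam * ⌊x / lam⌋₊ ≤ x :=
  ((mem_cell_iff hlam hx _).2 rfl).1

theorem lt_mul_floor {lam x : ℝ} (hlam : 0 < lam) (hx : 0 ≤ x) : x < lam * (⌊x / lam⌋₊ + 1) :=
  ((mem_cell_iff hlam hx _).2 rfl).2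

theorem cell_subset {lam : ℝ} (hlam : 0 < lam) {N i : ℕ} (hN : lam * N ≤ 1) (hi : i < N) :
    Set.Ico (lam * i) (lam * (i + 1)) ⊆ Set.Ico (0 : ℝ) 1 := by
  have hiN : (i + 1 : ℝ) ≤ N := by exact_mod_cast hi
  intro x hx
  exact ⟨le_trans (by positivity) hx.1, hx.2.trans_le (le_trans (by gcongr) hN)⟩

/-- A sequence of positive numbers tending to `0`. -/
structure IsPosNullSeq (s : ℕ → ℝ) : Prop where
  pos : ∀ n, 0 < s n
  tendsto : Tendsto s atTop (𝓝 0)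

namespace IsPosNullSeq

variable {s : ℕ → ℝ} (hs : IsPosNullSeq s) {x : ℝ}
include hs

theorem comp {φ : ℕ → ℕ} (hφ : Tendsto φ atTop atTop) : IsPosNullSeq (s ∘ φ) :=
  ⟨fun _ => hs.pos _, hs.tendsto.comp hφ⟩

theorem sqrt_two_mul : IsPosNullSeq fun n => √(2 * s n) where
  pos n := Real.sqrt_pos.2 (mul_pos two_pos (hs.pos n))
  tendsto := (Real.continuous_sqrt.tendsto' 0 0 Real.sqrt_zero).comp
    (by simpa using hs.tendsto.const_mul 2)

theorem tendsto_mul_floor (hx : 0 ≤ x) : Tendsto (fun n => s n * ⌊x / s n⌋₊) atTop (𝓝 x) := by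
  have hlower : Tendsto (fun n => x - s n) atTop (𝓝 x) := by
    simpa using tendsto_const_nhds.sub hs.tendsto
  refine tendsto_of_tendsto_of_tendsto_of_le_of_le hlower tendsto_const_nhds (fun n => ?_)
    fun n => mul_floor_le (hs.pos n) hx
  linarith [lt_mul_floor (hs.pos n) hx]

theorem eventually_floor_add_lt (hx : 0 ≤ x) (hx1 : x < 1) (k : ℕ) :
    ∀ᶠ n in atTop, ⌊x / s n⌋₊ + k < numCells (s n) := by
  have hlim : Tendsto (fun n => (k + 1 : ℝ) * s n) atTop (𝓝 0) := by
    simpa using hs.tendsto.const_mul (k + 1 : ℝ)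
  filter_upwards [hlim.eventually (gt_mem_nhds (sub_pos.2 hx1))] with n hn
  have hlt : s n * (⌊x / s n⌋₊ + k) < s n * numCells (s n) := by
    linarith [mul_floor_le (hs.pos n) hx, lt_mul_numCells (hs.pos n)]
  exact_mod_cast lt_of_mul_lt_mul_left hlt (hs.pos n).le

theorem eventually_le_numCells (k : ℕ) : ∀ᶠ n in atTop, k ≤ numCells (s n) := by
  filter_upwards [hs.eventually_floor_add_lt le_rfl one_pos k] with n hn
  omega

theorem tendsto_mul_numCells : Tendsto (fun n => s n * numCells (s n)) atTop (𝓝 1) := by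
  have hlower : Tendsto (fun n => 1 - s n) atTop (𝓝 1) := by
    simpa using tendsto_const_nhds.sub hs.tendsto
  exact tendsto_of_tendsto_of_tendsto_of_le_of_le hlower tendsto_const_nhds
    (fun n => (lt_mul_numCells (hs.pos n)).le) fun n => mul_numCells_le (hs.pos n)

theorem tendsto_mul_numCells_sub_one :
    Tendsto (fun n => s n * (numCells (s n) - 1 : ℕ)) atTop (𝓝 1) := by
  have hlim : Tendsto (fun n => s n * numCells (s n) - s n) atTop (𝓝 1) := by
    simpa using hs.tendsto_mul_numCells.sub hs.tendsto
  refine hlim.congr' ?_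
  filter_upwards [hs.eventually_le_numCells 1] with n hn
  rw [Nat.cast_pred hn, mul_sub_one]

end IsPosNullSeq

/-- The function with value `b i` on the cell `lam * (i + [0, 1))` for `i < N`, and `0` on the
cells after those. -/
noncomputable def stepFun {M : Type*} [Zero M] (lam : ℝ) (N : ℕ) (b : ℕ → M) (x : ℝ) : M :=
  (Set.Iio N).indicator b ⌊x / lam⌋₊

section StepFun

variable {lam x : ℝ} {N : ℕ}

theorem stepFun_of_lt {M : Type*} [Zero M] (b : ℕ → M) (h : ⌊x / lam⌋₊ < N) :
    stepFun lam N b x = b ⌊x / lam⌋₊ :=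
  Set.indicator_of_mem (Set.mem_Iio.2 h) b

theorem measurable_comp_floor {α : Type*} [MeasurableSpace α] (lam : ℝ) (b : ℕ → α) :
    Measurable fun x : ℝ => b ⌊x / lam⌋₊ :=
  (measurable_from_nat (f := b)).comp (Nat.measurable_floor.comp (measurable_id.div_const lam))

theorem measurable_stepFun {M : Type*} [Zero M] [MeasurableSpace M] (lam : ℝ) (N : ℕ)
    (b : ℕ → M) : Measurable (stepFun lam N b) :=
  measurable_comp_floor lam _

theorem abs_stepFun_le {b : ℕ → ℝ} {B : ℝ} (hB : 0 ≤ B) (hb : ∀ i < N, |b i| ≤ B) :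
    |stepFun lam N b x| ≤ B := by
  unfold stepFun Set.indicator
  split_ifs with h
  · exact hb _ h
  · rwa [abs_zero]

theorem tendsto_stepFun {M : Type*} [Zero M] [TopologicalSpace M] {lam : ℕ → ℝ}
    (hlam : IsPosNullSeq lam) (hx : x ∈ Set.Ioo (0 : ℝ) 1) (k : ℕ) {b : ℕ → ℕ → M} {y : M}
    (h : Tendsto (fun n => b n ⌊x / lam n⌋₊) atTop (𝓝 y)) :
    Tendsto (fun n => stepFun (lam n) (numCells (lam n) - k) (b n) x) atTop (𝓝 y) := by
  refine h.congr' ?_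
  filter_upwards [hlam.eventually_floor_add_lt hx.1.le hx.2 k] with n hn
  exact (stepFun_of_lt _ (by omega)).symm

theorem stepFun_eq_sum_indicator {M : Type*} [AddCommMonoid M] (hlam : 0 < lam) (hx : 0 ≤ x)
    (b : ℕ → M) :
    stepFun lam N b x = ∑ i ∈ Finset.range N,
      (Set.Ico (lam * i) (lam * (i + 1))).indicator (fun _ => b i) x := by
  simp only [stepFun, Set.indicator_apply, Set.mem_Iio, mem_cell_iff hlam hx, Finset.sum_ite_eq,
    Finset.mem_range]

theorem lintegral_stepFun (hlam : 0 < lam) (hN : lam * N ≤ 1) (b : ℕ → ℝ≥0∞) :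
    ∫⁻ x, stepFun lam N b x ∂muI = ∑ i ∈ Finset.range N, ENNReal.ofReal lam * b i := by
  rw [muI_eq_Ico, setLIntegral_congr_fun measurableSet_Ico fun x hx =>
      stepFun_eq_sum_indicator hlam hx.1 b,
    lintegral_finsetSum _ fun i _ => measurable_const.indicator measurableSet_Ico]
  refine Finset.sum_congr rfl fun i hi => ?_
  rw [lintegral_indicator_const measurableSet_Ico, Measure.restrict_apply measurableSet_Ico,
    Set.inter_eq_left.2 (cell_subset hlam hN (Finset.mem_range.1 hi)), Real.volume_Ico, mul_comm,
    mul_add_one, add_sub_cancel_left]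

theorem integral_stepFun_mul (hlam : 0 < lam) (hN : lam * N ≤ 1) (b : ℕ → ℝ) {φ : ℝ → ℝ}
    (hφ : Continuous φ) :
    ∫ x, stepFun lam N b x * φ x ∂muI =
      ∑ i ∈ Finset.range N, b i * ∫ x in (lam * i)..(lam * (i + 1)), φ x := by
  have hcongr : ∀ x ∈ Set.Ico (0 : ℝ) 1, stepFun lam N b x * φ x = ∑ i ∈ Finset.range N,
      (Set.Ico (lam * i) (lam * (i + 1))).indicator (fun x => b i * φ x) x := fun x hx => by
    rw [stepFun_eq_sum_indicator hlam hx.1, Finset.sum_mul]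
    exact Finset.sum_congr rfl fun i _ => (Set.indicator_mul_left _ (fun _ => b i) φ).symm
  have hint (i : ℕ) : Integrable (fun x => b i * φ x) (volume.restrict (Set.Ico (0 : ℝ) 1)) :=
    ((hφ.const_mul (b i)).integrableOn_Icc (a := 0) (b := 1)).mono_set Set.Ico_subset_Icc_self
  rw [muI_eq_Ico, setIntegral_congr_fun measurableSet_Ico hcongr,
    integral_finsetSum _ fun i _ => (hint i).indicator measurableSet_Ico]
  refine Finset.sum_congr rfl fun i hi => ?_
  rw [integral_indicator measurableSet_Ico, Measure.restrict_restrict measurableSet_Ico,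
    Set.inter_eq_left.2 (cell_subset hlam hN (Finset.mem_range.1 hi)), integral_const_mul,
    intervalIntegral.integral_of_le (by nlinarith), integral_Ico_eq_integral_Ioc]

theorem integral_stepFun (hlam : 0 < lam) (hN : lam * N ≤ 1) (b : ℕ → ℝ) :
    ∫ x, stepFun lam N b x ∂muI = lam * ∑ i ∈ Finset.range N, b i := by
  have h := integral_stepFun_mul hlam hN b (φ := fun _ => 1) continuous_const
  simp only [mul_one, intervalIntegral.integral_const, smul_eq_mul] at h
  rw [h, Finset.mul_sum]
  exact Finset.sum_congr rfl fun i _ => by ring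

theorem sum_mul_sub_eq_sub_sum_sub_mul (a f : ℕ → ℝ) (N : ℕ) :
    ∑ i ∈ Finset.range (N + 1), a i * (f (i + 1) - f i) =
      a N * f (N + 1) - a 0 * f 0 - ∑ i ∈ Finset.range N, (a (i + 1) - a i) * f (i + 1) := by
  induction N with
  | zero => simp only [Finset.sum_range_succ, Finset.sum_range_zero]; ring
  | succ N ih => rw [Finset.sum_range_succ, ih, Finset.sum_range_succ]; ring

theorem integral_stepFun_mul_deriv (hlam : 0 < lam) (hN0 : 1 ≤ N) (hN : lam * N ≤ 1) (b : ℕ → ℝ)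
    {φ : ℝ → ℝ} (hφ : ContDiff ℝ 1 φ) :
    ∫ x, stepFun lam N b x * deriv φ x ∂muI =
      b (N - 1) * φ (lam * N) - b 0 * φ 0 -
        ∑ i ∈ Finset.range (N - 1), (b (i + 1) - b i) * φ (lam * (i + 1)) := by
  have hcont : Continuous (deriv φ) := hφ.continuous_deriv le_rfl
  obtain ⟨M, rfl⟩ : ∃ M, N = M + 1 := ⟨N - 1, by omega⟩
  have hparts := sum_mul_sub_eq_sub_sum_sub_mul b (fun i => φ (lam * i)) M
  simp only [Nat.cast_add, Nat.cast_one, Nat.cast_zero, mul_zero, Nat.add_sub_cancel] at hparts ⊢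
  rw [integral_stepFun_mul hlam hN b hcont, ← hparts]
  refine Finset.sum_congr rfl fun i _ => ?_
  rw [intervalIntegral.integral_deriv_eq_sub
    (fun x _ => (hφ.differentiable one_ne_zero).differentiableAt) (hcont.intervalIntegrable _ _)]

end StepFun

theorem exists_tendsto_L1 {lam : ℕ → ℝ} {a : ℕ → ℕ → ℝ} {B : ℝ} (hB : ∀ n i, |a n i| ≤ B) {z : L1I}
    (hlim : ∀ᵐ x ∂muI, Tendsto (fun n => a n ⌊x / lam n⌋₊) atTop (𝓝 (z x))) :
    ∃ y : ℕ → L1I, Tendsto y atTop (𝓝 z) ∧ ∀ n, IsStepFun (lam n) (a n) (y n) := by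
  have hmeas (n : ℕ) : AEStronglyMeasurable (fun x => a n ⌊x / lam n⌋₊) muI :=
    (measurable_comp_floor (lam n) (a n)).aestronglyMeasurable
  have hmem (n : ℕ) : MemLp (fun x => a n ⌊x / lam n⌋₊) 1 muI :=
    MemLp.of_bound (hmeas n) B (Eventually.of_forall fun x => hB _ _)
  refine ⟨fun n => (hmem n).toLp _, ?_, fun n => (hmem n).coeFn_toLp.mono fun x hx _ => hx⟩
  have hnorm (n : ℕ) : eLpNorm (((hmem n).toLp _ : ℝ → ℝ) - (z : ℝ → ℝ)) 1 muI =
      ∫⁻ x, ‖a n ⌊x / lam n⌋₊ - z x‖ₑ ∂muI := by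
    rw [eLpNorm_one_eq_lintegral_enorm]
    refine lintegral_congr_ae ?_
    filter_upwards [(hmem n).coeFn_toLp] with x hx
    rw [Pi.sub_apply, hx]
  rw [Lp.tendsto_Lp_iff_tendsto_eLpNorm']
  simp only [hnorm]
  rw [← lintegral_zero (μ := muI)]
  refine tendsto_lintegral_of_dominated_convergence' (fun _ => ENNReal.ofReal (B + B))
    (fun n => ((hmeas n).sub (Lp.aestronglyMeasurable z)).enorm) (fun n => ?_) (by simp) ?_
  · filter_upwards [hlim] with x hx
    have hz : |z x| ≤ B := le_of_tendsto hx.abs (Eventually.of_forall fun n => hB _ _)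
    rw [← ofReal_norm]
    exact ENNReal.ofReal_le_ofReal ((norm_sub_le _ _).trans (add_le_add (hB _ _) hz))
  · filter_upwards [hlim] with x hx
    simpa using (hx.sub_const (z x)).enorm

theorem exists_subseq_ae_tendsto {y : ℕ → L1I} {z : L1I} (hy : Tendsto y atTop (𝓝 z))
    {p : ℕ → Prop} (hp : ∃ᶠ n in atTop, p n) :
    ∃ φ : ℕ → ℕ, Tendsto φ atTop atTop ∧ (∀ n, p (φ n)) ∧
      ∀ᵐ x ∂muI, Tendsto (fun n => y (φ n) x) atTop (𝓝 (z x)) := by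
  obtain ⟨ψ, hψ, hpψ⟩ := extraction_of_frequently_atTop hp
  obtain ⟨χ, hχ, hae⟩ :=
    (tendstoInMeasure_of_tendsto_Lp (hy.comp hψ.tendsto_atTop)).exists_seq_tendsto_ae
  exact ⟨ψ ∘ χ, (hψ.comp hχ).tendsto_atTop, fun n => hpψ _, hae⟩

theorem ae_tendsto_comp_floor {lam : ℕ → ℝ} (hlam : IsPosNullSeq lam) {a : ℕ → ℕ → ℝ}
    {y : ℕ → ℝ → ℝ} (hy : ∀ n, IsStepFun (lam n) (a n) (y n)) {z : ℝ → ℝ}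
    (hlim : ∀ᵐ x ∂muI, Tendsto (fun n => y n x) atTop (𝓝 (z x))) :
    ∀ᵐ x ∂muI, Tendsto (fun n => a n ⌊x / lam n⌋₊) atTop (𝓝 (z x)) := by
  filter_upwards [ae_all_iff.2 hy, hlim, ae_mem_Ioo] with x hstep hx hxI
  refine hx.congr' ?_
  filter_upwards [hlam.eventually_floor_add_lt hxI.1.le hxI.2 0] with n hn
  exact hstep n hn

/-! ### Chains of bounded energy -/

/-- The potential term of `quadEnergy`, divided by `h`. -/
noncomputable def wellTerm (a : ℕ → ℝ) (i : ℕ) : ℝ := ((a i ^ 2 + a (i + 1) ^ 2) / 2 - 1) ^ 2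

/-- The sum over the chain of the potential terms; `lam * wellSum N a` is the discrete version of
`∫ (z² - 1)²`. -/
noncomputable def wellSum (N : ℕ) (a : ℕ → ℝ) : ℝ := ∑ i ∈ Finset.range (N - 1), wellTerm a i

/-- The sum over the chain of the squared increments; `squaredIncrements N a / lam` is the discrete
version of `∫ (z')²`. -/
noncomputable def squaredIncrements (N : ℕ) (a : ℕ → ℝ) : ℝ :=
  ∑ i ∈ Finset.range (N - 1), (a (i + 1) - a i) ^ 2

theorem wellTerm_nonneg (a : ℕ → ℝ) (i : ℕ) : 0 ≤ wellTerm a i := sq_nonneg _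

theorem wellSum_nonneg (N : ℕ) (a : ℕ → ℝ) : 0 ≤ wellSum N a :=
  Finset.sum_nonneg fun _ _ => wellTerm_nonneg a _

theorem squaredIncrements_nonneg (N : ℕ) (a : ℕ → ℝ) : 0 ≤ squaredIncrements N a :=
  Finset.sum_nonneg fun _ _ => sq_nonneg _

theorem quadEnergy_eq (h κ : ℝ) (N : ℕ) (a : ℕ → ℝ) :
    quadEnergy h κ N a = h * wellSum N a + κ / h * squaredIncrements N a := by
  rw [quadEnergy, wellSum, squaredIncrements, Finset.mul_sum, Finset.mul_sum,
    ← Finset.sum_add_distrib]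
  refine Finset.sum_congr rfl fun i _ => ?_
  rw [bondEnergy, wellTerm]
  ring

theorem sq_sub_le_mul_squaredIncrements (a : ℕ → ℝ) {N i j : ℕ} (hij : i ≤ j) (hj : j < N) :
    (a j - a i) ^ 2 ≤ (j - i : ℝ) * squaredIncrements N a := by
  rw [← Finset.sum_Ico_sub a hij]
  refine sq_sum_le_card_mul_sum_sq.trans ?_
  rw [Nat.card_Ico, Nat.cast_sub hij]
  refine mul_le_mul_of_nonneg_left ?_ (sub_nonneg.2 (by exact_mod_cast hij))
  refine Finset.sum_le_sum_of_subset_of_nonneg (fun k hk => ?_) fun k _ _ => sq_nonneg _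
  simp only [Finset.mem_Ico, Finset.mem_range] at hk ⊢
  omega

theorem sq_sub_le_squaredIncrements_div {lam : ℝ} (hlam : 0 < lam) (a : ℕ → ℝ) {i j : ℕ}
    (hi : i < numCells lam) (hj : j < numCells lam) :
    (a j - a i) ^ 2 ≤ squaredIncrements (numCells lam) a / lam := by
  wlog hij : i ≤ j generalizing i j
  · rw [← neg_sub, neg_sq]
    exact this hj hi (not_le.1 hij).le
  have hlen : (j - i : ℝ) ≤ 1 / lam := by
    have hjN : (j : ℝ) ≤ numCells lam := by exact_mod_cast hj.le
    rw [le_div_iff₀ hlam]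
    nlinarith [mul_numCells_le hlam, (Nat.cast_nonneg i : (0 : ℝ) ≤ i)]
  calc (a j - a i) ^ 2 ≤ (j - i : ℝ) * squaredIncrements (numCells lam) a :=
        sq_sub_le_mul_squaredIncrements a hij hj
    _ ≤ 1 / lam * squaredIncrements (numCells lam) a :=
        mul_le_mul_of_nonneg_right hlen (squaredIncrements_nonneg _ _)
    _ = squaredIncrements (numCells lam) a / lam := one_div_mul_eq_div _ _

/-- Chains `a n` with `quadEnergy` at most `c`, at scales `lam n` and `h n = √(2 δ)` tending to `0`,
whose step functions converge a.e. to `z`. The factor `κ n → 1` is the price for replacing the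
gradient term of `chainEnergy` by the quadratic one. -/
structure ChainLimit (lam h κ : ℕ → ℝ) (c : ℝ) (a : ℕ → ℕ → ℝ) (z : ℝ → ℝ) : Prop where
  lam_null : IsPosNullSeq lam
  h_null : IsPosNullSeq h
  κ_pos : ∀ n, 0 < κ n
  κ_tendsto : Tendsto κ atTop (𝓝 1)
  two_le_numCells : ∀ n, 2 ≤ numCells (lam n)
  energy_le : ∀ n, quadEnergy (h n) (κ n) (numCells (lam n)) (a n) ≤ c
  periodic : ∀ n, |a n 0| = |a n (numCells (lam n) - 1)|
  tendsto : ∀ᵐ x ∂muI, Tendsto (fun n => a n ⌊x / lam n⌋₊) atTop (𝓝 (z x))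

namespace IsPosNullSeq

variable {lam del : ℕ → ℝ}

theorem tendsto_angleBound (hdel : IsPosNullSeq del) (c : ℝ) :
    Tendsto (fun n => angleBound (del n) c) atTop (𝓝 0) := by
  have hcube : Tendsto (fun n => c * √(2 * del n) ^ 3) atTop (𝓝 0) := by
    simpa using (hdel.sqrt_two_mul.tendsto.pow 3).const_mul c
  simpa [angleBound] using (hdel.tendsto.const_mul 2).add hcube.sqrt

theorem exists_chainLimit (hlam : IsPosNullSeq lam) (hdel : IsPosNullSeq del) {y : ℕ → L1I}
    {z : L1I} (hy : Tendsto y atTop (𝓝 z)) {c : ℝ≥0}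
    (hc : liminf (fun n => scaledHhf (lam n) (del n) (y n)) atTop < c) :
    ∃ (φ : ℕ → ℕ) (κ : ℕ → ℝ) (a : ℕ → ℕ → ℝ), Tendsto φ atTop atTop ∧
      ChainLimit (lam ∘ φ) (fun n => √(2 * del (φ n))) κ c a z := by
  have hbound := hdel.tendsto_angleBound c
  obtain ⟨φ, hφ, hprop, hae⟩ := exists_subseq_ae_tendsto hy
    ((frequently_lt_of_liminf_lt (by isBoundedDefault) hc).and_eventually
      ((hlam.eventually_le_numCells 2).and (hbound.eventually (gt_mem_nhds one_pos))))
  have hchain (n : ℕ) := exists_of_scaledHhf_lt (hlam.pos (φ n)) (hdel.pos (φ n))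
    (one_le_two.trans (hprop n).2.1) (hprop n).1
  choose a hper hstep henergy using hchain
  refine ⟨φ, fun n => (1 - angleBound (del (φ n)) c) ^ 2, a, hφ,
    { lam_null := hlam.comp hφ
      h_null := hdel.sqrt_two_mul.comp hφ
      κ_pos := fun n => pow_pos (by linarith [(hprop n).2.2]) 2
      κ_tendsto := by simpa using ((hbound.comp hφ).const_sub 1).pow 2
      two_le_numCells := fun n => (hprop n).2.1
      energy_le := fun n => ?_
      periodic := hper
      tendsto := ae_tendsto_comp_floor (hlam.comp hφ) hstep hae }⟩
  refine quadEnergy_le_of_chainEnergy_le (hdel.pos _).le ?_ (hprop n).2.2.le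
  have hlt := henergy n
  rw [← ENNReal.ofReal_coe_nnreal] at hlt
  exact (ENNReal.ofReal_lt_ofReal_iff'.1 hlt).1.le

theorem le_liminf_scaledHhf (hlam : IsPosNullSeq lam) (hdel : IsPosNullSeq del) {F : ℝ≥0∞}
    {z : L1I}
    (hF : ∀ (φ : ℕ → ℕ) (κ : ℕ → ℝ) (a : ℕ → ℕ → ℝ) (c : ℝ), Tendsto φ atTop atTop →
      ChainLimit (lam ∘ φ) (fun n => √(2 * del (φ n))) κ c a z → F ≤ ENNReal.ofReal c)
    {y : ℕ → L1I} (hy : Tendsto y atTop (𝓝 z)) :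
    F ≤ liminf (fun n => scaledHhf (lam n) (del n) (y n)) atTop := by
  by_contra! hlt
  obtain ⟨c, hliminf, hcF⟩ := ENNReal.lt_iff_exists_nnreal_btwn.1 hlt
  obtain ⟨φ, κ, a, hφ, H⟩ := hlam.exists_chainLimit hdel hy hliminf
  have hFc := hF φ κ a c hφ H
  rw [ENNReal.ofReal_coe_nnreal] at hFc
  exact hFc.not_gt hcF

theorem limsup_scaledHhf_le (hlam : IsPosNullSeq lam) (hdel : IsPosNullSeq del) {y : ℕ → L1I}
    {a : ℕ → ℕ → ℝ} {B : ℝ} (hB : ∀ n i, |a n i| ≤ B)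
    (hper : ∀ᶠ n in atTop, |a n 0| = |a n (numCells (lam n) - 1)|)
    (hy : ∀ n, IsStepFun (lam n) (a n) (y n)) {e : ℕ → ℝ} {e₀ : ℝ} (he : Tendsto e atTop (𝓝 e₀))
    (hle : ∀ᶠ n in atTop, quadEnergy (√(2 * del n)) 1 (numCells (lam n)) (a n) ≤ e n) :
    limsup (fun n => scaledHhf (lam n) (del n) (y n)) atTop ≤ ENNReal.ofReal e₀ := by
  have hsmall : ∀ᶠ n in atTop, del n * B ^ 2 < 1 := by
    have hlim : Tendsto (fun n => del n * B ^ 2) atTop (𝓝 0) := by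
      simpa using hdel.tendsto.mul_const (B ^ 2)
    exact hlim.eventually (gt_mem_nhds one_pos)
  have hmain : ∀ᶠ n in atTop, scaledHhf (lam n) (del n) (y n) ≤ ENNReal.ofReal (e n) := by
    filter_upwards [hper, hle, hsmall, hlam.eventually_le_numCells 1] with n hper hle hsmall hN
    have ha (i : ℕ) : del n * a n i ^ 2 ≤ 1 :=
      (mul_le_mul_of_nonneg_left (sq_le_sq.2 ((hB n i).trans (le_abs_self B)))
        (hdel.pos n).le).trans hsmall.le
    exact (scaledHhf_le (hlam.pos n) (hdel.pos n) hN (fun i => (ha i).trans_lt one_lt_two) hper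
      (hy n)).trans (ENNReal.ofReal_le_ofReal
        ((chainEnergy_le_quadEnergy (hdel.pos n).le ha _).trans hle))
  refine (limsup_le_limsup hmain).trans (le_of_eq ?_)
  exact ((ENNReal.continuous_ofReal.tendsto _).comp he).limsup_eq

end IsPosNullSeq

namespace ChainLimit

variable {lam h κ : ℕ → ℝ} {c : ℝ} {a : ℕ → ℕ → ℝ} {z : ℝ → ℝ} (H : ChainLimit lam h κ c a z)
include H

theorem comp {φ : ℕ → ℕ} (hφ : Tendsto φ atTop atTop) :
    ChainLimit (lam ∘ φ) (h ∘ φ) (κ ∘ φ) c (a ∘ φ) z where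
  lam_null := H.lam_null.comp hφ
  h_null := H.h_null.comp hφ
  κ_pos _ := H.κ_pos _
  κ_tendsto := H.κ_tendsto.comp hφ
  two_le_numCells _ := H.two_le_numCells _
  energy_le _ := H.energy_le _
  periodic _ := H.periodic _
  tendsto := H.tendsto.mono fun _ hx => hx.comp hφ

theorem wellSum_add_squaredIncrements_le (n : ℕ) :
    h n * wellSum (numCells (lam n)) (a n) +
      κ n / h n * squaredIncrements (numCells (lam n)) (a n) ≤ c :=
  (quadEnergy_eq _ _ _ _).symm.trans_le (H.energy_le n)

theorem mul_wellSum_le (n : ℕ) :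
    lam n * wellSum (numCells (lam n)) (a n) ≤ c * (lam n / h n) := by
  have hh := H.h_null.pos n
  have hlam := H.lam_null.pos n
  have hgrad : 0 ≤ κ n / h n * squaredIncrements (numCells (lam n)) (a n) :=
    mul_nonneg (div_nonneg (H.κ_pos n).le hh.le) (squaredIncrements_nonneg _ _)
  have hwell := le_of_add_le_of_nonneg_left (H.wellSum_add_squaredIncrements_le n) hgrad
  calc lam n * wellSum (numCells (lam n)) (a n)
      = h n * wellSum (numCells (lam n)) (a n) * (lam n / h n) := by field_simp
    _ ≤ c * (lam n / h n) := by gcongr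

theorem squaredIncrements_le (n : ℕ) :
    squaredIncrements (numCells (lam n)) (a n) ≤ c / κ n * h n := by
  have hh := H.h_null.pos n
  have hκ := H.κ_pos n
  have hwell : 0 ≤ h n * wellSum (numCells (lam n)) (a n) :=
    mul_nonneg hh.le (wellSum_nonneg _ _)
  have hgrad := le_of_add_le_of_nonneg_right (H.wellSum_add_squaredIncrements_le n) hwell
  calc squaredIncrements (numCells (lam n)) (a n)
      = κ n / h n * squaredIncrements (numCells (lam n)) (a n) / κ n * h n := by field_simp
    _ ≤ c / κ n * h n := by gcongr

theorem tendsto_div_κ : Tendsto (fun n => c / κ n) atTop (𝓝 c) := by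
  simpa [Pi.div_def] using (tendsto_const_nhds (x := c)).div H.κ_tendsto one_ne_zero

theorem tendsto_step {x : ℝ} (hx : x ∈ Set.Ioo (0 : ℝ) 1) :
    Tendsto (fun n => a n (⌊x / lam n⌋₊ + 1) - a n ⌊x / lam n⌋₊) atTop (𝓝 0) := by
  have hbound : Tendsto (fun n => c / κ n * h n) atTop (𝓝 0) := by
    simpa using H.tendsto_div_κ.mul H.h_null.tendsto
  refine squeeze_zero_norm' ?_ (by simpa using hbound.sqrt)
  filter_upwards [H.lam_null.eventually_floor_add_lt hx.1.le hx.2 1] with n hn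
  refine Real.abs_le_sqrt (le_trans ?_ (H.squaredIncrements_le n))
  exact Finset.single_le_sum (f := fun i => (a n (i + 1) - a n i) ^ 2) (fun i _ => sq_nonneg _)
    (Finset.mem_range.2 (by omega))

end ChainLimit

theorem tendsto_wellTerm {lam : ℕ → ℝ} {a : ℕ → ℕ → ℝ} {x y : ℝ}
    (h : Tendsto (fun n => a n ⌊x / lam n⌋₊) atTop (𝓝 y))
    (hsucc : Tendsto (fun n => a n (⌊x / lam n⌋₊ + 1)) atTop (𝓝 y)) :
    Tendsto (fun n => wellTerm (a n) ⌊x / lam n⌋₊) atTop (𝓝 ((y ^ 2 - 1) ^ 2)) := by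
  have hlim := ((((h.pow 2).add (hsucc.pow 2)).div_const 2).sub_const 1).pow 2
  rwa [add_self_div_two] at hlim

theorem ofReal_mul_wellSum {lam : ℝ} (hlam : 0 < lam) (a : ℕ → ℝ) :
    ENNReal.ofReal (lam * wellSum (numCells lam) a) =
      ∫⁻ x, stepFun lam (numCells lam - 1) (fun i => ENNReal.ofReal (wellTerm a i)) x ∂muI := by
  rw [lintegral_stepFun hlam (mul_numCells_sub_one_le hlam), wellSum, ← Finset.mul_sum,
    ENNReal.ofReal_mul hlam.le, ENNReal.ofReal_sum_of_nonneg fun i _ => wellTerm_nonneg a i]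

namespace ChainLimit

variable {lam h κ : ℕ → ℝ} {c : ℝ} {a : ℕ → ℕ → ℝ} {z : ℝ → ℝ} (H : ChainLimit lam h κ c a z)
include H

theorem lintegral_well_le {p : ℝ}
    (hp : Tendsto (fun n => lam n * wellSum (numCells (lam n)) (a n)) atTop (𝓝 p)) :
    ∫⁻ x, ENNReal.ofReal ((z x ^ 2 - 1) ^ 2) ∂muI ≤ ENNReal.ofReal p := by
  set F : ℕ → ℝ → ℝ≥0∞ := fun n => stepFun (lam n) (numCells (lam n) - 1)
    fun i => ENNReal.ofReal (wellTerm (a n) i)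
  have hlim : ∀ᵐ x ∂muI, Tendsto (fun n => F n x) atTop
      (𝓝 (ENNReal.ofReal ((z x ^ 2 - 1) ^ 2))) := by
    filter_upwards [H.tendsto, ae_mem_Ioo] with x hx hxI
    have hsucc : Tendsto (fun n => a n (⌊x / lam n⌋₊ + 1)) atTop (𝓝 (z x)) := by
      simpa using (H.tendsto_step hxI).add hx
    exact tendsto_stepFun H.lam_null hxI 1
      ((ENNReal.continuous_ofReal.tendsto _).comp (tendsto_wellTerm hx hsucc))
  calc ∫⁻ x, ENNReal.ofReal ((z x ^ 2 - 1) ^ 2) ∂muI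
      = ∫⁻ x, liminf (fun n => F n x) atTop ∂muI :=
        lintegral_congr_ae (hlim.mono fun x hx => hx.liminf_eq.symm)
    _ ≤ liminf (fun n => ∫⁻ x, F n x ∂muI) atTop :=
        lintegral_liminf_le fun n => measurable_stepFun _ _ _
    _ = liminf (fun n => ENNReal.ofReal (lam n * wellSum (numCells (lam n)) (a n))) atTop := by
        simp only [F, ofReal_mul_wellSum (H.lam_null.pos _)]
    _ = ENNReal.ofReal p := ((ENNReal.continuous_ofReal.tendsto _).comp hp).liminf_eq

theorem ae_eq_const (hl : Tendsto (fun n => lam n / h n) atTop atTop) :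
    ∃ b : ℝ, z =ᵐ[muI] fun _ => b := by
  have hbound : Tendsto (fun n => c / κ n * (h n / lam n)) atTop (𝓝 0) := by
    simpa [Pi.inv_def] using H.tendsto_div_κ.mul hl.inv_tendsto_atTop
  have hgood := H.tendsto.and ae_mem_Ioo
  obtain ⟨x₀, hx₀, hx₀I⟩ := hgood.exists
  refine ⟨z x₀, ?_⟩
  filter_upwards [hgood] with x ⟨hx, hxI⟩
  have hsq : Tendsto (fun n => (a n ⌊x / lam n⌋₊ - a n ⌊x₀ / lam n⌋₊) ^ 2) atTop (𝓝 0) := by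
    refine squeeze_zero' (Eventually.of_forall fun n => sq_nonneg _) ?_ hbound
    filter_upwards [H.lam_null.eventually_floor_add_lt hxI.1.le hxI.2 0,
      H.lam_null.eventually_floor_add_lt hx₀I.1.le hx₀I.2 0] with n hn hn₀
    rw [← mul_div_assoc]
    exact (sq_sub_le_squaredIncrements_div (H.lam_null.pos n) (a n) hn₀ hn).trans
      (div_le_div_of_nonneg_right (H.squaredIncrements_le n) (H.lam_null.pos n).le)
  exact sub_eq_zero.1 (sq_eq_zero_iff.1 (tendsto_nhds_unique ((hx.sub hx₀).pow 2) hsq))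

end ChainLimit

theorem quadEnergy_const_le {lam h : ℝ} (hlam : 0 < lam) (hh : 0 ≤ h) (κ b : ℝ) :
    quadEnergy h κ (numCells lam) (fun _ => b) ≤ (b ^ 2 - 1) ^ 2 * (h / lam) := by
  have hN : ((numCells lam - 1 : ℕ) : ℝ) ≤ 1 / lam := by
    rw [le_div_iff₀ hlam, mul_comm]
    exact mul_numCells_sub_one_le hlam
  calc quadEnergy h κ (numCells lam) (fun _ => b)
      = (numCells lam - 1 : ℕ) * (h * (b ^ 2 - 1) ^ 2) := by
        simp only [quadEnergy, bondEnergy, sub_self, Finset.sum_const, Finset.card_range,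
          nsmul_eq_mul]
        ring
    _ ≤ 1 / lam * (h * (b ^ 2 - 1) ^ 2) := by gcongr
    _ = (b ^ 2 - 1) ^ 2 * (h / lam) := by ring

theorem gammaConverges_limitTop {lam del : ℕ → ℝ} (hlam : IsPosNullSeq lam)
    (hdel : IsPosNullSeq del) (hl : Tendsto (fun n => lam n / √(2 * del n)) atTop atTop) :
    GammaConverges (fun n => scaledHhf (lam n) (del n)) limitTop := by
  intro z
  refine ⟨fun y hy => hlam.le_liminf_scaledHhf hdel (fun φ κ a c hφ H => ?_) hy, ?_⟩
  · rw [limitTop, if_pos (H.ae_eq_const (hl.comp hφ))]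
    exact zero_le
  · refine ⟨fun _ => z, tendsto_const_nhds, ?_⟩
    unfold limitTop
    split_ifs with hz
    · obtain ⟨b, hb⟩ := hz
      have he : Tendsto (fun n => (b ^ 2 - 1) ^ 2 * (√(2 * del n) / lam n)) atTop (𝓝 0) := by
        simpa [Pi.inv_def] using hl.inv_tendsto_atTop.const_mul ((b ^ 2 - 1) ^ 2)
      rw [← ENNReal.ofReal_zero]
      exact hlam.limsup_scaledHhf_le hdel (a := fun _ _ => b) (fun _ _ => le_rfl)
        (Eventually.of_forall fun _ => rfl) (fun n => hb.mono fun x hx _ => hx) he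
        (Eventually.of_forall fun n => quadEnergy_const_le (hlam.pos n) (Real.sqrt_nonneg _) 1 b)
    · exact le_top

theorem IsTestFun.continuous {φ : ℝ → ℝ} (h : IsTestFun φ) : Continuous φ := h.1.continuous

theorem IsTestFun.continuous_deriv {φ : ℝ → ℝ} (h : IsTestFun φ) : Continuous (deriv φ) :=
  h.1.continuous_deriv (by simp)

theorem IsTestFun.eq_zero {φ : ℝ → ℝ} (h : IsTestFun φ) {x : ℝ} (hx : x ∉ Set.Ioo (0 : ℝ) 1) :
    φ x = 0 := image_eq_zero_of_notMem_tsupport fun hx' => hx (h.2.2 hx')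

section StepFunLimit

variable {lam : ℕ → ℝ} (hlam : IsPosNullSeq lam) {b : ℕ → ℕ → ℝ} {B : ℝ} {w φ : ℝ → ℝ}
include hlam

theorem tendsto_integral_stepFun_mul (hB : ∀ᶠ n in atTop, ∀ i < numCells (lam n), |b n i| ≤ B)
    (hw : ∀ᵐ x ∂muI, Tendsto (fun n => b n ⌊x / lam n⌋₊) atTop (𝓝 (w x))) (hφ : Continuous φ) :
    Tendsto (fun n => ∫ x, stepFun (lam n) (numCells (lam n)) (b n) x * φ x ∂muI) atTop
      (𝓝 (∫ x, w x * φ x ∂muI)) := by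
  refine tendsto_integral_filter_of_dominated_convergence (fun x => |B| * |φ x|)
    (Eventually.of_forall fun n => ?_) ?_ ?_ ?_
  · exact ((measurable_stepFun _ _ _).mul hφ.measurable).aestronglyMeasurable
  · filter_upwards [hB] with n hn
    refine Eventually.of_forall fun x => ?_
    rw [norm_mul, Real.norm_eq_abs, Real.norm_eq_abs]
    exact mul_le_mul_of_nonneg_right
      (abs_stepFun_le (abs_nonneg B) fun i hi => (hn i hi).trans (le_abs_self B)) (abs_nonneg _)
  · exact ((hφ.abs.const_mul |B|).integrableOn_Icc (a := 0) (b := 1)).mono_set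
      Set.Ioo_subset_Icc_self
  · filter_upwards [hw, ae_mem_Ioo] with x hx hxI
    exact (tendsto_stepFun hlam hxI 0 hx).mul_const _

theorem tendsto_neg_sum_sub_mul_testFun
    (hB : ∀ᶠ n in atTop, ∀ i < numCells (lam n), |b n i| ≤ B)
    (hw : ∀ᵐ x ∂muI, Tendsto (fun n => b n ⌊x / lam n⌋₊) atTop (𝓝 (w x))) (hφ : IsTestFun φ) :
    Tendsto (fun n => -∑ i ∈ Finset.range (numCells (lam n) - 1),
      (b n (i + 1) - b n i) * φ (lam n * (i + 1))) atTop (𝓝 (∫ x, w x * deriv φ x ∂muI)) := by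
  have hend : Tendsto (fun n => b n (numCells (lam n) - 1) * φ (lam n * numCells (lam n))) atTop
      (𝓝 0) := by
    have hφ1 : Tendsto (fun n => φ (lam n * numCells (lam n))) atTop (𝓝 0) := by
      rw [← hφ.eq_zero (x := 1) (by simp)]
      exact (hφ.continuous.tendsto 1).comp hlam.tendsto_mul_numCells
    refine squeeze_zero_norm' ?_ (by simpa using hφ1.abs.const_mul B)
    filter_upwards [hB, hlam.eventually_le_numCells 1] with n hn hN
    rw [norm_mul, Real.norm_eq_abs, Real.norm_eq_abs]
    exact mul_le_mul_of_nonneg_right (hn _ (by omega)) (abs_nonneg _)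
  have hlim := (tendsto_integral_stepFun_mul hlam hB hw hφ.continuous_deriv).sub hend
  rw [sub_zero] at hlim
  refine hlim.congr' ?_
  filter_upwards [hlam.eventually_le_numCells 1] with n hN
  rw [integral_stepFun_mul_deriv (hlam.pos n) hN (mul_numCells_le (hlam.pos n)) (b n)
    (hφ.1.of_le (by simp)), hφ.eq_zero (x := 0) (by simp)]
  ring

end StepFunLimit

/-! ### The lower bound for vanishing `lam / h` -/

/-- The odd primitive of `(1 - t²)⁺`: the Modica–Mortola change of variables, which turns the
energy into a bound for the total variation. -/
noncomputable def wellPrimitive (t : ℝ) : ℝ :=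
  max (-1) (min 1 t) - max (-1) (min 1 t) ^ 3 / 3

theorem continuous_wellPrimitive : Continuous wellPrimitive := by
  unfold wellPrimitive
  fun_prop

theorem wellPrimitive_of_mem_Icc {t : ℝ} (ht : t ∈ Set.Icc (-1 : ℝ) 1) :
    wellPrimitive t = t - t ^ 3 / 3 := by
  rw [wellPrimitive, min_eq_right ht.2, max_eq_right ht.1]

theorem wellPrimitive_of_one_le {t : ℝ} (h : 1 ≤ t) : wellPrimitive t = 2 / 3 := by
  rw [wellPrimitive, min_eq_left h]
  norm_num

theorem wellPrimitive_of_le_neg_one {t : ℝ} (h : t ≤ -1) : wellPrimitive t = -(2 / 3) := by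
  rw [wellPrimitive, min_eq_right (by linarith), max_eq_left h]
  norm_num

theorem wellPrimitive_neg (t : ℝ) : wellPrimitive (-t) = -wellPrimitive t := by
  rcases le_total t (-1) with hl | hl
  · rw [wellPrimitive_of_le_neg_one hl, wellPrimitive_of_one_le (by linarith), neg_neg]
  rcases le_total 1 t with hr | hr
  · rw [wellPrimitive_of_one_le hr, wellPrimitive_of_le_neg_one (by linarith)]
  rw [wellPrimitive_of_mem_Icc ⟨hl, hr⟩, wellPrimitive_of_mem_Icc ⟨by linarith, by linarith⟩]
  ring

theorem wellPrimitive_of_eq_one_or {t : ℝ} (ht : t = 1 ∨ t = -1) :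
    wellPrimitive t = 2 / 3 * t := by
  rcases ht with rfl | rfl
  · rw [wellPrimitive_of_one_le le_rfl, mul_one]
  · rw [wellPrimitive_of_le_neg_one le_rfl, mul_neg_one]

theorem abs_wellPrimitive_add_le {t : ℝ} (ht : -1 ≤ t) :
    |wellPrimitive t + 2 / 3| ≤ (1 + t) ^ 2 := by
  rcases le_total 1 t with hr | hr
  · rw [wellPrimitive_of_one_le hr, abs_of_nonneg (by norm_num)]
    nlinarith
  · have hfactor : wellPrimitive t + 2 / 3 = (1 + t) ^ 2 * ((2 - t) / 3) := by
      rw [wellPrimitive_of_mem_Icc ⟨ht, hr⟩]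
      ring
    rw [hfactor, abs_of_nonneg (mul_nonneg (sq_nonneg _) (by linarith))]
    exact mul_le_of_le_one_right (sq_nonneg _) (by linarith)

theorem abs_wellPrimitive_sub_le_of_le_neg_one {s : ℝ} (hs : s ≤ -1) (t : ℝ) :
    |wellPrimitive t - wellPrimitive s| ≤ (t - s) ^ 2 := by
  rw [wellPrimitive_of_le_neg_one hs, sub_neg_eq_add]
  rcases le_total t (-1) with ht | ht
  · rw [wellPrimitive_of_le_neg_one ht, neg_add_cancel, abs_zero]
    exact sq_nonneg _
  · exact (abs_wellPrimitive_add_le ht).trans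
      (pow_le_pow_left₀ (by linarith) (by linarith) 2)

theorem abs_wellPrimitive_sub_le_of_mem_Icc {s t : ℝ} (hs : s ∈ Set.Icc (-1 : ℝ) 1)
    (ht : t ∈ Set.Icc (-1 : ℝ) 1) (hst : s ≤ t) :
    |wellPrimitive t - wellPrimitive s| ≤ |t - s| * |(s ^ 2 + t ^ 2) / 2 - 1| + (t - s) ^ 2 := by
  have hexpand : wellPrimitive t - wellPrimitive s =
      (t - s) * -((s ^ 2 + t ^ 2) / 2 - 1) + (t - s) ^ 2 * ((t - s) / 6) := by
    rw [wellPrimitive_of_mem_Icc hs, wellPrimitive_of_mem_Icc ht]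
    ring
  rw [hexpand]
  refine (abs_add_le _ _).trans (add_le_add (by rw [abs_mul, abs_neg]) ?_)
  rw [abs_of_nonneg (mul_nonneg (sq_nonneg _) (by linarith))]
  exact mul_le_of_le_one_right (sq_nonneg _) (by linarith [hs.1, ht.2])

theorem abs_wellPrimitive_sub_le (s t : ℝ) :
    |wellPrimitive t - wellPrimitive s| ≤ |t - s| * |(s ^ 2 + t ^ 2) / 2 - 1| + (t - s) ^ 2 := by
  wlog hst : s ≤ t generalizing s t
  · simpa only [abs_sub_comm (wellPrimitive s), abs_sub_comm s, add_comm (t ^ 2), sub_sq_comm s]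
      using this t s (not_le.1 hst).le
  have hcross : 0 ≤ |t - s| * |(s ^ 2 + t ^ 2) / 2 - 1| := by positivity
  rcases le_total s (-1) with hs | hs
  · exact le_add_of_nonneg_of_le hcross (abs_wellPrimitive_sub_le_of_le_neg_one hs t)
  rcases le_total 1 t with ht | ht
  · have hreflect := abs_wellPrimitive_sub_le_of_le_neg_one (neg_le_neg ht) (-s)
    rw [wellPrimitive_neg, wellPrimitive_neg, neg_sub_neg, neg_sub_neg] at hreflect
    exact le_add_of_nonneg_of_le hcross hreflect
  · exact abs_wellPrimitive_sub_le_of_mem_Icc ⟨hs, hst.trans ht⟩ ⟨hs.trans hst, ht⟩ hst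

theorem abs_wellPrimitive_le (t : ℝ) : |wellPrimitive t| ≤ 1 := by
  rcases le_total t (-1) with hl | hl
  · rw [wellPrimitive_of_le_neg_one hl]
    norm_num [abs_of_pos]
  rcases le_total 1 t with hr | hr
  · rw [wellPrimitive_of_one_le hr]
    norm_num [abs_of_pos]
  rw [wellPrimitive_of_mem_Icc ⟨hl, hr⟩, abs_le]
  constructor <;> nlinarith [mul_nonneg (sub_nonneg.2 hr) (sub_nonneg.2 hl), sq_nonneg t]

theorem two_mul_abs_wellPrimitive_sub_le {h κ : ℝ} (hh : 0 < h) (hκ : 0 < κ) (x y : ℝ) :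
    2 * |wellPrimitive y - wellPrimitive x| ≤ max 1 ((1 + 2 * h) / κ) * bondEnergy h κ x y := by
  set K := max 1 ((1 + 2 * h) / κ)
  set A := (x ^ 2 + y ^ 2) / 2 - 1 with hA
  set D := y - x
  have hK : 1 ≤ K := le_max_left _ _
  have hKκ : 1 + 2 * h ≤ K * κ := (div_le_iff₀ hκ).1 (le_max_right _ _)
  have hyoung : 2 * (|D| * |A|) ≤ h * A ^ 2 + 1 / h * D ^ 2 := by
    rw [← sq_abs A, ← sq_abs D, ← sub_nonneg]
    have hsquare : h * |A| ^ 2 + 1 / h * |D| ^ 2 - 2 * (|D| * |A|) = (h * |A| - |D|) ^ 2 / h := by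
      field_simp
      ring
    rw [hsquare]
    positivity
  calc 2 * |wellPrimitive y - wellPrimitive x|
      ≤ 2 * (|D| * |A| + D ^ 2) := by gcongr; exact abs_wellPrimitive_sub_le x y
    _ ≤ h * A ^ 2 + 1 / h * D ^ 2 + 2 * D ^ 2 := by linarith
    _ = 1 * (h * A ^ 2) + (1 + 2 * h) * (1 / h * D ^ 2) := by field_simp; ring
    _ ≤ K * (h * A ^ 2) + K * κ * (1 / h * D ^ 2) := by gcongr
    _ = K * bondEnergy h κ x y := by rw [bondEnergy, hA]; ring

namespace ChainLimit

variable {lam h κ : ℕ → ℝ} {c : ℝ} {a : ℕ → ℕ → ℝ} {z : ℝ → ℝ} (H : ChainLimit lam h κ c a z)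
include H

theorem sum_abs_wellPrimitive_sub_le (n : ℕ) :
    ∑ i ∈ Finset.range (numCells (lam n) - 1),
      |wellPrimitive (a n (i + 1)) - wellPrimitive (a n i)| ≤
        max 1 ((1 + 2 * h n) / κ n) * c / 2 := by
  rw [le_div_iff₀' two_pos, Finset.mul_sum]
  calc _ ≤ ∑ i ∈ Finset.range (numCells (lam n) - 1), max 1 ((1 + 2 * h n) / κ n) *
          bondEnergy (h n) (κ n) (a n i) (a n (i + 1)) :=
        Finset.sum_le_sum fun i _ =>
          two_mul_abs_wellPrimitive_sub_le (H.h_null.pos n) (H.κ_pos n) _ _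
    _ = max 1 ((1 + 2 * h n) / κ n) * quadEnergy (h n) (κ n) (numCells (lam n)) (a n) :=
        (Finset.mul_sum _ _ _).symm
    _ ≤ max 1 ((1 + 2 * h n) / κ n) * c := by gcongr; exact H.energy_le n

theorem tendsto_variation_bound :
    Tendsto (fun n => max 1 ((1 + 2 * h n) / κ n) * c / 2) atTop (𝓝 (c / 2)) := by
  have hfactor : Tendsto (fun n => (1 + 2 * h n) / κ n) atTop (𝓝 1) := by
    simpa [Pi.div_def] using
      ((H.h_null.tendsto.const_mul 2).const_add 1).div H.κ_tendsto one_ne_zero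
  simpa using (((tendsto_const_nhds (x := (1 : ℝ))).max hfactor).mul_const c).div_const 2

theorem ae_eq_one_or (hl : Tendsto (fun n => lam n / h n) atTop (𝓝 0)) :
    ∀ᵐ x ∂muI, z x = 1 ∨ z x = -1 := by
  have hwell : Tendsto (fun n => lam n * wellSum (numCells (lam n)) (a n)) atTop (𝓝 0) :=
    squeeze_zero (fun n => mul_nonneg (H.lam_null.pos n).le (wellSum_nonneg _ _))
      H.mul_wellSum_le (by simpa using hl.const_mul c)
  have hmeas : AEMeasurable z muI :=
    aemeasurable_of_tendsto_metrizable_ae atTop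
      (fun n => (measurable_comp_floor (lam n) (a n)).aemeasurable) H.tendsto
  have hint := H.lintegral_well_le hwell
  rw [ENNReal.ofReal_zero, nonpos_iff_eq_zero, lintegral_eq_zero_iff' (by fun_prop)] at hint
  filter_upwards [hint] with x hx
  have hsq : (z x ^ 2 - 1) ^ 2 = 0 := le_antisymm (ENNReal.ofReal_eq_zero.1 hx) (sq_nonneg _)
  exact sq_eq_one_iff.1 (sub_eq_zero.1 (sq_eq_zero_iff.1 hsq))

theorem isBVpm (hl : Tendsto (fun n => lam n / h n) atTop (𝓝 0)) : IsBVpm z := by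
  have hz := H.ae_eq_one_or hl
  refine ⟨hz, 3 / 2 * (c / 2), fun φ hφ hφ1 => ?_⟩
  have hlim : ∀ᵐ x ∂muI, Tendsto (fun n => wellPrimitive (a n ⌊x / lam n⌋₊)) atTop
      (𝓝 (2 / 3 * z x)) := by
    filter_upwards [H.tendsto, hz] with x hx hzx
    rw [← wellPrimitive_of_eq_one_or hzx]
    exact (continuous_wellPrimitive.tendsto _).comp hx
  have hle := le_of_tendsto_of_tendsto' (tendsto_neg_sum_sub_mul_testFun H.lam_null
    (b := fun n i => wellPrimitive (a n i))
    (Eventually.of_forall fun n i _ => abs_wellPrimitive_le _) hlim hφ)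
    H.tendsto_variation_bound fun n => ?_
  · simp only [mul_assoc, integral_const_mul] at hle
    linarith
  · calc _ ≤ ∑ i ∈ Finset.range (numCells (lam n) - 1),
          |(wellPrimitive (a n (i + 1)) - wellPrimitive (a n i)) * φ (lam n * (i + 1))| :=
        (neg_le_abs _).trans (Finset.abs_sum_le_sum_abs _ _)
      _ ≤ ∑ i ∈ Finset.range (numCells (lam n) - 1),
          |wellPrimitive (a n (i + 1)) - wellPrimitive (a n i)| :=
        Finset.sum_le_sum fun i _ => by
          rw [abs_mul]
          exact mul_le_of_le_one_right (abs_nonneg _) (hφ1 _)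
      _ ≤ _ := H.sum_abs_wellPrimitive_sub_le n

end ChainLimit

theorem exists_separating_radius {T : Finset ℝ} (hT : ∀ p ∈ T, p ∈ Set.Ioo (0 : ℝ) 1) :
    ∃ r > 0, (∀ p ∈ T, Metric.ball p r ⊆ Set.Ioo 0 1) ∧
      ∀ p ∈ T, ∀ q ∈ T, p ≠ q → Disjoint (Metric.ball p r) (Metric.ball q r) := by
  have hsub : ∀ᶠ r in 𝓝[>] (0 : ℝ), ∀ p ∈ T, Metric.ball p r ⊆ Set.Ioo 0 1 := by
    rw [eventually_all_finset]
    intro p hp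
    obtain ⟨ε, hε, hball⟩ := Metric.isOpen_iff.1 isOpen_Ioo p (hT p hp)
    filter_upwards [Ioo_mem_nhdsGT hε] with r hr
    exact (Metric.ball_subset_ball hr.2.le).trans hball
  have hdisj : ∀ᶠ r in 𝓝[>] (0 : ℝ), ∀ p ∈ T, ∀ q ∈ T, p ≠ q →
      Disjoint (Metric.ball p r) (Metric.ball q r) := by
    simp only [eventually_all_finset, eventually_imp_distrib_left]
    intro p _ q _ hpq
    filter_upwards [Ioo_mem_nhdsGT (half_pos (dist_pos.2 hpq))] with r hr
    exact Metric.ball_disjoint_ball (by linarith [hr.2])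
  obtain ⟨r, ⟨hr_sub, hr_disj⟩, hr⟩ := ((hsub.and hdisj).and self_mem_nhdsWithin).exists
  exact ⟨r, hr, hr_sub, hr_disj⟩

/-- `b` is the approximate limit of `z` at `p`; the jump set consists of the points of `(0, 1)`
without approximate limit. -/
def HasApproxLimit (z : ℝ → ℝ) (p b : ℝ) : Prop :=
  Tendsto (fun r => ⨍ y in Metric.ball p r, |z y - b| ∂muI) (𝓝[>] 0) (𝓝 0)

theorem mem_jumpSet_iff {z : ℝ → ℝ} {p : ℝ} :
    p ∈ jumpSet z ↔ p ∈ Set.Ioo (0 : ℝ) 1 ∧ ¬∃ b, HasApproxLimit z p b :=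
  Iff.rfl

theorem HasApproxLimit.of_ae_eq_mul {z w : ℝ → ℝ} {p b r e : ℝ} (hz : HasApproxLimit z p b)
    (hr : 0 < r) (h : ∀ᵐ x ∂muI, x ∈ Metric.ball p r → w x = e * z x) :
    HasApproxLimit w p (e * b) := by
  have hlim := Tendsto.const_mul |e| hz
  rw [mul_zero] at hlim
  refine hlim.congr' ?_
  filter_upwards [Ioo_mem_nhdsGT hr] with ρ hρ
  rw [setAverage_eq, setAverage_eq, smul_eq_mul, smul_eq_mul, mul_left_comm, ← integral_const_mul]
  congr 1
  refine integral_congr_ae ?_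
  rw [EventuallyEq, ae_restrict_iff' measurableSet_ball]
  filter_upwards [h] with x hx hxρ
  rw [hx (Metric.ball_subset_ball hρ.2.le hxρ), ← mul_sub, abs_mul]

theorem notMem_jumpSet_of_ae_eq {z : ℝ → ℝ} {p r b : ℝ} (hr : 0 < r)
    (h : ∀ᵐ x ∂muI, x ∈ Metric.ball p r → z x = b) : p ∉ jumpSet z := by
  have hone : HasApproxLimit (fun _ => 1) p 1 := by simp [HasApproxLimit]
  have hlim : HasApproxLimit z p (b * 1) := hone.of_ae_eq_mul hr (by simpa only [mul_one] using h)
  exact fun hp => (mem_jumpSet_iff.1 hp).2 ⟨_, hlim⟩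

theorem exists_mem_ball_eq_of_mem_jumpSet {z : ℝ → ℝ} {G : ℝ → Prop} (hG : ∀ᵐ x ∂muI, G x)
    {p r b b' : ℝ} (hr : 0 < r) (hz : ∀ᵐ x ∂muI, z x = b ∨ z x = b') (hp : p ∈ jumpSet z) :
    ∃ x ∈ Metric.ball p r, G x ∧ z x = b := by
  by_contra! hcon
  refine notMem_jumpSet_of_ae_eq hr (b := b') ?_ hp
  filter_upwards [hz, hG] with x hx hGx hxp
  exact hx.resolve_left (hcon x hxp hGx)

theorem exists_sign_change {z : ℝ → ℝ} (hz : ∀ᵐ x ∂muI, z x = 1 ∨ z x = -1) {G : ℝ → Prop}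
    (hG : ∀ᵐ x ∂muI, G x) {p r : ℝ} (hr : 0 < r) (hp : p ∈ jumpSet z) :
    ∃ x ∈ Metric.ball p r, ∃ y ∈ Metric.ball p r, x < y ∧ G x ∧ G y ∧
      (z x = 1 ∧ z y = -1 ∨ z x = -1 ∧ z y = 1) := by
  obtain ⟨x, hx, hGx, hzx⟩ := exists_mem_ball_eq_of_mem_jumpSet hG hr hz hp
  obtain ⟨y, hy, hGy, hzy⟩ :=
    exists_mem_ball_eq_of_mem_jumpSet hG hr (hz.mono fun _ => Or.symm) hp
  have hxy : x ≠ y := by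
    rintro rfl
    linarith
  rcases hxy.lt_or_gt with h | h
  · exact ⟨x, hx, y, hy, h, hGx, hGy, Or.inl ⟨hzx, hzy⟩⟩
  · exact ⟨y, hy, x, hx, h, hGy, hGx, Or.inr ⟨hzy, hzx⟩⟩

theorem mul_succ_mem_Icc {lam x y : ℝ} (hlam : 0 < lam) (hx : 0 ≤ x) (hy : 0 ≤ y) {i : ℕ}
    (hi : i ∈ Finset.Ico ⌊x / lam⌋₊ ⌊y / lam⌋₊) : lam * (i + 1) ∈ Set.Icc x y := by
  rw [Finset.mem_Ico] at hi
  have hxi : (⌊x / lam⌋₊ : ℝ) ≤ i := by exact_mod_cast hi.1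
  have hiy : (i + 1 : ℝ) ≤ ⌊y / lam⌋₊ := by exact_mod_cast hi.2
  exact ⟨(lt_mul_floor hlam hx).le.trans (by gcongr),
    le_trans (by gcongr) (mul_floor_le hlam hy)⟩

theorem sum_abs_sub_le_sum_range {ι : Type*} (f : ℕ → ℝ) {T : Finset ι} {s t : ι → ℕ} {M : ℕ}
    (hst : ∀ p ∈ T, s p ≤ t p) (ht : ∀ p ∈ T, t p ≤ M)
    (hdisj : (T : Set ι).PairwiseDisjoint fun p => Finset.Ico (s p) (t p)) :
    ∑ p ∈ T, |f (t p) - f (s p)| ≤ ∑ i ∈ Finset.range M, |f (i + 1) - f i| := by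
  classical
  calc ∑ p ∈ T, |f (t p) - f (s p)|
      ≤ ∑ p ∈ T, ∑ i ∈ Finset.Ico (s p) (t p), |f (i + 1) - f i| :=
        Finset.sum_le_sum fun p hp => by
          rw [← Finset.sum_Ico_sub f (hst p hp)]
          exact Finset.abs_sum_le_sum_abs _ _
    _ = ∑ i ∈ T.biUnion fun p => Finset.Ico (s p) (t p), |f (i + 1) - f i| :=
        (Finset.sum_biUnion hdisj).symm
    _ ≤ ∑ i ∈ Finset.range M, |f (i + 1) - f i| :=
        Finset.sum_le_sum_of_subset_of_nonneg
          (Finset.biUnion_subset.2 fun p hp i hi =>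
            Finset.mem_range.2 ((Finset.mem_Ico.1 hi).2.trans_le (ht p hp)))
          fun _ _ _ => abs_nonneg _

namespace ChainLimit

variable {lam h κ : ℕ → ℝ} {c : ℝ} {a : ℕ → ℕ → ℝ} {z : ℝ → ℝ} (H : ChainLimit lam h κ c a z)
include H

theorem eventually_sum_abs_sub_le {T : Finset ℝ} {r : ℝ} {x y : ℝ → ℝ}
    (hball : ∀ p ∈ T, Metric.ball p r ⊆ Set.Ioo 0 1)
    (hdisj : ∀ p ∈ T, ∀ q ∈ T, p ≠ q → Disjoint (Metric.ball p r) (Metric.ball q r))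
    (hx : ∀ p ∈ T, x p ∈ Metric.ball p r) (hy : ∀ p ∈ T, y p ∈ Metric.ball p r)
    (hxy : ∀ p ∈ T, x p < y p) (f : ℝ → ℝ) :
    ∀ᶠ n in atTop, ∑ p ∈ T, |f (a n ⌊y p / lam n⌋₊) - f (a n ⌊x p / lam n⌋₊)| ≤
      ∑ i ∈ Finset.range (numCells (lam n) - 1), |f (a n (i + 1)) - f (a n i)| := by
  have hlast : ∀ᶠ n in atTop, ∀ p ∈ T, ⌊y p / lam n⌋₊ + 1 < numCells (lam n) := by
    rw [eventually_all_finset]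
    intro p hp
    have hyI := hball p hp (hy p hp)
    exact H.lam_null.eventually_floor_add_lt hyI.1.le hyI.2 1
  filter_upwards [hlast] with n hn
  have hlam := H.lam_null.pos n
  refine sum_abs_sub_le_sum_range (fun i => f (a n i))
    (fun p hp => Nat.floor_mono (div_le_div_of_nonneg_right (hxy p hp).le hlam.le))
    (fun p hp => by have := hn p hp; omega) fun p hp q hq hpq => ?_
  have hmem (p : ℝ) (hp : p ∈ T) {i : ℕ}
      (hi : i ∈ Finset.Ico ⌊x p / lam n⌋₊ ⌊y p / lam n⌋₊) : lam n * (i + 1) ∈ Metric.ball p r :=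
    (convex_ball p r).ordConnected.out (hx p hp) (hy p hp)
      (mul_succ_mem_Icc hlam (hball p hp (hx p hp)).1.le (hball p hp (hy p hp)).1.le hi)
  rw [Function.onFun, Finset.disjoint_left]
  exact fun i hi hi' => Set.disjoint_left.1 (hdisj p hp q hq hpq) (hmem p hp hi) (hmem q hq hi')

theorem mul_card_le (hl : Tendsto (fun n => lam n / h n) atTop (𝓝 0)) {T : Finset ℝ}
    (hT : ↑T ⊆ jumpSet z) : 8 / 3 * (T.card : ℝ) ≤ c := by
  obtain ⟨r, hr, hball, hdisj⟩ := exists_separating_radius fun p hp => (hT hp).1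
  have hchange := fun p (hp : p ∈ T) =>
    exists_sign_change (H.ae_eq_one_or hl) H.tendsto hr (hT hp)
  choose! x hx y hy hxy hxlim hylim hsign using hchange
  have hlim : Tendsto (fun n => ∑ p ∈ T, |wellPrimitive (a n ⌊y p / lam n⌋₊) -
      wellPrimitive (a n ⌊x p / lam n⌋₊)|) atTop (𝓝 (∑ p ∈ T, 4 / 3)) := by
    refine tendsto_finsetSum _ fun p hp => ?_
    have hjump : |wellPrimitive (z (y p)) - wellPrimitive (z (x p))| = 4 / 3 := by
      rcases hsign p hp with ⟨hzx, hzy⟩ | ⟨hzx, hzy⟩ <;>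
        rw [hzx, hzy, wellPrimitive_of_one_le le_rfl, wellPrimitive_of_le_neg_one le_rfl] <;>
        norm_num
    rw [← hjump]
    exact (((continuous_wellPrimitive.tendsto _).comp (hylim p hp)).sub
      ((continuous_wellPrimitive.tendsto _).comp (hxlim p hp))).abs
  have hle := le_of_tendsto_of_tendsto hlim H.tendsto_variation_bound
    ((H.eventually_sum_abs_sub_le hball hdisj hx hy hxy wellPrimitive).mono fun n hn =>
      hn.trans (H.sum_abs_wellPrimitive_sub_le n))
  rw [Finset.sum_const, nsmul_eq_mul] at hle
  linarith

end ChainLimit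

theorem ChainLimit.limitZero_le {lam h κ : ℕ → ℝ} {c : ℝ} {a : ℕ → ℕ → ℝ} {z : L1I}
    (H : ChainLimit lam h κ c a z) (hl : Tendsto (fun n => lam n / h n) atTop (𝓝 0)) :
    limitZero z ≤ ENNReal.ofReal c := by
  rw [limitZero, if_pos (H.isBVpm hl)]
  have hfin : (jumpSet z).Finite := by
    by_contra hinf
    obtain ⟨m, hm⟩ := exists_nat_gt (3 / 8 * c)
    obtain ⟨T, hT, hcard⟩ := Set.Infinite.exists_subset_card_eq hinf m
    have hle := H.mul_card_le hl hT
    rw [hcard] at hle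
    linarith
  have hle := H.mul_card_le hl (T := hfin.toFinset) hfin.coe_toFinset.subset
  rw [hfin.encard_eq_coe_toFinset_card]
  convert! ENNReal.ofReal_le_ofReal hle
  rw [ENNReal.ofReal_mul (by norm_num), ENNReal.ofReal_div_of_pos (by norm_num)]
  simp

/-! ### Functions with values `±1` and finite jump set -/

theorem intervalIntegrable_of_integrable_muI {f : ℝ → ℝ} (hf : Integrable f muI) {x y : ℝ}
    (hx : x ∈ Set.Icc (0 : ℝ) 1) (hy : y ∈ Set.Icc (0 : ℝ) 1) :
    IntervalIntegrable f volume x y := by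
  have hunit : IntervalIntegrable f volume 0 1 := by
    rw [intervalIntegrable_iff_integrableOn_Ioc_of_le zero_le_one, IntegrableOn, ← muI_eq_Ioc]
    exact hf
  refine hunit.mono_set ?_
  rw [Set.uIcc_of_le zero_le_one]
  exact Set.ordConnected_Icc.uIcc_subset hx hy

theorem setAverage_ball_muI {p r : ℝ} (hr : 0 < r) (hsub : Metric.ball p r ⊆ Set.Ioo 0 1)
    (f : ℝ → ℝ) : ⨍ t in Metric.ball p r, f t ∂muI = (2 * r)⁻¹ * ∫ t in Metric.ball p r, f t := by
  rw [setAverage_eq, measureReal_restrict_apply measurableSet_ball, Set.inter_eq_left.2 hsub,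
    measureReal_def, Real.volume_ball, ENNReal.toReal_ofReal (by positivity),
    Measure.restrict_restrict_of_subset hsub, smul_eq_mul]

theorem norm_intervalIntegral_le_setAverage {f : ℝ → ℝ} (hf : Integrable f muI) {p y : ℝ}
    (hyp : y ≠ p) (hsub : Metric.ball p (2 * |y - p|) ⊆ Set.Ioo 0 1) :
    ‖∫ t in p..y, f t‖ ≤ 4 * |y - p| * ⨍ t in Metric.ball p (2 * |y - p|), |f t| ∂muI := by
  have hpos : 0 < |y - p| := abs_pos.2 (sub_ne_zero.2 hyp)
  have hmem : y ∈ Metric.ball p (2 * |y - p|) := by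
    rw [Metric.mem_ball, Real.dist_eq]
    linarith
  have hball : Set.uIoc p y ⊆ Metric.ball p (2 * |y - p|) :=
    Set.uIoc_subset_uIcc.trans ((convex_ball _ _).ordConnected.uIcc_subset
      (Metric.mem_ball_self (by positivity)) hmem)
  have hint : IntegrableOn (fun t => |f t|) (Metric.ball p (2 * |y - p|)) :=
    IntegrableOn.mono_set (t := Set.Ioo 0 1) hf.abs hsub
  calc ‖∫ t in p..y, f t‖ ≤ ∫ t in Set.uIoc p y, |f t| :=
        intervalIntegral.norm_integral_le_integral_norm_uIoc
    _ ≤ ∫ t in Metric.ball p (2 * |y - p|), |f t| :=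
        setIntegral_mono_set hint (Eventually.of_forall fun _ => abs_nonneg _) hball.eventuallyLE
    _ = 4 * |y - p| * ⨍ t in Metric.ball p (2 * |y - p|), |f t| ∂muI := by
        rw [setAverage_ball_muI (by positivity) hsub]
        field_simp
        ring

theorem HasApproxLimit.hasDerivAt_integral {z : ℝ → ℝ} (hz : Integrable z muI) {p b : ℝ}
    (hp : p ∈ Set.Ioo (0 : ℝ) 1) (h : HasApproxLimit z p b) :
    HasDerivAt (fun x => ∫ t in (0 : ℝ)..x, z t) b p := by
  have hradius : Tendsto (fun y => 2 * |y - p|) (𝓝[≠] p) (𝓝[>] 0) := by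
    refine tendsto_nhdsWithin_iff.2 ⟨tendsto_nhdsWithin_of_tendsto_nhds ?_, ?_⟩
    · exact Continuous.tendsto' (by fun_prop) _ _ (by simp)
    · filter_upwards [self_mem_nhdsWithin] with y hy
      exact mul_pos two_pos (abs_pos.2 (sub_ne_zero.2 hy))
  have hbound : Tendsto (fun y => 4 * ⨍ t in Metric.ball p (2 * |y - p|), |z t - b| ∂muI)
      (𝓝[≠] p) (𝓝 0) := by
    simpa only [mul_zero, Function.comp_def] using (Tendsto.comp h hradius).const_mul 4
  obtain ⟨ε, hε, hball⟩ := Metric.isOpen_iff.1 isOpen_Ioo p hp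
  rw [hasDerivAt_iff_tendsto_slope, tendsto_iff_norm_sub_tendsto_zero]
  refine squeeze_zero' (Eventually.of_forall fun y => norm_nonneg _) ?_ hbound
  filter_upwards [self_mem_nhdsWithin, hradius.eventually (Ioo_mem_nhdsGT hε)] with y hyp hyε
  have hyp : y ≠ p := hyp
  have hsub : Metric.ball p (2 * |y - p|) ⊆ Set.Ioo 0 1 :=
    (Metric.ball_subset_ball hyε.2.le).trans hball
  have hpos : 0 < |y - p| := abs_pos.2 (sub_ne_zero.2 hyp)
  have hy : y ∈ Set.Ioo (0 : ℝ) 1 := hsub (by rw [Metric.mem_ball, Real.dist_eq]; linarith)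
  have h0 : (0 : ℝ) ∈ Set.Icc (0 : ℝ) 1 := Set.left_mem_Icc.2 zero_le_one
  have hyI := Set.Ioo_subset_Icc_self hy
  have hpI := Set.Ioo_subset_Icc_self hp
  have hslope : slope (fun x => ∫ t in (0 : ℝ)..x, z t) p y - b =
      (y - p)⁻¹ * ∫ t in p..y, (z t - b) := by
    rw [intervalIntegral.integral_sub (intervalIntegrable_of_integrable_muI hz hpI hyI)
      intervalIntegrable_const, ← intervalIntegral.integral_interval_sub_left
      (intervalIntegrable_of_integrable_muI hz h0 hyI)
      (intervalIntegrable_of_integrable_muI hz h0 hpI), slope_def_field,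
      intervalIntegral.integral_const, smul_eq_mul, mul_sub, inv_mul_cancel_left₀
      (sub_ne_zero.2 hyp), div_eq_inv_mul]
  rw [hslope, norm_mul, norm_inv, Real.norm_eq_abs, inv_mul_le_iff₀ hpos, mul_left_comm,
    ← mul_assoc]
  exact norm_intervalIntegral_le_setAverage (hz.sub (integrable_const b)) hyp hsub

section SignValued

variable {z : ℝ → ℝ}

theorem HasApproxLimit.ne_zero (hz : ∀ᵐ x ∂muI, z x = 1 ∨ z x = -1) {p b : ℝ}
    (hp : p ∈ Set.Ioo (0 : ℝ) 1) (h : HasApproxLimit z p b) : b ≠ 0 := by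
  rintro rfl
  have hone : ∀ᶠ r in 𝓝[>] (0 : ℝ), ⨍ y in Metric.ball p r, |z y - 0| ∂muI = 1 := by
    filter_upwards [self_mem_nhdsWithin] with r (hr : 0 < r)
    have habs : ∀ᵐ y ∂muI.restrict (Metric.ball p r), |z y - 0| = 1 := by
      filter_upwards [ae_restrict_of_ae hz] with y hy
      rw [sub_zero, abs_eq zero_le_one]
      exact hy
    rw [average_congr habs]
    refine setAverage_const ?_ (measure_ne_top _ _) _
    rw [Measure.restrict_apply measurableSet_ball]
    exact ((Metric.isOpen_ball.inter isOpen_Ioo).measure_pos volume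
      ⟨p, Metric.mem_ball_self hr, hp⟩).ne'
  exact one_ne_zero (tendsto_nhds_unique (tendsto_const_nhds.congr' (EventuallyEq.symm hone)) h)

theorem ae_hasDerivAt_integral (hz : Integrable z muI) :
    ∀ᵐ x ∂muI, HasDerivAt (fun x => ∫ t in (0 : ℝ)..x, z t) (z x) x := by
  have hunit : IntervalIntegrable z volume 0 1 :=
    intervalIntegrable_of_integrable_muI hz (by simp) (by simp)
  filter_upwards [ae_restrict_of_ae hunit.ae_hasDerivAt_integral, ae_mem_Ioo] with x hx hxI
  refine hx ?_ 0 (by simp)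
  rw [Set.uIcc_of_le zero_le_one]
  exact Set.Ioo_subset_Icc_self hxI

theorem exists_ae_eq_of_notMem_jumpSet (hm : AEStronglyMeasurable z muI)
    (hz : ∀ᵐ x ∂muI, z x = 1 ∨ z x = -1) {α β : ℝ} (hsub : Set.Ioo α β ⊆ Set.Ioo 0 1)
    (hj : ∀ p ∈ Set.Ioo α β, p ∉ jumpSet z) :
    ∃ b : ℝ, (b = 1 ∨ b = -1) ∧ ∀ᵐ x ∂muI, x ∈ Set.Ioo α β → z x = b := by
  have hint : Integrable z muI := by
    refine Integrable.mono' (integrable_const (1 : ℝ)) hm (hz.mono fun x hx => ?_)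
    rcases hx with hx | hx <;> simp [hx]
  have hlim (p : ℝ) (hp : p ∈ Set.Ioo α β) : ∃ b, HasApproxLimit z p b := by
    by_contra hcon
    exact hj p hp (mem_jumpSet_iff.2 ⟨hsub hp, hcon⟩)
  choose! b hb using hlim
  have hderiv (p : ℝ) (hp : p ∈ Set.Ioo α β) :=
    (hb p hp).hasDerivAt_integral hint (hsub hp)
  have hzb : ∀ᵐ x ∂muI, x ∈ Set.Ioo α β → z x = b x := by
    filter_upwards [ae_hasDerivAt_integral hint] with x hx hxI
    exact hx.unique (hderiv x hxI)
  -- The approximate limits are the values of a derivative that does not vanish, so by Darboux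
  -- they all have the same sign.
  rcases hasDerivWithinAt_forall_lt_or_forall_gt_of_forall_ne (convex_Ioo α β)
    (fun p hp => (hderiv p hp).hasDerivWithinAt)
    (fun p hp => (hb p hp).ne_zero hz (hsub hp)) with hneg | hpos
  · refine ⟨-1, Or.inr rfl, ?_⟩
    filter_upwards [hz, hzb] with x hx hxb hxI
    exact hx.resolve_left fun hone => by linarith [hneg x hxI, hxb hxI]
  · refine ⟨1, Or.inl rfl, ?_⟩
    filter_upwards [hz, hzb] with x hx hxb hxI
    exact hx.resolve_right fun hone => by linarith [hpos x hxI, hxb hxI]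

theorem ae_muI_ne (p : ℝ) : ∀ᵐ x ∂muI, x ≠ p :=
  ae_restrict_of_ae (Measure.ae_ne volume p)

theorem exists_one_sided_values (hm : AEStronglyMeasurable z muI)
    (hz : ∀ᵐ x ∂muI, z x = 1 ∨ z x = -1) {p : ℝ} (hp : p ∈ Set.Ioo (0 : ℝ) 1) {S : Set ℝ}
    (hSfin : S.Finite) (hpS : p ∉ S) (hS : jumpSet z ⊆ insert p S) :
    ∃ r > 0, ∃ b₁ b₂ : ℝ, (b₁ = 1 ∨ b₁ = -1) ∧ (b₂ = 1 ∨ b₂ = -1) ∧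
      ∀ᵐ x ∂muI, x ∈ Metric.ball p r → z x = if x < p then b₁ else b₂ := by
  obtain ⟨r, hr, hball⟩ := Metric.isOpen_iff.1
    (isOpen_Ioo.inter hSfin.isClosed.isOpen_compl) p ⟨hp, hpS⟩
  have hnj : ∀ q ∈ Metric.ball p r, q ≠ p → q ∉ jumpSet z := fun q hq hqp hqj =>
    (hball hq).2 ((hS hqj).resolve_left hqp)
  rw [Real.ball_eq_Ioo] at hball hnj
  have hleft : Set.Ioo (p - r) p ⊆ Set.Ioo (p - r) (p + r) :=
    Set.Ioo_subset_Ioo_right (by linarith)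
  have hright : Set.Ioo p (p + r) ⊆ Set.Ioo (p - r) (p + r) :=
    Set.Ioo_subset_Ioo_left (by linarith)
  obtain ⟨b₁, hb₁, hz₁⟩ := exists_ae_eq_of_notMem_jumpSet hm hz
    (fun q hq => (hball (hleft hq)).1) fun q hq => hnj q (hleft hq) hq.2.ne
  obtain ⟨b₂, hb₂, hz₂⟩ := exists_ae_eq_of_notMem_jumpSet hm hz
    (fun q hq => (hball (hright hq)).1) fun q hq => hnj q (hright hq) hq.1.ne'
  refine ⟨r, hr, b₁, b₂, hb₁, hb₂, ?_⟩
  filter_upwards [hz₁, hz₂, ae_muI_ne p] with x hx₁ hx₂ hxp hx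
  rw [Real.ball_eq_Ioo] at hx
  split_ifs with hlt
  · exact hx₁ ⟨hx.1, hlt⟩
  · exact hx₂ ⟨hxp.lt_of_le' (not_lt.1 hlt), hx.2⟩

theorem sign_eq_one_or {t : ℝ} (ht : t ≠ 0) : Real.sign t = 1 ∨ Real.sign t = -1 :=
  (Real.sign_apply_eq_of_ne_zero t ht).symm

theorem measurable_sign : Measurable Real.sign :=
  Measurable.ite measurableSet_Iio measurable_const
    (Measurable.ite measurableSet_Ioi measurable_const measurable_const)

theorem notMem_jumpSet_or_notMem_jumpSet_mul_sign (hm : AEStronglyMeasurable z muI)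
    (hz : ∀ᵐ x ∂muI, z x = 1 ∨ z x = -1) {p : ℝ} {S : Set ℝ} (hSfin : S.Finite) (hpS : p ∉ S)
    (hS : jumpSet z ⊆ insert p S) :
    p ∉ jumpSet z ∨ p ∉ jumpSet fun x => z x * Real.sign (x - p) := by
  by_cases hp : p ∈ Set.Ioo (0 : ℝ) 1
  swap
  · exact Or.inl fun hj => hp (mem_jumpSet_iff.1 hj).1
  obtain ⟨r, hr, b₁, b₂, hb₁, hb₂, hzr⟩ := exists_one_sided_values hm hz hp hSfin hpS hS
  rcases eq_or_ne b₁ b₂ with rfl | hne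
  · exact Or.inl (notMem_jumpSet_of_ae_eq hr (by simpa only [ite_self] using hzr))
  · refine Or.inr (notMem_jumpSet_of_ae_eq (b := b₂) hr ?_)
    have hb : b₁ = -b₂ := by
      rcases hb₁ with rfl | rfl <;> rcases hb₂ with rfl | rfl <;> simp_all
    filter_upwards [hzr, ae_muI_ne p] with x hx hxp hxr
    rw [hx hxr]
    split_ifs with hlt
    · rw [Real.sign_of_neg (sub_neg.2 hlt), hb, neg_mul_neg, mul_one]
    · rw [Real.sign_of_pos (sub_pos.2 (hxp.lt_of_le' (not_lt.1 hlt))), mul_one]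

theorem sign_sub_eq_of_mem_ball {p q x : ℝ} (hx : x ∈ Metric.ball q |q - p|) :
    Real.sign (x - p) = Real.sign (q - p) := by
  rw [Metric.mem_ball, Real.dist_eq, abs_lt] at hx
  rcases lt_trichotomy (q - p) 0 with hlt | heq | hgt
  · rw [abs_of_neg hlt] at hx
    rw [Real.sign_of_neg hlt, Real.sign_of_neg (by linarith)]
  · rw [heq, abs_zero] at hx
    linarith
  · rw [abs_of_pos hgt] at hx
    rw [Real.sign_of_pos hgt, Real.sign_of_pos (by linarith)]

theorem mem_jumpSet_of_mem_jumpSet_mul_sign {p q : ℝ} (hqp : q ≠ p)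
    (hq : q ∈ jumpSet fun x => z x * Real.sign (x - p)) : q ∈ jumpSet z := by
  refine mem_jumpSet_iff.2 ⟨hq.1, fun ⟨b, hb⟩ => (mem_jumpSet_iff.1 hq).2
    ⟨_, hb.of_ae_eq_mul (e := Real.sign (q - p)) (abs_pos.2 (sub_ne_zero.2 hqp)) ?_⟩⟩
  exact Eventually.of_forall fun x hx => by rw [sign_sub_eq_of_mem_ball hx, mul_comm]

theorem exists_ae_eq_prod_sign (S : Finset ℝ) (hm : AEStronglyMeasurable z muI)
    (hz : ∀ᵐ x ∂muI, z x = 1 ∨ z x = -1) (hS : jumpSet z ⊆ S) :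
    ∃ T ⊆ S, ∃ s : ℝ, (s = 1 ∨ s = -1) ∧
      ∀ᵐ x ∂muI, z x = s * ∏ p ∈ T, Real.sign (x - p) := by
  induction S using Finset.induction_on generalizing z with
  | empty =>
    obtain ⟨b, hb, hzb⟩ := exists_ae_eq_of_notMem_jumpSet hm hz (α := 0) (β := 1) subset_rfl
      fun p _ hp => absurd (hS hp) (by simp)
    refine ⟨∅, subset_rfl, b, hb, ?_⟩
    filter_upwards [hzb, ae_mem_Ioo] with x hx hxI
    simpa using hx hxI
  | insert p S hpS ih =>
    rw [Finset.coe_insert] at hS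
    rcases notMem_jumpSet_or_notMem_jumpSet_mul_sign hm hz S.finite_toSet hpS hS with hp | hp
    · obtain ⟨T, hT, hzT⟩ := ih hm hz ((Set.subset_insert_iff_of_notMem hp).1 hS)
      exact ⟨T, hT.trans (Finset.subset_insert _ _), hzT⟩
    have hsign : ∀ᵐ x ∂muI, Real.sign (x - p) = 1 ∨ Real.sign (x - p) = -1 :=
      (ae_muI_ne p).mono fun x hx => sign_eq_one_or (sub_ne_zero.2 hx)
    have hmul : ∀ᵐ x ∂muI, z x * Real.sign (x - p) = 1 ∨ z x * Real.sign (x - p) = -1 := by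
      filter_upwards [hz, hsign] with x hx hxp
      rcases hx with hx | hx <;> rcases hxp with hxp | hxp <;> simp [hx, hxp]
    obtain ⟨T, hT, s, hs, hzT⟩ := ih
      (hm.mul (measurable_sign.comp (measurable_id.sub_const p)).aestronglyMeasurable) hmul
      ((Set.subset_insert_iff_of_notMem hp).1 fun q hq => (eq_or_ne q p).elim
        (fun h => Or.inl h) fun h => hS (mem_jumpSet_of_mem_jumpSet_mul_sign h hq))
    refine ⟨insert p T, Finset.insert_subset_insert _ hT, s, hs, ?_⟩
    filter_upwards [hzT, hsign] with x hx hxp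
    rw [Finset.prod_insert fun hpT => hpS (hT hpT), mul_left_comm, ← hx]
    rcases hxp with hxp | hxp <;> simp [hxp]

end SignValued

/-! ### Kinks and recovery chains -/

theorem one_sub_tanh_sq (t : ℝ) : 1 - Real.tanh t ^ 2 = (Real.cosh t ^ 2)⁻¹ := by
  have hc := (Real.cosh_pos t).ne'
  rw [Real.tanh_eq_sinh_div_cosh, div_pow, Real.sinh_sq]
  field_simp
  ring

theorem one_sub_tanh_sq_nonneg (t : ℝ) : 0 ≤ 1 - Real.tanh t ^ 2 := by
  rw [one_sub_tanh_sq]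
  positivity

theorem cosh_le_exp_mul_cosh {x y : ℝ} (h : x ≤ y) :
    Real.cosh y ≤ Real.exp (y - x) * Real.cosh x := by
  have hy : Real.exp (y - x) * Real.exp x = Real.exp y := by
    rw [← Real.exp_add, sub_add_cancel]
  have hy' : Real.exp (-y) ≤ Real.exp (y - x) * Real.exp (-x) := by
    rw [← Real.exp_add]
    exact Real.exp_le_exp.2 (by linarith)
  rw [Real.cosh_eq, Real.cosh_eq]
  linarith

theorem one_sub_tanh_sq_le {x y : ℝ} (h : x ≤ y) :
    1 - Real.tanh x ^ 2 ≤ Real.exp (y - x) ^ 2 * (1 - Real.tanh y ^ 2) := by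
  have hx : 0 < Real.cosh x ^ 2 := pow_pos (Real.cosh_pos x) 2
  have hy := Real.cosh_pos y
  rw [one_sub_tanh_sq, one_sub_tanh_sq, ← div_eq_mul_inv, inv_le_comm₀ hx (by positivity),
    inv_div, div_le_iff₀ (by positivity), ← mul_pow, mul_comm]
  exact pow_le_pow_left₀ hy.le (cosh_le_exp_mul_cosh h) 2

theorem hasDerivAt_tanh (t : ℝ) : HasDerivAt Real.tanh (1 - Real.tanh t ^ 2) t := by
  have hc := (Real.cosh_pos t).ne'
  have h := (Real.hasDerivAt_sinh t).fun_div (Real.hasDerivAt_cosh t) hc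
  simp only [← Real.tanh_eq_sinh_div_cosh] at h
  convert! h using 1
  rw [Real.tanh_eq_sinh_div_cosh]
  field_simp

theorem tanh_monotone : Monotone Real.tanh :=
  monotone_of_deriv_nonneg (fun t => (hasDerivAt_tanh t).differentiableAt) fun t => by
    rw [(hasDerivAt_tanh t).deriv]
    exact one_sub_tanh_sq_nonneg t

theorem tanh_pos {t : ℝ} (ht : 0 < t) : 0 < Real.tanh t := by
  rw [Real.tanh_eq_sinh_div_cosh]
  exact div_pos (Real.sinh_pos_iff.2 ht) (Real.cosh_pos _)

theorem abs_tanh_le (t : ℝ) : |Real.tanh t| ≤ 1 :=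
  abs_le.2 ⟨(Real.neg_one_lt_tanh t).le, (Real.tanh_lt_one t).le⟩

theorem tanh_eq_one_sub (t : ℝ) : Real.tanh t = 1 - 2 / (Real.exp (2 * t) + 1) := by
  rw [Real.tanh_eq_sinh_div_cosh, Real.sinh_eq, Real.cosh_eq, Real.exp_neg, two_mul, Real.exp_add]
  field_simp
  ring

theorem tendsto_tanh_atTop : Tendsto Real.tanh atTop (𝓝 1) := by
  have hexp : Tendsto (fun t : ℝ => Real.exp (2 * t) + 1) atTop atTop :=
    tendsto_atTop_add_const_right _ _
      (Real.tendsto_exp_atTop.comp (tendsto_id.const_mul_atTop two_pos))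
  simpa only [← tanh_eq_one_sub, sub_zero] using (hexp.const_div_atTop 2).const_sub 1

/-- The primitive of `(1 - tanh²)²`; it measures the Modica–Mortola energy of the optimal profile
`tanh`. -/
noncomputable def kinkPrimitive (t : ℝ) : ℝ := Real.tanh t - Real.tanh t ^ 3 / 3

theorem hasDerivAt_kinkPrimitive (t : ℝ) :
    HasDerivAt kinkPrimitive ((1 - Real.tanh t ^ 2) ^ 2) t := by
  convert! (hasDerivAt_tanh t).sub (((hasDerivAt_tanh t).pow 3).div_const 3) using 1
  push_cast
  ring

theorem abs_kinkPrimitive_le (t : ℝ) : |kinkPrimitive t| ≤ 2 / 3 := by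
  obtain ⟨hlow, hup⟩ := abs_le.1 (abs_tanh_le t)
  unfold kinkPrimitive
  set x := Real.tanh t
  rw [abs_le]
  constructor
  · nlinarith [mul_nonneg (sq_nonneg (1 + x)) (show 0 ≤ 2 - x by linarith)]
  · nlinarith [mul_nonneg (sq_nonneg (1 - x)) (show 0 ≤ 2 + x by linarith)]

theorem kinkPrimitive_neg (t : ℝ) : kinkPrimitive (-t) = -kinkPrimitive t := by
  unfold kinkPrimitive
  rw [Real.tanh_neg]
  ring

/-- Cauchy–Schwarz for the increment of `tanh`: with `s` the mean slope, integrate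
`2 s tanh' - s² ≤ (tanh')²`. -/
theorem sq_tanh_sub_le {t h : ℝ} (hh : 0 < h) :
    (Real.tanh (t + h) - Real.tanh t) ^ 2 ≤ h * (kinkPrimitive (t + h) - kinkPrimitive t) := by
  obtain ⟨s, hincr⟩ : ∃ s, Real.tanh (t + h) - Real.tanh t = s * h :=
    ⟨_, (div_mul_cancel₀ _ hh.ne').symm⟩
  have hderiv : ∀ x, HasDerivAt (fun x => kinkPrimitive x - 2 * s * Real.tanh x + s ^ 2 * x)
      ((1 - Real.tanh x ^ 2) ^ 2 - 2 * s * (1 - Real.tanh x ^ 2) + s ^ 2 * 1) x := fun x =>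
    ((hasDerivAt_kinkPrimitive x).sub ((hasDerivAt_tanh x).const_mul (2 * s))).add
      ((hasDerivAt_id x).const_mul (s ^ 2))
  have hmono : Monotone fun x => kinkPrimitive x - 2 * s * Real.tanh x + s ^ 2 * x :=
    monotone_of_deriv_nonneg (fun x => (hderiv x).differentiableAt) fun x => by
      rw [(hderiv x).deriv]
      nlinarith [sq_nonneg (1 - Real.tanh x ^ 2 - s)]
  have hle : kinkPrimitive t - 2 * s * Real.tanh t + s ^ 2 * t ≤
      kinkPrimitive (t + h) - 2 * s * Real.tanh (t + h) + s ^ 2 * (t + h) :=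
    hmono (by linarith)
  calc (Real.tanh (t + h) - Real.tanh t) ^ 2 = h * (s * (s * h)) := by rw [hincr]; ring
    _ ≤ h * (kinkPrimitive (t + h) - kinkPrimitive t) := by
        gcongr
        linear_combination hle - 2 * s * hincr

theorem mul_one_sub_tanh_sq_le {t h : ℝ} (hh : 0 ≤ h) :
    h * (1 - Real.tanh t ^ 2) ^ 2 ≤
      Real.exp (4 * h) * (kinkPrimitive (t + h) - kinkPrimitive t) := by
  have hslope : ∀ x ∈ interior (Set.Icc t (t + h)),
      (Real.exp (4 * h))⁻¹ * (1 - Real.tanh t ^ 2) ^ 2 ≤ deriv kinkPrimitive x := fun x hx => by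
    obtain ⟨htx, hxh⟩ := interior_subset hx
    rw [(hasDerivAt_kinkPrimitive x).deriv, inv_mul_le_iff₀ (Real.exp_pos _)]
    calc (1 - Real.tanh t ^ 2) ^ 2
        ≤ (Real.exp (x - t) ^ 2 * (1 - Real.tanh x ^ 2)) ^ 2 :=
          pow_le_pow_left₀ (one_sub_tanh_sq_nonneg t) (one_sub_tanh_sq_le htx) 2
      _ = Real.exp (4 * (x - t)) * (1 - Real.tanh x ^ 2) ^ 2 := by
          rw [mul_pow, ← pow_mul, ← Real.exp_nat_mul]
          norm_num
      _ ≤ Real.exp (4 * h) * (1 - Real.tanh x ^ 2) ^ 2 := by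
          gcongr
          linarith
  have hmean := (convex_Icc t (t + h)).mul_sub_le_image_sub_of_le_deriv
    (fun x _ => (hasDerivAt_kinkPrimitive x).continuousAt.continuousWithinAt)
    (fun x _ => (hasDerivAt_kinkPrimitive x).differentiableAt.differentiableWithinAt) hslope
    t (Set.left_mem_Icc.2 (by linarith)) (t + h) (Set.right_mem_Icc.2 (by linarith)) (by linarith)
  rw [add_sub_cancel_left, mul_assoc, inv_mul_le_iff₀ (Real.exp_pos _)] at hmean
  linarith

/-- The optimal profile `tanh`, steepened and cut off so that it equals `±1` outside
`(-τ, τ)`. -/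
noncomputable def kink (τ t : ℝ) : ℝ := max (-1) (min 1 (Real.tanh t / Real.tanh τ))

section Kink

variable {τ h t : ℝ}

theorem abs_kink_le (τ t : ℝ) : |kink τ t| ≤ 1 :=
  abs_le.2 ⟨le_max_left _ _, max_le (by norm_num) (min_le_left _ _)⟩

theorem kink_sq_le (τ t : ℝ) : kink τ t ^ 2 ≤ 1 :=
  (sq_le_one_iff_abs_le_one _).2 (abs_kink_le τ t)

theorem abs_kink_sub_le (hτ : 0 < τ) (s t : ℝ) :
    |kink τ t - kink τ s| ≤ |Real.tanh t - Real.tanh s| / Real.tanh τ := by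
  calc |kink τ t - kink τ s|
      ≤ |min 1 (Real.tanh t / Real.tanh τ) - min 1 (Real.tanh s / Real.tanh τ)| := by
        simpa [kink] using abs_max_sub_max_le_max (-1) (min 1 (Real.tanh t / Real.tanh τ)) (-1)
          (min 1 (Real.tanh s / Real.tanh τ))
    _ ≤ |Real.tanh t / Real.tanh τ - Real.tanh s / Real.tanh τ| := by
        simpa using abs_min_sub_min_le_max 1 (Real.tanh t / Real.tanh τ) 1
          (Real.tanh s / Real.tanh τ)
    _ = |Real.tanh t - Real.tanh s| / Real.tanh τ := by
        rw [← sub_div, abs_div, abs_of_pos (tanh_pos hτ)]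

theorem tanh_sq_le_kink_sq (hτ : 0 < τ) (t : ℝ) : Real.tanh t ^ 2 ≤ kink τ t ^ 2 := by
  have hτ1 := (Real.tanh_lt_one τ).le
  obtain ⟨hlow, hup⟩ := abs_le.1 (abs_tanh_le t)
  rw [sq_le_sq]
  rcases le_total 0 (Real.tanh t) with h | h
  · rw [abs_of_nonneg h]
    exact (le_max_of_le_right (le_min hup (le_div_self h (tanh_pos hτ) hτ1))).trans
      (le_abs_self _)
  · have hdiv : Real.tanh t / Real.tanh τ ≤ Real.tanh t := by
      simpa only [neg_div, neg_le_neg_iff] using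
        le_div_self (neg_nonneg.2 h) (tanh_pos hτ) hτ1
    rw [abs_of_nonpos h]
    exact (neg_le_neg (max_le hlow ((min_le_right _ _).trans hdiv))).trans (neg_le_abs _)

theorem kink_eq_sign (hτ : 0 < τ) (ht : τ ≤ |t|) : kink τ t = Real.sign t := by
  have htanh := tanh_pos hτ
  unfold kink
  rcases le_total 0 t with h | h
  · rw [abs_of_nonneg h] at ht
    have hle : 1 ≤ Real.tanh t / Real.tanh τ := (one_le_div htanh).2 (tanh_monotone ht)
    rw [min_eq_left hle, Real.sign_of_pos (hτ.trans_le ht), max_eq_right (by norm_num)]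
  · rw [abs_of_nonpos h] at ht
    have hle : Real.tanh t / Real.tanh τ ≤ -1 := by
      rw [div_le_iff₀ htanh, neg_one_mul, le_neg, ← Real.tanh_neg]
      exact tanh_monotone ht
    rw [Real.sign_of_neg (by linarith), max_eq_left ((min_le_right _ _).trans hle)]

theorem kink_sq_eq_one (hτ : 0 < τ) (ht : τ ≤ |t|) : kink τ t ^ 2 = 1 := by
  rw [kink_eq_sign hτ ht, sq_eq_one_iff]
  exact sign_eq_one_or (abs_pos.1 (hτ.trans_le ht))

theorem kink_add_eq (hτ : 0 < τ) (hh : 0 ≤ h) (ht : τ + h ≤ |t|) :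
    kink τ (t + h) = kink τ t := by
  rcases le_total 0 t with h0 | h0
  · rw [abs_of_nonneg h0] at ht
    rw [kink_eq_sign hτ (by rw [abs_of_nonneg] <;> linarith),
      kink_eq_sign hτ (by rw [abs_of_nonneg] <;> linarith),
      Real.sign_of_pos (by linarith), Real.sign_of_pos (by linarith)]
  · rw [abs_of_nonpos h0] at ht
    rw [kink_eq_sign hτ (by rw [abs_of_nonpos] <;> linarith),
      kink_eq_sign hτ (by rw [abs_of_nonpos] <;> linarith),
      Real.sign_of_neg (by linarith), Real.sign_of_neg (by linarith)]

theorem sq_kink_sub_le (hτ : 0 < τ) (hh : 0 < h) (t : ℝ) :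
    1 / h * (kink τ (t + h) - kink τ t) ^ 2 ≤
      (Real.tanh τ)⁻¹ ^ 2 * (kinkPrimitive (t + h) - kinkPrimitive t) := by
  rw [one_div, inv_mul_le_iff₀ hh]
  calc (kink τ (t + h) - kink τ t) ^ 2
      ≤ (|Real.tanh (t + h) - Real.tanh t| / Real.tanh τ) ^ 2 := by
        rw [← sq_abs (kink τ (t + h) - kink τ t)]
        exact pow_le_pow_left₀ (abs_nonneg _) (abs_kink_sub_le hτ _ _) 2
    _ = (Real.tanh τ)⁻¹ ^ 2 * (Real.tanh (t + h) - Real.tanh t) ^ 2 := by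
        rw [div_pow, sq_abs]
        ring
    _ ≤ (Real.tanh τ)⁻¹ ^ 2 * (h * (kinkPrimitive (t + h) - kinkPrimitive t)) := by
        gcongr
        exact sq_tanh_sub_le hh
    _ = h * ((Real.tanh τ)⁻¹ ^ 2 * (kinkPrimitive (t + h) - kinkPrimitive t)) := by ring

theorem kink_potential_le (hτ : 0 < τ) (hh : 0 ≤ h) (t : ℝ) :
    h / 4 * (kink τ t ^ 2 + kink τ (t + h) ^ 2 - 2) ^ 2 ≤
      Real.exp (4 * h) * (kinkPrimitive (t + h) - kinkPrimitive t) := by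
  have hleft := mul_one_sub_tanh_sq_le (t := t) hh
  have hright : h * (1 - Real.tanh (t + h) ^ 2) ^ 2 ≤
      Real.exp (4 * h) * (kinkPrimitive (t + h) - kinkPrimitive t) := by
    have := mul_one_sub_tanh_sq_le (t := -(t + h)) hh
    rw [Real.tanh_neg, neg_sq, show -(t + h) + h = -t by ring, kinkPrimitive_neg,
      kinkPrimitive_neg] at this
    linarith
  have ht := tanh_sq_le_kink_sq hτ t
  have hth := tanh_sq_le_kink_sq hτ (t + h)
  have hkt := kink_sq_le τ t
  have hkth := kink_sq_le τ (t + h)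
  calc h / 4 * (kink τ t ^ 2 + kink τ (t + h) ^ 2 - 2) ^ 2
      = h / 4 * ((1 - kink τ t ^ 2) + (1 - kink τ (t + h) ^ 2)) ^ 2 := by ring
    _ ≤ h / 4 * ((1 - Real.tanh t ^ 2) + (1 - Real.tanh (t + h) ^ 2)) ^ 2 := by gcongr
    _ ≤ h / 4 * (2 * ((1 - Real.tanh t ^ 2) ^ 2 + (1 - Real.tanh (t + h) ^ 2) ^ 2)) := by
        gcongr
        exact add_sq_le
    _ ≤ Real.exp (4 * h) * (kinkPrimitive (t + h) - kinkPrimitive t) := by linarith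

theorem bondEnergy_kink_le (hτ : 0 < τ) (hh : 0 < h) (t : ℝ) :
    bondEnergy h 1 (kink τ t) (kink τ (t + h)) ≤
      ((Real.tanh τ)⁻¹ ^ 2 + Real.exp (4 * h)) * (kinkPrimitive (t + h) - kinkPrimitive t) := by
  unfold bondEnergy
  linarith [sq_kink_sub_le hτ hh t, kink_potential_le hτ hh.le t]

theorem sum_bondEnergy_kink_le (hτ : 0 < τ) (hh : 0 < h) (t : ℝ) (M : ℕ) :
    ∑ i ∈ Finset.range M, bondEnergy h 1 (kink τ (t + h * i)) (kink τ (t + h * i + h)) ≤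
      ((Real.tanh τ)⁻¹ ^ 2 + Real.exp (4 * h)) * (4 / 3) := by
  have hincr : kinkPrimitive (t + h * M) - kinkPrimitive (t + h * (0 : ℕ)) ≤ 4 / 3 := by
    linarith [(abs_le.1 (abs_kinkPrimitive_le (t + h * M))).2,
      (abs_le.1 (abs_kinkPrimitive_le (t + h * (0 : ℕ)))).1]
  have hnode : ∀ i : ℕ, t + h * i + h = t + h * (i + 1 : ℕ) := fun i => by
    push_cast
    ring
  refine (Finset.sum_le_sum fun i _ => bondEnergy_kink_le hτ hh _).trans ?_
  simp_rw [hnode]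
  rw [← Finset.mul_sum, Finset.sum_range_sub fun i : ℕ => kinkPrimitive (t + h * i)]
  gcongr

end Kink

theorem bondEnergy_mul {κ h e : ℝ} (he : e ^ 2 = 1) (x y : ℝ) :
    bondEnergy h κ (e * x) (e * y) = bondEnergy h κ x y := by
  rw [bondEnergy, ← mul_sub, mul_pow, mul_pow, mul_pow, he, one_mul, one_mul, one_mul, bondEnergy]

theorem bondEnergy_self {κ h e : ℝ} (he : e ^ 2 = 1) : bondEnergy h κ e e = 0 := by
  norm_num [bondEnergy, he]

theorem sq_mul_prod_eq_one {ι : Type*} {s : ℝ} (hs : s ^ 2 = 1) {T : Finset ι} {f : ι → ℝ}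
    (hf : ∀ p ∈ T, f p ^ 2 = 1) : (s * ∏ p ∈ T, f p) ^ 2 = 1 := by
  rw [mul_pow, hs, one_mul, ← Finset.prod_pow, Finset.prod_eq_one hf]

theorem bondEnergy_mul_prod_le {ι : Type*} {s h κ : ℝ} (hh : 0 ≤ h) (hκ : 0 ≤ κ)
    (hs : s ^ 2 = 1) {T : Finset ι} {x y : ι → ℝ}
    (hxy : (T : Set ι).Pairwise fun p q => x p ^ 2 = 1 ∧ y p = x p ∨ x q ^ 2 = 1 ∧ y q = x q) :
    bondEnergy h κ (s * ∏ p ∈ T, x p) (s * ∏ p ∈ T, y p) ≤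
      ∑ p ∈ T, bondEnergy h κ (x p) (y p) := by
  classical
  have hnonneg (p : ι) : 0 ≤ bondEnergy h κ (x p) (y p) := bondEnergy_nonneg hh hκ _ _
  by_cases hall : ∀ p ∈ T, x p ^ 2 = 1 ∧ y p = x p
  · rw [Finset.prod_congr rfl fun p hp => (hall p hp).2,
      bondEnergy_self (sq_mul_prod_eq_one hs fun p hp => (hall p hp).1)]
    exact Finset.sum_nonneg fun p _ => hnonneg p
  · push Not at hall
    obtain ⟨q, hq, hqne⟩ := hall
    have hothers : ∀ p ∈ T.erase q, x p ^ 2 = 1 ∧ y p = x p := fun p hp =>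
      (hxy (Finset.mem_of_mem_erase hp) hq (Finset.ne_of_mem_erase hp)).resolve_right
        fun hflat => hqne hflat.1 hflat.2
    have hx : s * ∏ p ∈ T, x p = (s * ∏ p ∈ T.erase q, x p) * x q := by
      rw [← Finset.prod_erase_mul T _ hq, mul_assoc]
    have hy : s * ∏ p ∈ T, y p = (s * ∏ p ∈ T.erase q, x p) * y q := by
      rw [← Finset.prod_erase_mul T _ hq, mul_assoc,
        Finset.prod_congr rfl fun p hp => (hothers p hp).2]
    rw [hx, hy, bondEnergy_mul (sq_mul_prod_eq_one hs fun p hp => (hothers p hp).1)]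
    exact Finset.single_le_sum (f := fun p => bondEnergy h κ (x p) (y p)) (fun p _ => hnonneg p) hq

/-- The recovery chain for a function jumping at the points of `T`: in the variable rescaled by
`h / lam`, in which consecutive nodes are `h` apart, it has the profile `kink` at each point of
`T`. -/
noncomputable def kinkChain (τ h lam s : ℝ) (T : Finset ℝ) (i : ℕ) : ℝ :=
  s * ∏ p ∈ T, kink τ (h / lam * (lam * i - p))

section KinkChain

variable {τ h lam s r : ℝ} {T : Finset ℝ}

theorem rescaled_node_succ (hlam : lam ≠ 0) (i : ℕ) (p : ℝ) :
    h / lam * (lam * (i + 1 : ℕ) - p) = h / lam * (lam * i - p) + h := by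
  push_cast
  field_simp
  ring

theorem abs_kinkChain_le (hs : s ^ 2 = 1) (i : ℕ) : |kinkChain τ h lam s T i| ≤ 1 := by
  rw [kinkChain, abs_mul, (abs_eq zero_le_one).2 (sq_eq_one_iff.1 hs), one_mul, Finset.abs_prod]
  exact Finset.prod_le_one (fun _ _ => abs_nonneg _) fun _ _ => abs_kink_le _ _

theorem abs_kinkChain_eq_one (hτ : 0 < τ) (hs : s ^ 2 = 1) {i : ℕ}
    (hi : ∀ p ∈ T, τ ≤ |h / lam * (lam * i - p)|) : |kinkChain τ h lam s T i| = 1 := by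
  rw [abs_eq zero_le_one, ← sq_eq_one_iff]
  exact sq_mul_prod_eq_one hs fun p hp => kink_sq_eq_one hτ (hi p hp)

theorem bondEnergy_kinkChain_le (hlam : 0 < lam) (hh : 0 < h) (hτ : 0 < τ) (hs : s ^ 2 = 1)
    (hr : τ + h ≤ h / lam * r)
    (hdisj : ∀ p ∈ T, ∀ q ∈ T, p ≠ q → Disjoint (Metric.ball p r) (Metric.ball q r)) (i : ℕ) :
    bondEnergy h 1 (kinkChain τ h lam s T i) (kinkChain τ h lam s T (i + 1)) ≤
      ∑ p ∈ T, bondEnergy h 1 (kink τ (h / lam * (lam * i - p)))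
        (kink τ (h / lam * (lam * i - p) + h)) := by
  have hflat (p : ℝ) (hp : lam * i ∉ Metric.ball p r) :
      kink τ (h / lam * (lam * i - p)) ^ 2 = 1 ∧
        kink τ (h / lam * (lam * i - p) + h) = kink τ (h / lam * (lam * i - p)) := by
    rw [Metric.mem_ball, Real.dist_eq, not_lt] at hp
    have hfar : τ + h ≤ |h / lam * (lam * i - p)| := by
      rw [abs_mul, abs_of_pos (div_pos hh hlam)]
      exact hr.trans (by gcongr)
    exact ⟨kink_sq_eq_one hτ (by linarith), kink_add_eq hτ hh.le hfar⟩
  simp only [kinkChain, rescaled_node_succ hlam.ne']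
  refine bondEnergy_mul_prod_le hh.le zero_le_one hs fun p hp q hq hpq => ?_
  by_cases hi : lam * i ∈ Metric.ball p r
  · exact .inr (hflat q (Set.disjoint_left.1 (hdisj p hp q hq hpq) hi))
  · exact .inl (hflat p hi)

theorem quadEnergy_kinkChain_le (hlam : 0 < lam) (hh : 0 < h) (hτ : 0 < τ) (hs : s ^ 2 = 1)
    (hr : τ + h ≤ h / lam * r)
    (hdisj : ∀ p ∈ T, ∀ q ∈ T, p ≠ q → Disjoint (Metric.ball p r) (Metric.ball q r)) (N : ℕ) :
    quadEnergy h 1 N (kinkChain τ h lam s T) ≤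
      T.card * (((Real.tanh τ)⁻¹ ^ 2 + Real.exp (4 * h)) * (4 / 3)) := by
  have hnode (i : ℕ) (p : ℝ) : h / lam * (lam * i - p) = -(h / lam * p) + h * i := by
    field_simp
    ring
  refine (Finset.sum_le_sum fun i _ =>
    bondEnergy_kinkChain_le hlam hh hτ hs hr hdisj i).trans ?_
  rw [Finset.sum_comm, ← nsmul_eq_mul]
  refine Finset.sum_le_card_nsmul _ _ _ fun p _ => ?_
  simp only [hnode]
  exact sum_bondEnergy_kink_le hτ hh _ _

end KinkChain

/-- Cut-off radii `τ` for the kinks of a sequence of chains: they exhaust the optimal profile, and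
the kinks still concentrate in the original variable. -/
structure IsKinkScale (lam h τ : ℕ → ℝ) : Prop where
  lam_null : IsPosNullSeq lam
  h_null : IsPosNullSeq h
  pos : ∀ n, 0 < τ n
  tendsto : Tendsto τ atTop atTop
  width_tendsto : Tendsto (fun n => lam n / h n * τ n) atTop (𝓝 0)

theorem IsPosNullSeq.exists_isKinkScale {lam h : ℕ → ℝ} (hlam : IsPosNullSeq lam)
    (hh : IsPosNullSeq h) (hl : Tendsto (fun n => lam n / h n) atTop (𝓝 0)) :
    ∃ τ, IsKinkScale lam h τ := by
  have hsqrt_pos (n : ℕ) : 0 < √(lam n / h n) :=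
    Real.sqrt_pos.2 (div_pos (hlam.pos n) (hh.pos n))
  have hsqrt : Tendsto (fun n => √(lam n / h n)) atTop (𝓝 0) :=
    (Real.continuous_sqrt.tendsto' 0 0 Real.sqrt_zero).comp hl
  refine ⟨fun n => (√(lam n / h n))⁻¹, hlam, hh, fun n => inv_pos.2 (hsqrt_pos n),
    tendsto_inv_nhdsGT_zero.comp
      (tendsto_nhdsWithin_iff.2 ⟨hsqrt, Eventually.of_forall hsqrt_pos⟩), ?_⟩
  simpa only [← div_eq_mul_inv, Real.div_sqrt] using hsqrt

theorem eventually_sign_eq {u : ℕ → ℝ} {b : ℝ} (hu : Tendsto u atTop (𝓝 b)) (hb : b ≠ 0) :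
    ∀ᶠ n in atTop, Real.sign (u n) = Real.sign b := by
  rcases hb.lt_or_gt with hb | hb
  · filter_upwards [hu.eventually (gt_mem_nhds hb)] with n hn
    rw [Real.sign_of_neg hn, Real.sign_of_neg hb]
  · filter_upwards [hu.eventually (lt_mem_nhds hb)] with n hn
    rw [Real.sign_of_pos hn, Real.sign_of_pos hb]

theorem sign_mul_of_pos {c : ℝ} (hc : 0 < c) (x : ℝ) : Real.sign (c * x) = Real.sign x := by
  rcases lt_trichotomy x 0 with hx | rfl | hx
  · rw [Real.sign_of_neg hx, Real.sign_of_neg (mul_neg_of_pos_of_neg hc hx)]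
  · rw [mul_zero]
  · rw [Real.sign_of_pos hx, Real.sign_of_pos (mul_pos hc hx)]

namespace IsKinkScale

variable {lam h τ : ℕ → ℝ} (H : IsKinkScale lam h τ) {s : ℝ} {T : Finset ℝ}
include H

theorem div_pos (n : ℕ) : 0 < h n / lam n := _root_.div_pos (H.h_null.pos n) (H.lam_null.pos n)

theorem eventually_le {u : ℕ → ℝ} {b : ℝ} (hu : Tendsto u atTop (𝓝 b)) (hb : 0 < b) :
    ∀ᶠ n in atTop, τ n ≤ h n / lam n * u n := by
  filter_upwards [H.width_tendsto.eventually_lt hu hb] with n hn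
  rw [← inv_div, inv_mul_lt_iff₀ (H.div_pos n)] at hn
  exact hn.le

theorem eventually_add_le {r : ℝ} (hr : 0 < r) :
    ∀ᶠ n in atTop, τ n + h n ≤ h n / lam n * r := by
  have hlim : Tendsto (fun n => r - lam n) atTop (𝓝 r) := by
    simpa using H.lam_null.tendsto.const_sub r
  filter_upwards [H.eventually_le hlim hr] with n hn
  rw [mul_sub, div_mul_cancel₀ _ (H.lam_null.pos n).ne'] at hn
  linarith

theorem tendsto_kinkChain {x : ℝ} (hx : x ∈ Set.Ioo (0 : ℝ) 1) (hxT : ∀ p ∈ T, x ≠ p) :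
    Tendsto (fun n => kinkChain (τ n) (h n) (lam n) s T ⌊x / lam n⌋₊) atTop
      (𝓝 (s * ∏ p ∈ T, Real.sign (x - p))) := by
  refine Tendsto.const_mul s (tendsto_finsetProd _ fun p hp => tendsto_const_nhds.congr' ?_)
  have hxp := sub_ne_zero.2 (hxT p hp)
  have hnode : Tendsto (fun n => lam n * ⌊x / lam n⌋₊ - p) atTop (𝓝 (x - p)) :=
    (H.lam_null.tendsto_mul_floor hx.1.le).sub_const p
  filter_upwards [H.eventually_le hnode.abs (abs_pos.2 hxp), eventually_sign_eq hnode hxp]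
    with n hfar hsign
  rw [kink_eq_sign (H.pos n) (by rwa [abs_mul, abs_of_pos (H.div_pos n)]),
    sign_mul_of_pos (H.div_pos n), hsign]

theorem eventually_abs_kinkChain_eq_one (hs : s ^ 2 = 1) {j : ℕ → ℕ} {b : ℝ}
    (hj : Tendsto (fun n => lam n * j n) atTop (𝓝 b)) (hb : b ∉ T) :
    ∀ᶠ n in atTop, |kinkChain (τ n) (h n) (lam n) s T (j n)| = 1 := by
  have hfar : ∀ᶠ n in atTop, ∀ p ∈ T, τ n ≤ h n / lam n * |lam n * j n - p| := by
    rw [eventually_all_finset]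
    exact fun p hp => H.eventually_le (hj.sub_const p).abs
      (abs_pos.2 (sub_ne_zero.2 fun hbp => hb (hbp ▸ hp)))
  filter_upwards [hfar] with n hn
  refine abs_kinkChain_eq_one (H.pos n) hs fun p hp => ?_
  rw [abs_mul, abs_of_pos (H.div_pos n)]
  exact hn p hp

theorem eventually_abs_kinkChain_endpoints_eq (hs : s ^ 2 = 1)
    (hT : ∀ p ∈ T, p ∈ Set.Ioo (0 : ℝ) 1) :
    ∀ᶠ n in atTop, |kinkChain (τ n) (h n) (lam n) s T 0| =
      |kinkChain (τ n) (h n) (lam n) s T (numCells (lam n) - 1)| := by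
  have hleft : Tendsto (fun n => lam n * (0 : ℕ)) atTop (𝓝 0) := by simp
  filter_upwards [H.eventually_abs_kinkChain_eq_one hs hleft fun h0 => (hT 0 h0).1.false,
    H.eventually_abs_kinkChain_eq_one hs H.lam_null.tendsto_mul_numCells_sub_one
      fun h1 => (hT 1 h1).2.false] with n h0 h1
  rw [h0, h1]

theorem tendsto_energy_bound (m : ℝ) :
    Tendsto (fun n => m * (((Real.tanh (τ n))⁻¹ ^ 2 + Real.exp (4 * h n)) * (4 / 3))) atTop
      (𝓝 (8 / 3 * m)) := by
  have htanh : Tendsto (fun n => (Real.tanh (τ n))⁻¹) atTop (𝓝 1) := by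
    simpa using (tendsto_tanh_atTop.comp H.tendsto).inv₀ one_ne_zero
  have hexp : Tendsto (fun n => Real.exp (4 * h n)) atTop (𝓝 1) :=
    (Real.continuous_exp.tendsto' 0 1 Real.exp_zero).comp
      (by simpa using H.h_null.tendsto.const_mul 4)
  convert! (((htanh.pow 2).add hexp).mul_const (4 / 3)).const_mul m using 2
  ring

end IsKinkScale

theorem exists_recovery_prod_sign {lam del : ℕ → ℝ} (hlam : IsPosNullSeq lam)
    (hdel : IsPosNullSeq del) (hl : Tendsto (fun n => lam n / √(2 * del n)) atTop (𝓝 0))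
    {T : Finset ℝ} (hT : ∀ p ∈ T, p ∈ Set.Ioo (0 : ℝ) 1) {s : ℝ} (hs : s ^ 2 = 1) {z : L1I}
    (hz : ∀ᵐ x ∂muI, z x = s * ∏ p ∈ T, Real.sign (x - p)) :
    ∃ y : ℕ → L1I, Tendsto y atTop (𝓝 z) ∧
      limsup (fun n => scaledHhf (lam n) (del n) (y n)) atTop ≤
        ENNReal.ofReal (8 / 3 * T.card) := by
  obtain ⟨r, hr, -, hdisj⟩ := exists_separating_radius hT
  obtain ⟨τ, H⟩ := hlam.exists_isKinkScale hdel.sqrt_two_mul hl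
  have hlim : ∀ᵐ x ∂muI, Tendsto
      (fun n => kinkChain (τ n) √(2 * del n) (lam n) s T ⌊x / lam n⌋₊) atTop (𝓝 (z x)) := by
    have hne : ∀ᵐ x ∂muI, ∀ p ∈ T, x ≠ p := (eventually_all_finset T).2 fun p _ => ae_muI_ne p
    filter_upwards [hz, hne, ae_mem_Ioo] with x hzx hxT hx
    rw [hzx]
    exact H.tendsto_kinkChain hx hxT
  obtain ⟨y, hy, hstep⟩ := exists_tendsto_L1 (fun n i => abs_kinkChain_le hs i) hlim
  refine ⟨y, hy, hlam.limsup_scaledHhf_le hdel (fun n i => abs_kinkChain_le hs i)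
    (H.eventually_abs_kinkChain_endpoints_eq hs hT) hstep (H.tendsto_energy_bound _) ?_⟩
  filter_upwards [H.eventually_add_le hr] with n hn
  exact quadEnergy_kinkChain_le (hlam.pos n) (H.h_null.pos n) (H.pos n) hs hn hdisj _

theorem gammaConverges_limitZero {lam del : ℕ → ℝ} (hlam : IsPosNullSeq lam)
    (hdel : IsPosNullSeq del) (hl : Tendsto (fun n => lam n / √(2 * del n)) atTop (𝓝 0)) :
    GammaConverges (fun n => scaledHhf (lam n) (del n)) limitZero := by
  intro z
  refine ⟨fun y hy => hlam.le_liminf_scaledHhf hdel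
    (fun φ κ a c hφ H => H.limitZero_le (hl.comp hφ)) hy, ?_⟩
  by_cases hz : IsBVpm z
  swap
  · refine ⟨fun _ => z, tendsto_const_nhds, ?_⟩
    rw [limitZero, if_neg hz]
    exact le_top
  have h83 : (8 / 3 : ℝ≥0∞) = ENNReal.ofReal (8 / 3) := by
    rw [ENNReal.ofReal_div_of_pos (by norm_num)]
    norm_num
  rw [limitZero, if_pos hz, h83]
  by_cases hfin : (jumpSet z).Finite
  · obtain ⟨T, hTS, s, hs, hzT⟩ := exists_ae_eq_prod_sign hfin.toFinset
      (Lp.aestronglyMeasurable z) hz.1 (by simp)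
    have hTI : ∀ p ∈ T, p ∈ Set.Ioo (0 : ℝ) 1 := fun p hp => (hfin.mem_toFinset.1 (hTS hp)).1
    obtain ⟨y, hy, hle⟩ := exists_recovery_prod_sign hlam hdel hl hTI (sq_eq_one_iff.2 hs) hzT
    refine ⟨y, hy, hle.trans ?_⟩
    rw [hfin.encard_eq_coe_toFinset_card, ENNReal.ofReal_mul (by norm_num)]
    have : T.card ≤ hfin.toFinset.card := Finset.card_le_card hTS
    gcongr
    simpa using this
  · refine ⟨fun _ => z, tendsto_const_nhds, ?_⟩
    rw [Set.encard_eq_top_iff.2 hfin, ENat.toENNReal_top, ENNReal.mul_top (by simp)]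
    exact le_top

/-! ### Weak derivatives on `(0, 1)` -/

theorem integrable_mul_continuous {g f : ℝ → ℝ} (hg : Integrable g muI) (hf : Continuous f) :
    Integrable (fun x => g x * f x) muI := by
  obtain ⟨B, hB⟩ := isCompact_Icc.exists_bound_of_continuousOn
    (hf.continuousOn (s := Set.Icc (0 : ℝ) 1))
  refine hg.mul_bdd (c := B) hf.aestronglyMeasurable ?_
  filter_upwards [ae_mem_Ioo] with x hx
  exact hB x (Set.Ioo_subset_Icc_self hx)

theorem integrable_of_continuous {f : ℝ → ℝ} (hf : Continuous f) : Integrable f muI := by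
  simpa only [one_mul] using integrable_mul_continuous (integrable_const (1 : ℝ)) hf

theorem integral_muI_eq {f : ℝ → ℝ} : ∫ x, f x ∂muI = ∫ x in (0 : ℝ)..1, f x := by
  rw [intervalIntegral.integral_of_le zero_le_one, muI_eq_Ioc]

section TestFunctions

variable {f g φ ψ ρ : ℝ → ℝ}

theorem IsTestFun.memLp (hφ : IsTestFun φ) : MemLp φ 2 muI := by
  obtain ⟨B, hB⟩ := hφ.2.1.exists_bound_of_continuous hφ.continuous
  exact MemLp.of_bound hφ.continuous.aestronglyMeasurable B (Eventually.of_forall hB)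

theorem IsTestFun.integrable_mul (hφ : IsTestFun φ) (hg : LocallyIntegrableOn g (Set.Ioo 0 1)) :
    Integrable (fun x => g x * φ x) muI := by
  obtain ⟨B, hB⟩ := hφ.2.1.exists_bound_of_continuous hφ.continuous
  have hsupp : IntegrableOn (fun x => g x * φ x) (tsupport φ) :=
    (hg.integrableOn_compact_subset hφ.2.2 hφ.2.1).mul_bdd (c := B)
      hφ.continuous.aestronglyMeasurable (Eventually.of_forall hB)
  refine ((integrableOn_iff_integrable_of_support_subset fun x hx => ?_).1 hsupp).integrableOn
  exact subset_tsupport _ (right_ne_zero_of_mul hx)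

theorem IsTestFun.setIntegral_mul (hφ : IsTestFun φ) :
    ∫ x, g x * φ x ∂muI = ∫ x, g x * φ x :=
  setIntegral_eq_integral_of_forall_compl_eq_zero fun x hx => by rw [hφ.eq_zero hx, mul_zero]

theorem ae_eq_zero_of_integral_mul_testFun (hf : LocallyIntegrableOn f (Set.Ioo 0 1))
    (h : ∀ φ, IsTestFun φ → ∫ x, f x * φ x ∂muI = 0) : ∀ᵐ x ∂muI, f x = 0 := by
  rw [ae_restrict_iff' measurableSet_Ioo]
  refine isOpen_Ioo.ae_eq_zero_of_integral_contDiff_smul_eq_zero hf fun φ hφ hcomp hsupp => ?_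
  have hφ : IsTestFun φ := ⟨hφ, hcomp, hsupp⟩
  simpa only [hφ.setIntegral_mul, mul_comm, smul_eq_mul] using h φ hφ

theorem IsTestFun.exists_support_subset_Icc (hφ : IsTestFun φ) :
    ∃ α β, 0 < α ∧ β < 1 ∧ Function.support φ ⊆ Set.Icc α β := by
  rcases (tsupport φ).eq_empty_or_nonempty with hempty | hne
  · refine ⟨1, 0, one_pos, one_pos, (subset_tsupport φ).trans ?_⟩
    rw [hempty]
    exact Set.empty_subset _
  · obtain ⟨α, hα, hα'⟩ := hφ.2.1.isCompact.exists_isLeast hne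
    obtain ⟨β, hβ, hβ'⟩ := hφ.2.1.isCompact.exists_isGreatest hne
    exact ⟨α, β, (hφ.2.2 hα).1, (hφ.2.2 hβ).2, fun x hx =>
      ⟨hα' (subset_tsupport φ hx), hβ' (subset_tsupport φ hx)⟩⟩

theorem support_integral_subset_Icc {α β : ℝ} (hf : Continuous f) (hα : 0 < α) (hβ : β < 1)
    (hsupp : Function.support f ⊆ Set.Icc α β) (hmean : ∫ x in (0 : ℝ)..1, f x = 0) :
    Function.support (fun x => ∫ t in (0 : ℝ)..x, f t) ⊆ Set.Icc α β := by
  have hvanish {x y : ℝ} (h : ∀ t ∈ Set.uIoc x y, t ∉ Set.Icc α β) : ∫ t in x..y, f t = 0 :=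
    intervalIntegral.integral_zero_ae <| Eventually.of_forall fun t ht =>
      Function.notMem_support.1 fun hft => h t ht (hsupp hft)
  refine Function.support_subset_iff'.2 fun x hx => ?_
  rw [Set.mem_Icc, not_and_or, not_le, not_le] at hx
  rcases hx with hxα | hβx
  · exact hvanish fun t ht hmem =>
      (ht.2.trans_lt (max_lt hα hxα)).not_ge hmem.1
  · rw [← intervalIntegral.integral_add_adjacent_intervals (hf.intervalIntegrable 0 1)
      (hf.intervalIntegrable 1 x), hmean, zero_add]
    exact hvanish fun t ht hmem => ((lt_min hβ hβx).trans ht.1).not_ge hmem.2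

theorem IsTestFun.exists_deriv_eq (hf : IsTestFun f) (hmean : ∫ x, f x ∂muI = 0) :
    ∃ φ, IsTestFun φ ∧ deriv φ = f := by
  have hderiv (x : ℝ) : HasDerivAt (fun x => ∫ t in (0 : ℝ)..x, f t) (f x) x :=
    hf.continuous.integral_hasStrictDerivAt 0 x |>.hasDerivAt
  have hderiv_eq : deriv (fun x => ∫ t in (0 : ℝ)..x, f t) = f := funext fun x => (hderiv x).deriv
  obtain ⟨α, β, hα, hβ, hsupp⟩ := hf.exists_support_subset_Icc
  have hsub := support_integral_subset_Icc hf.continuous hα hβ hsupp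
    (integral_muI_eq.symm.trans hmean)
  refine ⟨_, ⟨?_, HasCompactSupport.of_support_subset_isCompact isCompact_Icc hsub, ?_⟩, hderiv_eq⟩
  · rw [contDiff_infty_iff_deriv, hderiv_eq]
    exact ⟨fun x => (hderiv x).differentiableAt, hf.1⟩
  · exact (closure_minimal hsub isClosed_Icc).trans fun x hx =>
      ⟨hα.trans_le hx.1, hx.2.trans_lt hβ⟩

theorem exists_testFun_integral_eq_one : ∃ ρ, IsTestFun ρ ∧ ∫ x, ρ x ∂muI = 1 := by
  let b : ContDiffBump (1 / 2 : ℝ) := ⟨1 / 8, 1 / 4, by norm_num, by norm_num⟩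
  have hsupp : tsupport (b.normed volume) ⊆ Set.Ioo 0 1 := by
    rw [b.tsupport_normed_eq, Real.closedBall_eq_Icc]
    exact Set.Icc_subset_Ioo (by norm_num [b]) (by norm_num [b])
  have hb : IsTestFun (b.normed volume) := ⟨b.contDiff_normed, b.hasCompactSupport_normed, hsupp⟩
  refine ⟨_, hb, Eq.trans ?_ (b.integral_normed (μ := volume))⟩
  exact setIntegral_eq_integral_of_forall_compl_eq_zero fun x => hb.eq_zero

theorem IsTestFun.sub_const_mul (hψ : IsTestFun ψ) (hρ : IsTestFun ρ) (m : ℝ) :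
    IsTestFun fun x => ψ x - m * ρ x := by
  refine ⟨hψ.1.sub (contDiff_const.mul hρ.1), hψ.2.1.sub hρ.2.1.mul_left, ?_⟩
  refine (tsupport_sub _ _).trans (Set.union_subset hψ.2.2 ?_)
  exact (tsupport_mul_subset_right (f := fun _ => m)).trans hρ.2.2

/-- The lemma of du Bois-Reymond. -/
theorem exists_ae_eq_const_of_integral_mul_deriv {v : ℝ → ℝ} (hv : Integrable v muI)
    (h : ∀ φ, IsTestFun φ → ∫ x, v x * deriv φ x ∂muI = 0) : ∃ C, ∀ᵐ x ∂muI, v x = C := by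
  obtain ⟨ρ, hρ, hρ1⟩ := exists_testFun_integral_eq_one
  set C := ∫ x, v x * ρ x ∂muI
  suffices hzero : ∀ᵐ x ∂muI, v x - C = 0 from ⟨C, hzero.mono fun x hx => sub_eq_zero.1 hx⟩
  refine ae_eq_zero_of_integral_mul_testFun
    (IntegrableOn.locallyIntegrableOn (hv.sub (integrable_const C))) fun ψ hψ => ?_
  have hiψ := integrable_of_continuous hψ.continuous
  have hiρ := integrable_of_continuous hρ.continuous
  have hivψ := integrable_mul_continuous hv hψ.continuous
  have hivρ := integrable_mul_continuous hv hρ.continuous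
  set m := ∫ x, ψ x ∂muI
  obtain ⟨φ, hφ, hderiv⟩ := (hψ.sub_const_mul hρ m).exists_deriv_eq (by
    rw [integral_sub hiψ (hiρ.const_mul m), integral_const_mul, hρ1, mul_one, sub_self])
  calc ∫ x, (v x - C) * ψ x ∂muI = (∫ x, v x * ψ x ∂muI) - C * m := by
        simp only [sub_mul]
        rw [integral_sub hivψ (hiψ.const_mul C), integral_const_mul]
    _ = (∫ x, v x * ψ x ∂muI) - m * C := by rw [mul_comm C]
    _ = ∫ x, v x * deriv φ x ∂muI := by
        simp only [hderiv, mul_sub, mul_left_comm _ m]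
        rw [integral_sub hivψ (hivρ.const_mul m), integral_const_mul]
    _ = 0 := h φ hφ

end TestFunctions

section WeakDerivative

variable {z g g' : ℝ → ℝ}

theorem IsWeakDeriv.ae_eq (h : IsWeakDeriv z g) (h' : IsWeakDeriv z g') : g =ᵐ[muI] g' := by
  have hzero := ae_eq_zero_of_integral_mul_testFun (h.1.sub h'.1) fun φ hφ => by
    simp only [Pi.sub_apply, sub_mul]
    rw [integral_sub (hφ.integrable_mul h.1) (hφ.integrable_mul h'.1)]
    linarith [h.2 φ hφ, h'.2 φ hφ]
  exact hzero.mono fun x hx => sub_eq_zero.1 hx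

theorem IsWeakDeriv.weakDeriv_ae_eq (h : IsWeakDeriv z g) : weakDeriv z =ᵐ[muI] g := by
  have hex : ∃ g, IsWeakDeriv z g := ⟨g, h⟩
  rw [weakDeriv, dif_pos hex]
  exact hex.choose_spec.ae_eq h

theorem IsWeakDeriv.lintegral_weakDeriv_sq (h : IsWeakDeriv z g) (hg : MemLp g 2 muI) :
    ∫⁻ x, ENNReal.ofReal (weakDeriv z x ^ 2) ∂muI = ENNReal.ofReal (∫ x, g x ^ 2 ∂muI) := by
  rw [lintegral_congr_ae (h.weakDeriv_ae_eq.mono fun x hx => by rw [hx]),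
    ofReal_integral_eq_lintegral_ofReal hg.integrable_sq (ae_of_all _ fun _ => sq_nonneg _)]

theorem continuousOn_integral (hg : Integrable g muI) :
    ContinuousOn (fun x => ∫ t in (0 : ℝ)..x, g t) (Set.Icc 0 1) := by
  have hunit : IntervalIntegrable g volume 0 1 :=
    intervalIntegrable_of_integrable_muI hg (by simp) (by simp)
  simpa only [Set.uIcc_of_le zero_le_one] using
    (hunit.absolutelyContinuousOnInterval_intervalIntegral (c := 0) (by simp)).continuousOn

theorem integral_integral_mul_deriv {φ : ℝ → ℝ} (hg : Integrable g muI) (hφ : IsTestFun φ) :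
    ∫ x, (∫ t in (0 : ℝ)..x, g t) * deriv φ x ∂muI = -∫ x, g x * φ x ∂muI := by
  have hunit : IntervalIntegrable g volume 0 1 :=
    intervalIntegrable_of_integrable_muI hg (by simp) (by simp)
  have hG := hunit.absolutelyContinuousOnInterval_intervalIntegral (c := 0) (by simp)
  have hφ' : AbsolutelyContinuousOnInterval φ 0 1 :=
    (hφ.1.of_le (by simp) : ContDiff ℝ 1 φ).contDiffOn.absolutelyContinuousOnInterval
  rw [integral_muI_eq, hG.integral_mul_deriv_eq_deriv_mul hφ', hφ.eq_zero (by simp),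
    hφ.eq_zero (by simp), mul_zero, mul_zero, sub_self, zero_sub, neg_inj, integral_muI_eq]
  refine intervalIntegral.integral_congr_ae ?_
  filter_upwards [hunit.ae_hasDerivAt_integral] with x hx hxI
  rw [(hx (Set.uIoc_subset_uIcc hxI) 0 (by simp)).deriv]

theorem IsWeakDeriv.exists_ae_eq_primitive (h : IsWeakDeriv z g) (hz : Integrable z muI)
    (hg : Integrable g muI) : ∃ C, ∀ᵐ x ∂muI, z x = C + ∫ t in (0 : ℝ)..x, g t := by
  have hG : Integrable (fun x => ∫ t in (0 : ℝ)..x, g t) muI :=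
    (continuousOn_integral hg).integrableOn_Icc.mono_set Set.Ioo_subset_Icc_self
  obtain ⟨C, hC⟩ := exists_ae_eq_const_of_integral_mul_deriv (hz.sub hG) fun φ hφ => by
    simp only [Pi.sub_apply, sub_mul]
    rw [integral_sub (integrable_mul_continuous hz hφ.continuous_deriv)
      (integrable_mul_continuous hG hφ.continuous_deriv), h.2 φ hφ,
      integral_integral_mul_deriv hg hφ, sub_self]
  exact ⟨C, hC.mono fun x hx => sub_eq_iff_eq_add.1 hx⟩

end WeakDerivative

section WeakCompactness

variable {E : Type*} [NormedAddCommGroup E] [InnerProductSpace ℝ E]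

theorem exists_subseq_tendsto_inner [CompleteSpace E] [TopologicalSpace.SeparableSpace E]
    {u : ℕ → E} {R : ℝ} (hu : ∀ n, ‖u n‖ ≤ R) :
    ∃ (v : E) (ψ : ℕ → ℕ), StrictMono ψ ∧
      ∀ w, Tendsto (fun n => inner ℝ (u (ψ n)) w) atTop (𝓝 (inner ℝ v w)) := by
  let D (n : ℕ) : WeakDual ℝ E := StrongDual.toWeakDual (InnerProductSpace.toDual ℝ E (u n))
  have hD (n : ℕ) :
      D n ∈ WeakDual.toStrongDual ⁻¹' Metric.closedBall (0 : StrongDual ℝ E) R := by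
    rw [Set.mem_preimage, mem_closedBall_zero_iff]
    exact ((InnerProductSpace.toDual ℝ E).norm_map (u n)).trans_le (hu n)
  obtain ⟨T, -, ψ, hψ, hT⟩ := WeakDual.isSeqCompact_closedBall ℝ E 0 R hD
  refine ⟨(InnerProductSpace.toDual ℝ E).symm (WeakDual.toStrongDual T), ψ, hψ, fun w => ?_⟩
  rw [InnerProductSpace.toDual_symm_apply]
  exact (WeakDual.eval_continuous w).continuousAt.tendsto.comp hT

theorem norm_sq_le_of_tendsto_inner {ι : Type*} {L : Filter ι} [L.NeBot] {u : ι → E} {v : E}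
    {Q : ℝ} (hv : Tendsto (fun n => inner ℝ (u n) v) L (𝓝 (inner ℝ v v)))
    (hQ : Tendsto (fun n => ‖u n‖ ^ 2) L (𝓝 Q)) : ‖v‖ ^ 2 ≤ Q := by
  rw [real_inner_self_eq_norm_sq] at hv
  have hle : 2 * ‖v‖ ^ 2 ≤ Q + ‖v‖ ^ 2 :=
    le_of_tendsto_of_tendsto' (hv.const_mul 2) (hQ.add_const _) fun n => by
      linarith [real_inner_le_norm (u n) v, two_mul_le_add_sq ‖u n‖ ‖v‖]
  linarith

theorem inner_toLp {f g : ℝ → ℝ} (hf : MemLp f 2 muI) (hg : MemLp g 2 muI) :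
    inner ℝ (hf.toLp f) (hg.toLp g) = ∫ x, f x * g x ∂muI := by
  rw [L2.inner_def]
  refine integral_congr_ae ?_
  filter_upwards [hf.coeFn_toLp, hg.coeFn_toLp] with x hfx hgx
  rw [hfx, hgx, real_inner_eq_re_inner, RCLike.inner_apply, conj_trivial, mul_comm]
  rfl

theorem norm_toLp_sq {f : ℝ → ℝ} (hf : MemLp f 2 muI) :
    ‖hf.toLp f‖ ^ 2 = ∫ x, f x ^ 2 ∂muI := by
  rw [← real_inner_self_eq_norm_sq, inner_toLp]
  simp only [sq]

theorem exists_subseq_tendsto_integral_mul {G : ℕ → ℝ → ℝ} (hG : ∀ n, MemLp (G n) 2 muI) {Q : ℝ}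
    (hQ : Tendsto (fun n => ∫ x, G n x ^ 2 ∂muI) atTop (𝓝 Q)) :
    ∃ g : ℝ → ℝ, MemLp g 2 muI ∧ ∫ x, g x ^ 2 ∂muI ≤ Q ∧ ∃ ψ : ℕ → ℕ, StrictMono ψ ∧
      ∀ f, MemLp f 2 muI →
        Tendsto (fun n => ∫ x, G (ψ n) x * f x ∂muI) atTop (𝓝 (∫ x, g x * f x ∂muI)) := by
  have : Fact ((2 : ℝ≥0∞) ≠ ⊤) := ⟨ENNReal.ofNat_ne_top⟩
  simp only [← norm_toLp_sq (hG _)] at hQ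
  obtain ⟨R, hR⟩ := hQ.bddAbove_range
  obtain ⟨v, ψ, hψ, hlim⟩ := exists_subseq_tendsto_inner
    (u := fun n => (hG n).toLp (G n)) fun n => Real.le_sqrt_of_sq_le (hR ⟨n, rfl⟩)
  obtain ⟨g, hg, rfl⟩ : ∃ g, ∃ hg : MemLp g 2 muI, hg.toLp g = v :=
    ⟨v, Lp.memLp v, Lp.toLp_coeFn v _⟩
  refine ⟨g, hg, ?_, ψ, hψ, fun f hf => ?_⟩
  · rw [← norm_toLp_sq hg]
    exact norm_sq_le_of_tendsto_inner (hlim _) (hQ.comp hψ.tendsto_atTop)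
  · simpa only [inner_toLp] using hlim (hf.toLp f)

end WeakCompactness

theorem sq_intervalIntegral_le {g : ℝ → ℝ} {x y : ℝ} (hxy : x ≤ y)
    (hg : IntervalIntegrable g volume x y)
    (hg2 : IntervalIntegrable (fun t => g t ^ 2) volume x y) :
    (∫ t in x..y, g t) ^ 2 ≤ (y - x) * ∫ t in x..y, g t ^ 2 := by
  rcases hxy.eq_or_lt with rfl | hlt
  · simp
  have hpos : 0 < y - x := sub_pos.2 hlt
  set m := (∫ t in x..y, g t) / (y - x) with hm
  have hvariance : ∫ t in x..y, (g t - m) ^ 2 =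
      (∫ t in x..y, g t ^ 2) - 2 * m * (∫ t in x..y, g t) + m ^ 2 * (y - x) := by
    have hexpand (t : ℝ) : (g t - m) ^ 2 = g t ^ 2 - 2 * m * g t + m ^ 2 := by ring
    simp only [hexpand]
    rw [intervalIntegral.integral_add (hg2.sub (hg.const_mul _)) intervalIntegrable_const,
      intervalIntegral.integral_sub hg2 (hg.const_mul _), intervalIntegral.integral_const_mul,
      intervalIntegral.integral_const, smul_eq_mul]
    ring
  have hnonneg : 0 ≤ ∫ t in x..y, (g t - m) ^ 2 :=
    intervalIntegral.integral_nonneg hxy fun t _ => sq_nonneg _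
  have hmean : ∫ t in x..y, g t = m * (y - x) := by rw [hm, div_mul_cancel₀ _ hpos.ne']
  rw [hvariance, hmean] at hnonneg
  rw [hmean]
  nlinarith only [mul_nonneg hpos.le hnonneg]

theorem memLp_of_continuousOn {w : ℝ → ℝ} (hw : ContinuousOn w (Set.Icc 0 1)) (p : ℝ≥0∞) :
    MemLp w p muI := by
  obtain ⟨B, hB⟩ := isCompact_Icc.exists_bound_of_continuousOn hw
  refine MemLp.of_bound ((hw.mono Set.Ioo_subset_Icc_self).aestronglyMeasurable measurableSet_Ioo)
    B (ae_mem_Ioo.mono fun x hx => hB x (Set.Ioo_subset_Icc_self hx))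

theorem eqOn_Icc_of_ae_muI_eq {f g : ℝ → ℝ} (hf : ContinuousOn f (Set.Icc 0 1))
    (hg : ContinuousOn g (Set.Icc 0 1)) (h : f =ᵐ[muI] g) : Set.EqOn f g (Set.Icc 0 1) := by
  refine Measure.eqOn_Icc_of_ae_eq volume zero_ne_one ?_ hf hg
  rwa [← Measure.restrict_congr_set Ioo_ae_eq_Icc]

theorem le_of_ae_muI_le {f g : ℝ → ℝ} (hf : ContinuousOn f (Set.Icc 0 1))
    (hg : ContinuousOn g (Set.Icc 0 1)) (h : ∀ᵐ x ∂muI, f x ≤ g x) {x : ℝ}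
    (hx : x ∈ Set.Icc (0 : ℝ) 1) : f x ≤ g x :=
  max_eq_right_iff.1 (eqOn_Icc_of_ae_muI_eq (hf.sup hg) hg (h.mono fun _ => max_eq_right) hx)

/-! ### The Riemann sum regime -/

/-- The discrete counterpart of `∫ (z')²`. -/
noncomputable def dirichletEnergy (lam : ℝ) (a : ℕ → ℝ) : ℝ :=
  squaredIncrements (numCells lam) a / lam

/-- The discrete derivative of a chain, as a function on `I`. It vanishes on the last cell. -/
noncomputable def diffQuot (lam : ℝ) (a : ℕ → ℝ) : ℝ → ℝ :=
  stepFun lam (numCells lam - 1) fun i => (a (i + 1) - a i) / lam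

section DifferenceQuotient

variable {lam x y : ℝ} {a : ℕ → ℝ}

theorem dirichletEnergy_nonneg (hlam : 0 < lam) (a : ℕ → ℝ) : 0 ≤ dirichletEnergy lam a :=
  div_nonneg (squaredIncrements_nonneg _ _) hlam.le

theorem mul_dirichletEnergy (hlam : 0 < lam) (a : ℕ → ℝ) :
    lam * dirichletEnergy lam a = squaredIncrements (numCells lam) a :=
  mul_div_cancel₀ _ hlam.ne'

theorem abs_sub_le_sqrt_mul_dirichletEnergy (hlam : 0 < lam) {i j : ℕ} (hij : i ≤ j)
    (hj : j < numCells lam) {t : ℝ} (ht : lam * (j - i) ≤ t) :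
    |a j - a i| ≤ √(t * dirichletEnergy lam a) := by
  refine Real.abs_le_sqrt ((sq_sub_le_mul_squaredIncrements a hij hj).trans ?_)
  calc (j - i : ℝ) * squaredIncrements (numCells lam) a
      = lam * (j - i) * dirichletEnergy lam a := by
        rw [← mul_dirichletEnergy hlam]
        ring
    _ ≤ t * dirichletEnergy lam a := by
        gcongr
        exact dirichletEnergy_nonneg hlam a

theorem abs_abs_sub_abs_le_of_periodic (hlam : 0 < lam) (hper : |a 0| = |a (numCells lam - 1)|)
    (hx : 0 ≤ x) (hxN : ⌊x / lam⌋₊ < numCells lam) (hy : 0 ≤ y) (hyN : ⌊y / lam⌋₊ < numCells lam) :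
    |(|a ⌊x / lam⌋₊| - |a ⌊y / lam⌋₊|)| ≤
      √(x * dirichletEnergy lam a) + √((1 - y) * dirichletEnergy lam a) := by
  have hleft : |a ⌊x / lam⌋₊ - a 0| ≤ √(x * dirichletEnergy lam a) :=
    abs_sub_le_sqrt_mul_dirichletEnergy hlam (Nat.zero_le _) hxN
      (by simpa using mul_floor_le hlam hx)
  have hright : |a (numCells lam - 1) - a ⌊y / lam⌋₊| ≤ √((1 - y) * dirichletEnergy lam a) := by
    refine abs_sub_le_sqrt_mul_dirichletEnergy hlam (by omega) (by omega) ?_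
    rw [Nat.cast_pred (by omega)]
    linarith [lt_mul_floor hlam hy, mul_numCells_le hlam]
  calc |(|a ⌊x / lam⌋₊| - |a ⌊y / lam⌋₊|)|
      ≤ |(|a ⌊x / lam⌋₊| - |a 0|)| + |(|a (numCells lam - 1)| - |a ⌊y / lam⌋₊|)| := by
        rw [← hper]
        exact abs_sub_le _ _ _
    _ ≤ √(x * dirichletEnergy lam a) + √((1 - y) * dirichletEnergy lam a) :=
        add_le_add ((abs_abs_sub_abs_le_abs_sub _ _).trans hleft)
          ((abs_abs_sub_abs_le_abs_sub _ _).trans hright)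

theorem memLp_diffQuot (lam : ℝ) (a : ℕ → ℝ) : MemLp (diffQuot lam a) 2 muI := by
  refine MemLp.of_bound (measurable_stepFun _ _ _).aestronglyMeasurable
    (∑ i ∈ Finset.range (numCells lam - 1), |(a (i + 1) - a i) / lam|) (ae_of_all _ fun x => ?_)
  exact abs_stepFun_le (Finset.sum_nonneg fun _ _ => abs_nonneg _) fun i hi =>
    Finset.single_le_sum (f := fun i => |(a (i + 1) - a i) / lam|) (fun _ _ => abs_nonneg _)
      (Finset.mem_range.2 hi)

theorem integral_diffQuot_sq (hlam : 0 < lam) (a : ℕ → ℝ) :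
    ∫ x, diffQuot lam a x ^ 2 ∂muI = dirichletEnergy lam a := by
  have hsq (x : ℝ) : diffQuot lam a x ^ 2 =
      stepFun lam (numCells lam - 1) (fun i => ((a (i + 1) - a i) / lam) ^ 2) x := by
    unfold diffQuot stepFun Set.indicator
    split_ifs <;> simp
  simp only [hsq]
  rw [integral_stepFun hlam (mul_numCells_sub_one_le hlam), dirichletEnergy, squaredIncrements,
    Finset.mul_sum, Finset.sum_div]
  refine Finset.sum_congr rfl fun i _ => ?_
  field_simp

theorem abs_mul_sub_integral_le {φ : ℝ → ℝ} {L : ℝ≥0} (hφ : LipschitzWith L φ) (hxy : x ≤ y) :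
    |(y - x) * φ y - ∫ t in x..y, φ t| ≤ L * (y - x) ^ 2 := by
  have hdiff : (y - x) * φ y - ∫ t in x..y, φ t = ∫ t in x..y, (φ y - φ t) := by
    rw [intervalIntegral.integral_sub intervalIntegrable_const
      (hφ.continuous.intervalIntegrable _ _), intervalIntegral.integral_const, smul_eq_mul]
  have hbound : ∀ t ∈ Set.uIoc x y, ‖φ y - φ t‖ ≤ L * (y - x) := fun t ht => by
    rw [Set.uIoc_of_le hxy] at ht
    calc ‖φ y - φ t‖ ≤ L * |y - t| := hφ.dist_le_mul y t
      _ ≤ L * (y - x) := by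
          rw [abs_of_nonneg (sub_nonneg.2 ht.2)]
          gcongr
          exact ht.1.le
  calc |(y - x) * φ y - ∫ t in x..y, φ t| ≤ L * (y - x) * |y - x| := by
        rw [hdiff]
        exact intervalIntegral.norm_integral_le_of_norm_le_const hbound
    _ = L * (y - x) ^ 2 := by
        rw [abs_of_nonneg (sub_nonneg.2 hxy)]
        ring

theorem abs_sum_sub_integral_diffQuot_mul_le (hlam : 0 < lam) (a : ℕ → ℝ) {φ : ℝ → ℝ} {L : ℝ≥0}
    (hφ : LipschitzWith L φ) :
    |∑ i ∈ Finset.range (numCells lam - 1), (a (i + 1) - a i) * φ (lam * (i + 1)) -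
      ∫ x, diffQuot lam a x * φ x ∂muI| ≤ L * (lam * (dirichletEnergy lam a + 1)) := by
  have hcell (i : ℕ) : |(a (i + 1) - a i) * φ (lam * (i + 1)) -
      (a (i + 1) - a i) / lam * ∫ x in (lam * i)..(lam * (i + 1)), φ x| ≤
        L * ((a (i + 1) - a i) ^ 2 + lam ^ 2) := by
    have hlen : lam * (i + 1 : ℝ) - lam * i = lam := by ring
    have hle := abs_mul_sub_integral_le hφ (show lam * i ≤ lam * (i + 1 : ℝ) by linarith)
    rw [hlen] at hle
    calc _ = |a (i + 1) - a i| / lam *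
          |lam * φ (lam * (i + 1)) - ∫ x in (lam * i)..(lam * (i + 1)), φ x| := by
          rw [← abs_of_pos hlam, ← abs_div, abs_of_pos hlam, ← abs_mul]
          congr 1
          field_simp
      _ ≤ |a (i + 1) - a i| / lam * (L * lam ^ 2) := by gcongr
      _ = L * (|a (i + 1) - a i| * lam) := by field_simp
      _ ≤ L * ((a (i + 1) - a i) ^ 2 + lam ^ 2) := by
          rw [← sq_abs (a (i + 1) - a i)]
          gcongr
          nlinarith only [two_mul_le_add_sq |a (i + 1) - a i| lam,
            mul_nonneg (abs_nonneg (a (i + 1) - a i)) hlam.le]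
  calc _ = |∑ i ∈ Finset.range (numCells lam - 1), ((a (i + 1) - a i) * φ (lam * (i + 1)) -
        (a (i + 1) - a i) / lam * ∫ x in (lam * i)..(lam * (i + 1)), φ x)| := by
        unfold diffQuot
        rw [integral_stepFun_mul hlam (mul_numCells_sub_one_le hlam) _ hφ.continuous,
          Finset.sum_sub_distrib]
    _ ≤ ∑ i ∈ Finset.range (numCells lam - 1), L * ((a (i + 1) - a i) ^ 2 + lam ^ 2) :=
        (Finset.abs_sum_le_sum_abs _ _).trans (Finset.sum_le_sum fun i _ => hcell i)
    _ = L * (lam * (dirichletEnergy lam a + lam * (numCells lam - 1 : ℕ))) := by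
        rw [mul_add lam, mul_dirichletEnergy hlam, squaredIncrements, ← Finset.mul_sum,
          Finset.sum_add_distrib, Finset.sum_const, Finset.card_range, nsmul_eq_mul]
        ring
    _ ≤ L * (lam * (dirichletEnergy lam a + 1)) := by
        gcongr
        exact mul_numCells_sub_one_le hlam

end DifferenceQuotient

section FiniteDirichletEnergy

variable {lam : ℕ → ℝ} {a : ℕ → ℕ → ℝ} {z : ℝ → ℝ} {Q : ℝ} (hlam : IsPosNullSeq lam)
  (hz : ∀ᵐ x ∂muI, Tendsto (fun n => a n ⌊x / lam n⌋₊) atTop (𝓝 (z x)))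
  (hQ : Tendsto (fun n => dirichletEnergy (lam n) (a n)) atTop (𝓝 Q))

include hlam hz hQ

theorem exists_eventually_abs_le :
    ∃ B, ∀ᶠ n in atTop, ∀ i < numCells (lam n), |a n i| ≤ B := by
  obtain ⟨x, hx, hxI⟩ := (hz.and ae_mem_Ioo).exists
  refine ⟨|z x| + √Q + 1, ?_⟩
  filter_upwards [(hx.abs.add hQ.sqrt).eventually (gt_mem_nhds (lt_add_one _)),
    hlam.eventually_floor_add_lt hxI.1.le hxI.2 0] with n hn hxn i hi
  have hosc : |a n i - a n ⌊x / lam n⌋₊| ≤ √(dirichletEnergy (lam n) (a n)) :=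
    Real.abs_le_sqrt (sq_sub_le_squaredIncrements_div (hlam.pos n) (a n) hxn hi)
  linarith [abs_sub_abs_le_abs_sub (a n i) (a n ⌊x / lam n⌋₊)]

theorem tendsto_integral_diffQuot_mul {φ : ℝ → ℝ} (hφ : IsTestFun φ) :
    Tendsto (fun n => ∫ x, diffQuot (lam n) (a n) x * φ x ∂muI) atTop
      (𝓝 (-∫ x, z x * deriv φ x ∂muI)) := by
  obtain ⟨B, hB⟩ := exists_eventually_abs_le hlam hz hQ
  obtain ⟨L, hL⟩ := hφ.1.lipschitzWith_of_hasCompactSupport hφ.2.1 (by simp)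
  have hbound : Tendsto (fun n => (L : ℝ) * (lam n * (dirichletEnergy (lam n) (a n) + 1))) atTop
      (𝓝 0) := by
    simpa using (hlam.tendsto.mul (hQ.add_const 1)).const_mul (L : ℝ)
  have herror : Tendsto (fun n => ∑ i ∈ Finset.range (numCells (lam n) - 1),
      (a n (i + 1) - a n i) * φ (lam n * (i + 1)) - ∫ x, diffQuot (lam n) (a n) x * φ x ∂muI)
      atTop (𝓝 0) :=
    squeeze_zero_norm (fun n => abs_sum_sub_integral_diffQuot_mul_le (hlam.pos n) (a n) hL) hbound
  simpa using (tendsto_neg_sum_sub_mul_testFun hlam hB hz hφ).neg.sub herror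

theorem exists_isWeakDeriv :
    ∃ g, MemLp g 2 muI ∧ ∫ x, g x ^ 2 ∂muI ≤ Q ∧ IsWeakDeriv z g := by
  obtain ⟨g, hg, hgQ, ψ, hψ, hweak⟩ := exists_subseq_tendsto_integral_mul
    (fun n => memLp_diffQuot (lam n) (a n))
    (hQ.congr fun n => (integral_diffQuot_sq (hlam.pos n) (a n)).symm)
  refine ⟨g, hg, hgQ, IntegrableOn.locallyIntegrableOn (hg.integrable one_le_two),
    fun φ hφ => ?_⟩
  rw [tendsto_nhds_unique (hweak φ hφ.memLp)
    ((tendsto_integral_diffQuot_mul hlam hz hQ hφ).comp hψ.tendsto_atTop), neg_neg]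

theorem abs_abs_sub_abs_le (hper : ∀ n, |a n 0| = |a n (numCells (lam n) - 1)|) :
    ∀ᵐ y ∂muI, ∀ᵐ x ∂muI, |(|z x| - |z y|)| ≤ √(x * Q) + √((1 - y) * Q) := by
  filter_upwards [hz, ae_mem_Ioo] with y hzy hy
  filter_upwards [hz, ae_mem_Ioo] with x hzx hx
  refine le_of_tendsto_of_tendsto (hzx.abs.sub hzy.abs).abs
    ((hQ.const_mul x).sqrt.add (hQ.const_mul (1 - y)).sqrt) ?_
  filter_upwards [hlam.eventually_floor_add_lt hx.1.le hx.2 0,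
    hlam.eventually_floor_add_lt hy.1.le hy.2 0] with n hxn hyn
  exact abs_abs_sub_abs_le_of_periodic (hlam.pos n) (hper n) hx.1.le hxn hy.1.le hyn

theorem abs_zero_eq_abs_one (hper : ∀ n, |a n 0| = |a n (numCells (lam n) - 1)|) {w : ℝ → ℝ}
    (hw : ContinuousOn w (Set.Icc 0 1)) (hzw : z =ᵐ[muI] w) : |w 0| = |w 1| := by
  have hzero : ∀ᵐ y ∂muI, |(|w 0| - |w y|)| ≤ √((1 - y) * Q) := by
    filter_upwards [abs_abs_sub_abs_le hlam hz hQ hper, hzw] with y hy hzwy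
    have hwy : ∀ᵐ x ∂muI, |(|w x| - |w y|)| ≤ √(x * Q) + √((1 - y) * Q) := by
      filter_upwards [hy, hzw] with x hx hzwx
      rwa [hzwx, hzwy] at hx
    simpa using le_of_ae_muI_le (by fun_prop) (by fun_prop) hwy (Set.left_mem_Icc.2 zero_le_one)
  have hone : |(|w 0| - |w 1|)| ≤ √((1 - 1) * Q) :=
    le_of_ae_muI_le (by fun_prop) (by fun_prop) hzero (Set.right_mem_Icc.2 zero_le_one)
  rw [sub_self, zero_mul, Real.sqrt_zero] at hone
  exact sub_eq_zero.1 (abs_nonpos_iff.1 hone)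

end FiniteDirichletEnergy

theorem IsW12per.lintegral_well {z : ℝ → ℝ} (hz : IsW12per z) :
    ∫⁻ x, ENNReal.ofReal ((z x ^ 2 - 1) ^ 2) ∂muI =
      ENNReal.ofReal (∫ x, (z x ^ 2 - 1) ^ 2 ∂muI) := by
  obtain ⟨-, w, hw, hzw, -⟩ := hz
  have hint : Integrable (fun x => (w x ^ 2 - 1) ^ 2) muI :=
    memLp_one_iff_integrable.1 (memLp_of_continuousOn (by fun_prop) 1)
  refine (ofReal_integral_eq_lintegral_ofReal (hint.congr ?_)
    (ae_of_all _ fun _ => sq_nonneg _)).symm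
  exact hzw.mono fun x hx => by simp only [hx]

theorem limitFinite_eq {l : ℝ} (hl0 : 0 < l) {z : L1I} (hz : IsW12per z) {g : ℝ → ℝ}
    (hg : MemLp g 2 muI) (hzg : IsWeakDeriv z g) :
    limitFinite l z =
      ENNReal.ofReal (1 / l * (∫ x, (z x ^ 2 - 1) ^ 2 ∂muI) + l * ∫ x, g x ^ 2 ∂muI) := by
  have hwell : 0 ≤ ∫ x, (z x ^ 2 - 1) ^ 2 ∂muI := integral_nonneg fun _ => sq_nonneg _
  have hgrad : 0 ≤ ∫ x, g x ^ 2 ∂muI := integral_nonneg fun _ => sq_nonneg _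
  have hl : 0 < 1 / l := one_div_pos.2 hl0
  rw [limitFinite, if_pos hz, hz.lintegral_well, hzg.lintegral_weakDeriv_sq hg,
    ← ENNReal.ofReal_mul hl.le, ← ENNReal.ofReal_mul hl0.le,
    ← ENNReal.ofReal_add (mul_nonneg hl.le hwell) (mul_nonneg hl0.le hgrad)]

namespace ChainLimit

variable {lam h κ : ℕ → ℝ} {c l : ℝ} {a : ℕ → ℕ → ℝ}

theorem inv_mul_add_mul_le {z : ℝ → ℝ} (H : ChainLimit lam h κ c a z) (hl0 : 0 < l)
    (hl : Tendsto (fun n => lam n / h n) atTop (𝓝 l)) {P Q : ℝ}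
    (hP : Tendsto (fun n => lam n * wellSum (numCells (lam n)) (a n)) atTop (𝓝 P))
    (hQ : Tendsto (fun n => dirichletEnergy (lam n) (a n)) atTop (𝓝 Q)) :
    1 / l * P + l * Q ≤ c := by
  have hlim : Tendsto (fun n => (lam n / h n)⁻¹ * (lam n * wellSum (numCells (lam n)) (a n)) +
      κ n * (lam n / h n) * dirichletEnergy (lam n) (a n)) atTop (𝓝 (l⁻¹ * P + 1 * l * Q)) :=
    ((hl.inv₀ hl0.ne').mul hP).add ((H.κ_tendsto.mul hl).mul hQ)
  rw [one_mul, ← one_div] at hlim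
  refine le_of_tendsto' hlim fun n => le_of_eq_of_le ?_ (H.wellSum_add_squaredIncrements_le n)
  have := (H.lam_null.pos n).ne'
  have := (H.h_null.pos n).ne'
  rw [dirichletEnergy, inv_div]
  field_simp

theorem limitFinite_le_of_tendsto {z : L1I} (H : ChainLimit lam h κ c a z) (hl0 : 0 < l)
    (hl : Tendsto (fun n => lam n / h n) atTop (𝓝 l)) {P Q : ℝ}
    (hP : Tendsto (fun n => lam n * wellSum (numCells (lam n)) (a n)) atTop (𝓝 P))
    (hQ : Tendsto (fun n => dirichletEnergy (lam n) (a n)) atTop (𝓝 Q)) :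
    limitFinite l z ≤ ENNReal.ofReal c := by
  obtain ⟨g, hg, hgQ, hzg⟩ := exists_isWeakDeriv H.lam_null H.tendsto hQ
  have hgi : Integrable g muI := hg.integrable one_le_two
  obtain ⟨C, hC⟩ := hzg.exists_ae_eq_primitive (L1.integrable_coeFn z) hgi
  have hcont : ContinuousOn (fun x => C + ∫ t in (0 : ℝ)..x, g t) (Set.Icc 0 1) :=
    (continuousOn_integral hgi).const_add C
  have hz2 : MemLp z 2 muI := (memLp_congr_ae hC).2 (memLp_of_continuousOn hcont 2)
  have hper : IsW12per z := ⟨⟨hz2, g, hg, hzg⟩, _, hcont, hC,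
    abs_zero_eq_abs_one H.lam_null H.tendsto hQ H.periodic hcont hC⟩
  have hP0 : 0 ≤ P :=
    ge_of_tendsto' hP fun n => mul_nonneg (H.lam_null.pos n).le (wellSum_nonneg _ _)
  have hwell : ∫ x, (z x ^ 2 - 1) ^ 2 ∂muI ≤ P := by
    rw [← ENNReal.ofReal_le_ofReal_iff hP0, ← hper.lintegral_well]
    exact H.lintegral_well_le hP
  rw [limitFinite_eq hl0 hper hg hzg]
  refine ENNReal.ofReal_le_ofReal (le_trans ?_ (H.inv_mul_add_mul_le hl0 hl hP hQ))
  gcongr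

theorem limitFinite_le {z : L1I} (H : ChainLimit lam h κ c a z) (hl0 : 0 < l)
    (hl : Tendsto (fun n => lam n / h n) atTop (𝓝 l)) : limitFinite l z ≤ ENNReal.ofReal c := by
  obtain ⟨R, hR⟩ := (hl.const_mul c).bddAbove_range
  obtain ⟨R', hR'⟩ := (H.tendsto_div_κ.mul (hl.inv₀ hl0.ne')).bddAbove_range
  have hmem (n : ℕ) : (lam n * wellSum (numCells (lam n)) (a n), dirichletEnergy (lam n) (a n)) ∈
      Set.Icc 0 R ×ˢ Set.Icc 0 R' := by
    have hlam := H.lam_null.pos n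
    refine ⟨⟨mul_nonneg hlam.le (wellSum_nonneg _ _), (H.mul_wellSum_le n).trans (hR ⟨n, rfl⟩)⟩,
      dirichletEnergy_nonneg hlam _, le_trans ?_ (hR' ⟨n, rfl⟩)⟩
    calc dirichletEnergy (lam n) (a n) ≤ c / κ n * h n / lam n :=
          div_le_div_of_nonneg_right (H.squaredIncrements_le n) hlam.le
      _ = c / κ n * (lam n / h n)⁻¹ := by rw [inv_div, mul_div_assoc]
  obtain ⟨⟨P, Q⟩, -, ψ, hψ, hlim⟩ := (isCompact_Icc.prod isCompact_Icc).tendsto_subseq hmem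
  rw [Prod.tendsto_iff] at hlim
  exact (H.comp hψ.tendsto_atTop).limitFinite_le_of_tendsto hl0 (hl.comp hψ.tendsto_atTop)
    hlim.1 hlim.2

end ChainLimit

/-- The `i`-th of the `M + 1` equidistant nodes in `[0, 1]`, continued by `1` after the last one. -/
noncomputable def node (M i : ℕ) : ℝ := min 1 (i / M)

theorem node_mem_Icc (M i : ℕ) : node M i ∈ Set.Icc (0 : ℝ) 1 :=
  ⟨le_min zero_le_one (by positivity), min_le_left _ _⟩

theorem node_zero (M : ℕ) : node M 0 = 0 := by simp [node]

theorem node_self {M : ℕ} (hM : 0 < M) : node M M = 1 := by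
  rw [node, div_self (by exact_mod_cast hM.ne'), min_self]

theorem node_of_le {M i : ℕ} (hi : i ≤ M) : node M i = i / M :=
  min_eq_right (div_le_one_of_le₀ (by exact_mod_cast hi) (Nat.cast_nonneg M))

theorem IsPosNullSeq.tendsto_node {lam : ℕ → ℝ} (hlam : IsPosNullSeq lam) {x : ℝ}
    (hx : x ∈ Set.Ioo (0 : ℝ) 1) (k : ℕ) :
    Tendsto (fun n => node (numCells (lam n) - 1) (⌊x / lam n⌋₊ + k)) atTop (𝓝 x) := by
  have hnum : Tendsto (fun n => lam n * (⌊x / lam n⌋₊ + k : ℕ)) atTop (𝓝 x) := by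
    simpa [mul_add] using (hlam.tendsto_mul_floor hx.1.le).add (hlam.tendsto.mul_const (k : ℝ))
  have hdiv : Tendsto (fun n => lam n * (⌊x / lam n⌋₊ + k : ℕ) /
      (lam n * (numCells (lam n) - 1 : ℕ))) atTop (𝓝 x) := by
    simpa [Pi.div_def] using hnum.div hlam.tendsto_mul_numCells_sub_one one_ne_zero
  have hmin := (tendsto_const_nhds (x := (1 : ℝ))).min hdiv
  rw [min_eq_right hx.2.le] at hmin
  refine hmin.congr fun n => ?_
  rw [node, mul_div_mul_left _ _ (hlam.pos n).ne']

theorem squaredIncrements_primitive_node_le {g : ℝ → ℝ} (hg : MemLp g 2 muI) (C : ℝ) {N : ℕ}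
    (hN : 2 ≤ N) :
    squaredIncrements N (fun i => C + ∫ t in (0 : ℝ)..node (N - 1) i, g t) ≤
      1 / (N - 1 : ℕ) * ∫ x, g x ^ 2 ∂muI := by
  have hM : 0 < N - 1 := by omega
  set M := N - 1
  have hint {f : ℝ → ℝ} (hf : Integrable f muI) (i j : ℕ) :
      IntervalIntegrable f volume (node M i) (node M j) :=
    intervalIntegrable_of_integrable_muI hf (node_mem_Icc M i) (node_mem_Icc M j)
  have hgi : Integrable g muI := hg.integrable one_le_two
  have hincrement (i : ℕ) (hi : i ∈ Finset.range M) :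
      ((C + ∫ t in (0 : ℝ)..node M (i + 1), g t) - (C + ∫ t in (0 : ℝ)..node M i, g t)) ^ 2 ≤
        1 / M * ∫ t in node M i..node M (i + 1), g t ^ 2 := by
    have hi := Finset.mem_range.1 hi
    have hlen : node M (i + 1) - node M i = 1 / M := by
      rw [node_of_le hi, node_of_le hi.le]
      push_cast
      ring
    rw [add_sub_add_left_eq_sub, ← node_zero M,
      intervalIntegral.integral_interval_sub_left (hint hgi _ _) (hint hgi _ _), ← hlen]
    refine sq_intervalIntegral_le ?_ (hint hgi _ _) (hint hg.integrable_sq _ _)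
    exact sub_nonneg.1 (hlen ▸ by positivity)
  calc squaredIncrements N (fun i => C + ∫ t in (0 : ℝ)..node M i, g t)
      ≤ ∑ i ∈ Finset.range M, 1 / M * ∫ t in node M i..node M (i + 1), g t ^ 2 :=
        Finset.sum_le_sum hincrement
    _ = 1 / M * ∫ x, g x ^ 2 ∂muI := by
        rw [← Finset.mul_sum, intervalIntegral.sum_integral_adjacent_intervals fun i _ =>
          hint hg.integrable_sq i (i + 1), node_zero, node_self hM, integral_muI_eq]

theorem abs_wellTerm_le {a : ℕ → ℝ} {B : ℝ} (hB : ∀ i, |a i| ≤ B) (i : ℕ) :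
    |wellTerm a i| ≤ (B ^ 2 + 1) ^ 2 := by
  have hsq (j : ℕ) : a j ^ 2 ≤ B ^ 2 := sq_le_sq' (abs_le.1 (hB j)).1 (abs_le.1 (hB j)).2
  rw [abs_of_nonneg (wellTerm_nonneg a i)]
  exact sq_le_sq' (by linarith [sq_nonneg (a i), sq_nonneg (a (i + 1)), sq_nonneg B])
    (by linarith [hsq i, hsq (i + 1)])

theorem IsPosNullSeq.tendsto_mul_wellSum {lam : ℕ → ℝ} (hlam : IsPosNullSeq lam)
    {a : ℕ → ℕ → ℝ} {B : ℝ} (hB : ∀ n i, |a n i| ≤ B) {z : ℝ → ℝ}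
    (hz : ∀ k, ∀ᵐ x ∂muI, Tendsto (fun n => a n (⌊x / lam n⌋₊ + k)) atTop (𝓝 (z x))) :
    Tendsto (fun n => lam n * wellSum (numCells (lam n)) (a n)) atTop
      (𝓝 (∫ x, (z x ^ 2 - 1) ^ 2 ∂muI)) := by
  have hintegral (n : ℕ) : ∫ x, stepFun (lam n) (numCells (lam n) - 1) (wellTerm (a n)) x ∂muI =
      lam n * wellSum (numCells (lam n)) (a n) :=
    integral_stepFun (hlam.pos n) (mul_numCells_sub_one_le (hlam.pos n)) _
  simp only [← hintegral]
  refine tendsto_integral_of_dominated_convergence (fun _ => (B ^ 2 + 1) ^ 2)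
    (fun n => (measurable_stepFun _ _ _).aestronglyMeasurable) (integrable_const _)
    (fun n => ae_of_all _ fun x => abs_stepFun_le (sq_nonneg _) fun i _ =>
      abs_wellTerm_le (hB n) i) ?_
  filter_upwards [hz 0, hz 1, ae_mem_Ioo] with x hx hsucc hxI
  exact tendsto_stepFun hlam hxI 1 (tendsto_wellTerm hx hsucc)

theorem quadEnergy_primitive_node_le {lam h : ℝ} (hlam : 0 < lam) (hh : 0 < h) {g : ℝ → ℝ}
    (hg : MemLp g 2 muI) (C : ℝ) (hN : 2 ≤ numCells lam) {a : ℕ → ℝ}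
    (ha : a = fun i => C + ∫ t in (0 : ℝ)..node (numCells lam - 1) i, g t) :
    quadEnergy h 1 (numCells lam) a ≤
      (lam / h)⁻¹ * (lam * wellSum (numCells lam) a) +
        lam / h * (lam * (numCells lam - 1 : ℕ))⁻¹ * ∫ x, g x ^ 2 ∂muI := by
  rw [quadEnergy_eq]
  have hM : ((numCells lam - 1 : ℕ) : ℝ) ≠ 0 := by
    rw [Nat.cast_ne_zero]
    omega
  refine add_le_add (le_of_eq (by field_simp)) ?_
  calc 1 / h * squaredIncrements (numCells lam) a
      ≤ 1 / h * (1 / (numCells lam - 1 : ℕ) * ∫ x, g x ^ 2 ∂muI) := by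
        rw [ha]
        exact mul_le_mul_of_nonneg_left (squaredIncrements_primitive_node_le hg C hN)
          (by positivity)
    _ = lam / h * (lam * (numCells lam - 1 : ℕ))⁻¹ * ∫ x, g x ^ 2 ∂muI := by field_simp

theorem exists_recovery_primitive {lam del : ℕ → ℝ} (hlam : IsPosNullSeq lam)
    (hdel : IsPosNullSeq del) {l : ℝ} (hl0 : 0 < l)
    (hl : Tendsto (fun n => lam n / √(2 * del n)) atTop (𝓝 l)) {z : L1I} {g : ℝ → ℝ}
    (hg : MemLp g 2 muI) {C : ℝ} (hz : ∀ᵐ x ∂muI, z x = C + ∫ t in (0 : ℝ)..x, g t)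
    (hper : |C + ∫ t in (0 : ℝ)..0, g t| = |C + ∫ t in (0 : ℝ)..1, g t|) :
    ∃ y : ℕ → L1I, Tendsto y atTop (𝓝 z) ∧
      limsup (fun n => scaledHhf (lam n) (del n) (y n)) atTop ≤
        ENNReal.ofReal (1 / l * (∫ x, (z x ^ 2 - 1) ^ 2 ∂muI) + l * ∫ x, g x ^ 2 ∂muI) := by
  have hcont : ContinuousOn (fun x => C + ∫ t in (0 : ℝ)..x, g t) (Set.Icc 0 1) :=
    (continuousOn_integral (hg.integrable one_le_two)).const_add C
  obtain ⟨B, hbound⟩ := isCompact_Icc.exists_bound_of_continuousOn hcont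
  set a : ℕ → ℕ → ℝ := fun n i => C + ∫ t in (0 : ℝ)..node (numCells (lam n) - 1) i, g t with ha
  have hB (n i : ℕ) : |a n i| ≤ B := hbound _ (node_mem_Icc _ _)
  have hlim (k : ℕ) : ∀ᵐ x ∂muI, Tendsto (fun n => a n (⌊x / lam n⌋₊ + k)) atTop (𝓝 (z x)) := by
    filter_upwards [hz, ae_mem_Ioo] with x hx hxI
    rw [hx]
    exact (hcont x (Set.Ioo_subset_Icc_self hxI)).tendsto.comp (tendsto_nhdsWithin_iff.2
      ⟨hlam.tendsto_node hxI k, Eventually.of_forall fun n => node_mem_Icc _ _⟩)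
  obtain ⟨y, hy, hstep⟩ := exists_tendsto_L1 hB (hlim 0)
  have he : Tendsto (fun n => (lam n / √(2 * del n))⁻¹ *
        (lam n * wellSum (numCells (lam n)) (a n)) +
      lam n / √(2 * del n) * (lam n * (numCells (lam n) - 1 : ℕ))⁻¹ * ∫ x, g x ^ 2 ∂muI) atTop
      (𝓝 (1 / l * (∫ x, (z x ^ 2 - 1) ^ 2 ∂muI) + l * ∫ x, g x ^ 2 ∂muI)) := by
    simpa using ((hl.inv₀ hl0.ne').mul (hlam.tendsto_mul_wellSum hB hlim)).add
      ((hl.mul (hlam.tendsto_mul_numCells_sub_one.inv₀ one_ne_zero)).mul_const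
        (∫ x, g x ^ 2 ∂muI))
  refine ⟨y, hy, hlam.limsup_scaledHhf_le hdel hB ?_ hstep he ?_⟩
  · filter_upwards [hlam.eventually_le_numCells 2] with n hn
    simp only [ha]
    rwa [node_zero, node_self (by omega)]
  · filter_upwards [hlam.eventually_le_numCells 2] with n hn
    exact quadEnergy_primitive_node_le (hlam.pos n) (hdel.sqrt_two_mul.pos n) hg C hn rfl

theorem gammaConverges_limitFinite {lam del : ℕ → ℝ} (hlam : IsPosNullSeq lam)
    (hdel : IsPosNullSeq del) {l : ℝ} (hl0 : 0 < l)
    (hl : Tendsto (fun n => lam n / √(2 * del n)) atTop (𝓝 l)) :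
    GammaConverges (fun n => scaledHhf (lam n) (del n)) (limitFinite l) := by
  intro z
  refine ⟨fun y hy => hlam.le_liminf_scaledHhf hdel
    (fun φ κ a c hφ H => H.limitFinite_le hl0 (hl.comp hφ)) hy, ?_⟩
  by_cases hz : IsW12per z
  · obtain ⟨⟨-, g, hg, hzg⟩, w, hw, hzw, hper⟩ := id hz
    have hgi : Integrable g muI := hg.integrable one_le_two
    obtain ⟨C, hC⟩ := hzg.exists_ae_eq_primitive (L1.integrable_coeFn z) hgi
    have heq : Set.EqOn w (fun x => C + ∫ t in (0 : ℝ)..x, g t) (Set.Icc 0 1) :=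
      eqOn_Icc_of_ae_muI_eq hw ((continuousOn_integral hgi).const_add C) (hzw.symm.trans hC)
    rw [heq (by simp), heq (by simp)] at hper
    rw [limitFinite_eq hl0 hz hg hzg]
    exact exists_recovery_primitive hlam hdel hl0 hl hg hC hper
  · refine ⟨fun _ => z, tendsto_const_nhds, ?_⟩
    rw [limitFinite, if_neg hz]
    exact le_top

end SpinChain

theorem theorem4p1 (lam del : ℕ → ℝ)
    (hlam : ∀ n, 0 < lam n) (hlam0 : Tendsto lam atTop (𝓝 0))
    (hdel : ∀ n, 0 < del n) (hdel0 : Tendsto del atTop (𝓝 0)) :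
    (Tendsto (fun n => lam n / Real.sqrt (2 * del n)) atTop (𝓝 0) →
      SpinChain.GammaConverges (fun n => SpinChain.scaledHhf (lam n) (del n))
        SpinChain.limitZero) ∧
    (∀ l : ℝ, 0 < l → Tendsto (fun n => lam n / Real.sqrt (2 * del n)) atTop (𝓝 l) →
      SpinChain.GammaConverges (fun n => SpinChain.scaledHhf (lam n) (del n))
        (SpinChain.limitFinite l)) ∧
    (Tendsto (fun n => lam n / Real.sqrt (2 * del n)) atTop atTop →
      SpinChain.GammaConverges (fun n => SpinChain.scaledHhf (lam n) (del n))
        SpinChain.limitTop) := by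
  have hlam : SpinChain.IsPosNullSeq lam := ⟨hlam, hlam0⟩
  have hdel : SpinChain.IsPosNullSeq del := ⟨hdel, hdel0⟩
  exact ⟨SpinChain.gammaConverges_limitZero hlam hdel,
    fun _ hl0 hl => SpinChain.gammaConverges_limitFinite hlam hdel hl0 hl,
    SpinChain.gammaConverges_limitTop hlam hdel⟩
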